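/- Identify the Riemann sphere $\hat{\mathbb C}$ with the unit sphere $S^2\subset\mathbb R^3$ by stereographic projection and hyperbolic space $\mathbb H^3$ with the open unit ball (Poincaré ball model), so that $\hat{\mathbb C}=\partial\mathbb H^3$; $|\cdot|$ is the Euclidean norm of $\mathbb R^3$. A Jordan curve $\gamma\subset\hat{\mathbb C}$ is *asymptotically conformal* if $$\max_{w\in\gamma(a,b)}\frac{|a-w|+|w-b|}{|a-b|}\longrightarrow 1\qquad\text{as } a,b\in\gamma,\ a\ne b,\ |a-b|\to0,$$ where $\gamma(a,b)$ is the subarc of $\gamma$ of smaller diameter between $a$ and $b$. For a domain $\Omega\subset\hat{\mathbb C}$ that is the image of the unit disk $\mathbb D$ under a conformal map $f:\mathbb D\to\Omega$, let $\rho_\Omega$ be its Poincaré metric, the push-forward under $f$ of $4|d\zeta|^2/(1-|\zeta|^2)^2$. For $p\in\Omega$ let $\mathfrak H(p)=\{x\in\mathbb H^3:\nu_x(p)=\rho_\Omega(p)\}$, a horosphere based at $p$, where $\nu_x=\left(\frac{1-|x|^2}{|x-p|^2}\right)^2 g_{S^2}$ is the visual metric from $x$ (the pull-back of the round metric $g_{S^2}$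 under an isometry of $\mathbb H^3$ that sends $x$ to the origin). The *Epstein–Poincaré map* $\mathrm{Ep}_\Omega:\Omega\to\mathbb H^3$ is the unique smooth map such that, for every $p\in\Omega$, $\mathrm{Ep}_\Omega(p)\in\mathfrak H(p)$ and the image of the differential of $\mathrm{Ep}_\Omega$ at $p$ is tangent to $\mathfrak H(p)$. **Statement.** Let $\gamma\subset\hat{\mathbb C}$ be an asymptotically conformal Jordan curve, and let $\Omega,\Omega^*$ be the two connected components of $\hat{\mathbb C}\setminus\gamma$. Then: 1. there is an open neighborhood $U$ of $\gamma$ in $\hat{\mathbb C}$ such that the restrictions of $\mathrm{Ep}_\Omega$ to $U\cap\Omega$ and of $\mathrm{Ep}_{\Omega^*}$ to $U\cap\Omega^*$ are smooth immersions into $\mathbb H^3$ and embeddings (homeomorphisms onto their images); 2. $\mathrm{Ep}_\Omega$ and $\mathrm{Ep}_{\Omega^*}$ extend continuously, as maps to the closed ball $\mathbb H^3\cup\hat{\mathbb C}$, to $\Omega\cup\gamma$ and $\Omega^*\cup\gamma$ by the identity map on $\gamma$. -/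

import Mathlib

open Set Metric Topology
open scoped Manifold ContDiff

/-- Euclidean three-space. Its open unit ball is hyperbolic three-space (ball model). -/
abbrev E3 : Type := EuclideanSpace ℝ (Fin 3)

/-- The unit sphere of `E3`: the Riemann sphere (via stereographic projection) and the boundary
at infinity of the ball model of hyperbolic three-space. -/
abbrev S2 : Type := sphere (0 : E3) 1

/-- The open unit ball, i.e. hyperbolic three-space in the ball model. -/
def hyperbolicSpace : Set E3 := ball 0 1

/-! ### Jordan curves and asymptotic conformality -/

/-- `c` is a `1`-periodic parametrization of a Jordan curve in the sphere. -/
structure IsJordanParam (c : ℝ → S2) : Prop where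
  continuous : Continuous c
  periodic : Function.Periodic c 1
  injOn : InjOn c (Ico 0 1)

/-- `γ` is an asymptotically conformal Jordan curve: the maximum over `w ∈ γ(a, b)` of
`(|a - w| + |w - b|) / |a - b|` tends to `1` as `a, b ∈ γ` and `|a - b| → 0`, where `γ(a, b)` is the
subarc of smaller diameter of `γ` between `a` and `b`.

With `a = c s` and `b = c t`, `s ≤ t ≤ s + 1`, the two subarcs between `a` and `b` are
`c '' Icc s t` and `c '' Icc t (s + 1)`. -/
def IsAsymptoticallyConformal (γ : Set S2) : Prop :=
  ∃ c : ℝ → S2, IsJordanParam c ∧ range c = γ ∧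
    ∀ ε > 0, ∃ δ > 0, ∀ s t : ℝ, s ≤ t → t ≤ s + 1 → dist (c s) (c t) < δ →
      diam (c '' Icc s t) ≤ diam (c '' Icc t (s + 1)) →
      ∀ w ∈ c '' Icc s t, dist (c s) w + dist w (c t) ≤ (1 + ε) * dist (c s) (c t)

/-- `Ω` is a connected component of the set `A`. -/
def IsComponentOf (Ω A : Set S2) : Prop :=
  ∃ p ∈ A, Ω = connectedComponentIn A p

/-! ### The Poincaré metric -/

/-- `f` is a conformal map of the unit disk onto the subset `Ω` of the sphere (it may preserve or
reverse the orientation; this makes no difference for the hyperbolic metric of `Ω`). -/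
structure IsConformalOnto (f : ℂ → S2) (Ω : Set S2) : Prop where
  bijOn : BijOn f (ball 0 1) Ω
  smooth : ContDiffOn ℝ ∞ (fun ζ => (f ζ : E3)) (ball 0 1)
  conformal : ∀ ζ ∈ ball (0 : ℂ) 1, ConformalAt (fun ζ => (f ζ : E3)) ζ

/-- The push-forward under `f` of the hyperbolic metric `4 |dζ|² / (1 - |ζ|²)²` of the unit disk,
written as a density with respect to the round metric of the sphere. If `f` is a conformal map of
the disk onto `Ω`, this is the complete conformal metric of curvature `-1` on `Ω`, and it does not
depend on `f`. The norm of the differential of `f` is its conformal factor. -/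
noncomputable def poincareDensity (f : ℂ → S2) (p : S2) : ℝ :=
  let ζ := Function.invFunOn f (ball 0 1) p
  4 / ((1 - ‖ζ‖ ^ 2) ^ 2 * ‖fderiv ℝ (fun ζ => (f ζ : E3)) ζ‖ ^ 2)

/-! ### Epstein maps -/

/-- The visual metric at the point `x` of hyperbolic space (the pull-back of the round metric of the
sphere by an isometry sending `x` to the origin), as a density with respect to the round metric. -/
noncomputable def visualDensity (x : E3) (p : S2) : ℝ :=
  ((1 - ‖x‖ ^ 2) / ‖x - (p : E3)‖ ^ 2) ^ 2

/-- The horosphere based at `p` of the points from which the visual metric at `p` is `r`. -/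
def horosphere (p : S2) (r : ℝ) : Set E3 :=
  {x ∈ hyperbolicSpace | visualDensity x p = r}

/-- `E` is the Epstein map of the conformal metric `ρ` (a density with respect to the round metric)
on the open set `Ω`: the smooth map to hyperbolic space which solves the envelope equation of the
horospheres `horosphere p (ρ p)`. That is, `E p` lies on the horosphere at `p`, and the image of the
differential of `E` at `p` is tangent to this horosphere, a level set of `visualDensity · p`; in
other words it is orthogonal to the normal of the horosphere. -/
structure IsEpsteinMap (Ω : Set S2) (ρ : S2 → ℝ) (E : S2 → E3) : Prop where
  smooth : ContMDiffOn (𝓡 2) 𝓘(ℝ, E3) ∞ E Ω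
  mem_horosphere : ∀ p ∈ Ω, E p ∈ horosphere p (ρ p)
  tangent : ∀ p ∈ Ω, ∀ v : TangentSpace (𝓡 2) p,
    fderiv ℝ (fun x => visualDensity x p) (E p) (mfderiv (𝓡 2) 𝓘(ℝ, E3) E p v) = 0

open Classical in
/-- The Epstein map of the metric `ρ` on `Ω`. Only its values on `Ω` matter, and these are uniquely
determined. -/
noncomputable def epsteinMap (Ω : Set S2) (ρ : S2 → ℝ) : S2 → E3 :=
  if h : ∃ E, IsEpsteinMap Ω ρ E then h.choose else fun _ => 0

/-- The Epstein–Poincaré map of `Ω`, where `f` is a conformal map of the unit disk onto `Ω`. -/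
noncomputable def epsteinPoincareMap (Ω : Set S2) (f : ℂ → S2) : S2 → E3 :=
  epsteinMap Ω (poincareDensity f)

/-! ### The conclusions -/

/-- On the open subset `W` of the sphere, `E` is a smooth immersion into hyperbolic space and an
embedding. -/
structure IsImmersionEmbeddingOn (E : S2 → E3) (W : Set S2) : Prop where
  mapsTo : MapsTo E W hyperbolicSpace
  smooth : ContMDiffOn (𝓡 2) 𝓘(ℝ, E3) ∞ E W
  immersion : ∀ p ∈ W, Function.Injective (mfderiv (𝓡 2) 𝓘(ℝ, E3) E p)
  embedding : IsEmbedding (W.domRestrict E)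

/-- `E`, restricted to `Ω`, extends continuously to `Ω ∪ γ` by the identity map on `γ` (as a map to
the closed ball). -/
def ExtendsByIdentity (E : S2 → E3) (Ω γ : Set S2) : Prop :=
  ∃ F : S2 → E3, ContinuousOn F (Ω ∪ γ) ∧ EqOn F E Ω ∧ ∀ p ∈ γ, F p = (p : E3)

/-!
The theorem is local near `γ`, and each side of the curve is treated separately. For the component
`Ω`, stereographic projection from a point `q` of the other component turns `Ω` into a plane domain
bounded by a bounded Jordan curve, and hyperbolic space into the upper half-space `ℂ × (0, ∞)`. In
these coordinates the envelope equation can be solved explicitly (`envelope_iff`): the Epstein map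
of a metric `σ |dz|` sends `z` to a point that depends only on `σ z` and on the gradient of `log σ`
at `z`. This gives existence and uniqueness of the Epstein map (`IsFrame.epsteinMap_spec`). For the
hyperbolic metric it is a smooth function of the `2`-jet of the Riemann map (`epsteinJet`), and it
commutes with similarities of the plane (`planarEpstein_similarity`). For a half-plane it is
`w ↦ (i Im w, Re w)`, an isometry onto a vertical half-plane (`planarEpstein_cayley`).

Asymptotic conformality means that short arcs of the curve lie in thin ellipses around their chords.
Hence, seen from a point `z ∈ Ω` at the scale of its small distance `d` to the curve, the curve is
almost a line and `Ω` is almost a half-plane: it contains a disk of radius `R d` and misses another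
one, the two disks being almost tangent, with `R` as large as desired (`IsFlatCurve.exists_disks`).
That the second disk is not contained in `Ω` as well is a winding number argument
(`not_mem_of_isPreconnected`). Two applications of the Schwarz lemma and the Borel–Carathéodory
theorem show that the normalized Riemann map of `Ω` is then uniformly close to the one of the
half-plane (`exists_close_cayley`). By Cauchy estimates its derivatives are close as well, so the
rescaled Epstein map is `C¹`-close to an isometry on a large compact set
(`exists_planarEpstein_stable`).

Consequently the Epstein map moves `z` by at most a multiple of `d`, which gives the continuous
extension by the identity, and it is an immersion near the curve. It is injective near the curve:
the height of an Epstein point is comparable to the distance of `z` to the curve, so two points with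
the same image are seen at the same scale and lie in one compact set where the map is injective
(`exists_planarEpstein_injOn`). The extension by the identity is thus continuous and injective on a
compact neighbourhood of `γ` in `Ω ∪ γ`, hence an embedding (`exists_isImmersionEmbeddingOn`).
-/


/-! ### Closed curves satisfying a sharp three point condition -/

section Curve

variable {X : Type*} [MetricSpace X]

/-- If `c` is a simple closed curve, then nearby points have nearby parameters. -/
theorem exists_param_close {c : ℝ → X} (hcont : Continuous c) (hper : Function.Periodic c 1)
    (hinj : InjOn c (Ico 0 1)) {η : ℝ} (hη : 0 < η) :
    ∃ δ > 0, ∀ s t : ℝ, s ≤ t → t ≤ s + 1 → dist (c s) (c t) < δ → t - s < η ∨ s + 1 - t < η := by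
  -- by periodicity it suffices to consider pairs of parameters in a compact set
  set K : Set (ℝ × ℝ) := {x | x.1 ∈ Icc (0 : ℝ) 1 ∧ x.2 ∈ Icc (0 : ℝ) 2 ∧ x.1 + η ≤ x.2 ∧
    x.2 ≤ x.1 + 1 - η} with hK
  have hKc : IsCompact K := by
    refine (isCompact_Icc.prod isCompact_Icc : IsCompact (Icc (0 : ℝ) 1 ×ˢ Icc (0 : ℝ) 2))
      |>.of_isClosed_subset ?_ (fun x hx => ⟨hx.1, hx.2.1⟩)
    refine (isClosed_Icc.preimage continuous_fst).inter
      ((isClosed_Icc.preimage continuous_snd).inter (IsClosed.inter ?_ ?_))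
    · exact isClosed_le (f := fun x : ℝ × ℝ => x.1 + η) (g := fun x => x.2) (by fun_prop)
        (by fun_prop)
    · exact isClosed_le (f := fun x : ℝ × ℝ => x.2) (g := fun x => x.1 + 1 - η) (by fun_prop)
        (by fun_prop)
  have hfr : ∀ s, c (Int.fract s) = c s := fun s => by
    have := hper.sub_int_mul_eq ⌊s⌋ (x := s)
    rwa [mul_one] at this
  have hne : ∀ s t : ℝ, s < t → t < s + 1 → c s ≠ c t := by
    intro s t h1 h2 h
    rw [← hfr s, ← hfr t] at h
    have := hinj ⟨Int.fract_nonneg s, Int.fract_lt_one s⟩ ⟨Int.fract_nonneg t, Int.fract_lt_one t⟩ h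
    obtain ⟨n, hn⟩ := Int.fract_eq_fract.1 this
    have h3 : (-1 : ℝ) < n := by linarith
    have h4 : (n : ℝ) < 0 := by linarith
    have h3' : (-1 : ℤ) < n := by exact_mod_cast h3
    have h4' : n < (0 : ℤ) := by exact_mod_cast h4
    omega
  obtain ⟨δ, hδ, hmin⟩ : ∃ δ > 0, ∀ x ∈ K, δ ≤ dist (c x.1) (c x.2) := by
    rcases K.eq_empty_or_nonempty with h | h
    · exact ⟨1, one_pos, by simp [h]⟩
    · obtain ⟨x, hx, hm⟩ := hKc.exists_isMinOn h
        (f := fun x : ℝ × ℝ => dist (c x.1) (c x.2)) (by fun_prop)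
      refine ⟨_, dist_pos.2 (hne x.1 x.2 ?_ ?_), fun y hy => hm hy⟩
      · have := hx.2.2.1; linarith
      · have := hx.2.2.2; linarith
  refine ⟨δ, hδ, fun s t hst hts hd => ?_⟩
  by_contra! hcon
  have e1 : c (s - ⌊s⌋) = c s := hfr s
  have e2 : c (t - ⌊s⌋) = c t := by simpa using hper.sub_int_mul_eq ⌊s⌋ (x := t)
  have f0 := Int.fract_nonneg s
  have f1 := Int.fract_lt_one s
  rw [Int.fract] at f0 f1
  have := hmin (s - ⌊s⌋, t - ⌊s⌋) ⟨⟨f0, f1.le⟩, ⟨by linarith, by linarith⟩,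
    by simp only; linarith [hcon.1], by simp only; linarith [hcon.2]⟩
  simp only [e1, e2] at this
  linarith

/-- A simple closed curve, parametrized with period `1`, such that
`(|a - w| + |w - b|) / |a - b|` tends to `1` uniformly for `w` on short subarcs from `a` to `b`. -/
structure IsFlatCurve (c : ℝ → X) : Prop where
  continuous : Continuous c
  periodic : Function.Periodic c 1
  injOn : InjOn c (Ico 0 1)
  flat : ∀ ε > 0, ∃ η > 0, ∀ s u t : ℝ, s ≤ u → u ≤ t → t ≤ s + η →
    dist (c s) (c u) + dist (c u) (c t) ≤ (1 + ε) * dist (c s) (c t)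

/-- Around each point of a flat curve, at each small scale `r`, there is a subarc with end points at
distance `r` which is contained in a thin ellipse with foci at the end points, while the rest of the
curve stays at distance almost `r`. -/
theorem IsFlatCurve.exists_arc {c : ℝ → X} (hc : IsFlatCurve c) {ε : ℝ} (hε : 0 < ε) :
    ∃ δ > 0, ∀ s r : ℝ, 0 < r → r < δ → ∃ a b : ℝ, a ≤ s ∧ s ≤ b ∧ a < b ∧ b < a + 1 ∧
      dist (c a) (c s) = r ∧ dist (c s) (c b) = r ∧
      (∀ u ∈ Icc a b, dist (c a) (c u) + dist (c u) (c b) ≤ (1 + ε) * dist (c a) (c b)) ∧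
      ∀ u ∈ Icc b (a + 1), r ≤ (1 + ε) * dist (c s) (c u) := by
  obtain ⟨η, hη, hflat⟩ := hc.flat ε hε
  set η' := min (η / 2) (1 / 4) with hη'
  have hη'0 : 0 < η' := by positivity
  have h1 : η' ≤ η / 2 := min_le_left _ _
  have h2 : η' ≤ 1 / 4 := min_le_right _ _
  obtain ⟨δ, hδ, hA⟩ := exists_param_close hc.continuous hc.periodic hc.injOn hη'0
  refine ⟨δ, hδ, fun s r hr hrδ => ?_⟩
  have hcc := hc.continuous
  obtain ⟨b, hb, hbr⟩ : ∃ b ∈ Icc s (s + η'), dist (c s) (c b) = r := by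
    refine intermediate_value_Icc (f := fun b => dist (c s) (c b)) (by linarith) (by fun_prop)
      ⟨by simp [hr.le], ?_⟩
    by_contra! hcon
    rcases hA s (s + η') (by linarith) (by linarith) (hcon.trans hrδ) with h | h <;> linarith
  obtain ⟨a, ha, har⟩ : ∃ a ∈ Icc (s - η') s, dist (c a) (c s) = r := by
    refine intermediate_value_Icc' (f := fun b => dist (c b) (c s)) (by linarith) (by fun_prop)
      ⟨by simp [hr.le], ?_⟩
    by_contra! hcon
    rcases hA (s - η') s (by linarith) (by linarith) (hcon.trans hrδ) with h | h <;> linarith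
  have hsb : s < b := lt_of_le_of_ne hb.1 (fun h => by rw [h, dist_self] at hbr; linarith)
  refine ⟨a, b, ha.2, hb.1, lt_of_le_of_lt ha.2 hsb, by linarith [ha.1, hb.2], har, hbr,
    fun u hu => hflat a u b hu.1 hu.2 (by linarith [ha.1, hb.2]), fun u hu => ?_⟩
  by_cases hur : dist (c s) (c u) < δ
  · have hdn : 0 ≤ dist (c s) (c u) := dist_nonneg
    rcases hA s u (by linarith [hu.1]) (by linarith [hu.2, ha.2]) hur with h | h
    · have := hflat s b u hb.1 hu.1 (by linarith)
      have h0 : 0 ≤ dist (c b) (c u) := dist_nonneg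
      linarith
    · have := hflat (u - 1) a s (by linarith [hu.2]) ha.2 (by linarith)
      have e : c (u - 1) = c u := hc.periodic.sub_eq u
      rw [e] at this
      have h0 : 0 ≤ dist (c u) (c a) := dist_nonneg
      rw [dist_comm (c s) (c u)]
      linarith
  · nlinarith

end Curve

/-! ### Separation by a curve which is locally almost a line -/

/-- A sum of principal logarithms along the polygon `x 0, …, x n` seen from `q`. -/
noncomputable def logSum (x : ℕ → ℂ) (n : ℕ) (q : ℂ) : ℂ :=
  ∑ i ∈ Finset.range n, Complex.log ((x (i + 1) - q) / (x i - q))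

theorem div_mem_slitPlane_of_norm_sub_lt {x y q : ℂ} (h : ‖y - x‖ < ‖x - q‖) :
    (y - q) / (x - q) ∈ Complex.slitPlane := by
  have hx : x - q ≠ 0 := fun h0 => by rw [h0, norm_zero] at h; linarith [norm_nonneg (y - x)]
  have h1 : (y - q) / (x - q) = 1 + (y - x) / (x - q) := by field_simp; ring
  rw [h1]
  apply Complex.mem_slitPlane_of_norm_lt_one
  rw [norm_div, div_lt_one (norm_pos_iff.2 hx)]
  exact h

theorem continuousOn_logSum {x : ℕ → ℂ} {n : ℕ} {S : Set ℂ}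
    (h : ∀ i < n, ∀ q ∈ S, ‖x (i + 1) - x i‖ < ‖x i - q‖) : ContinuousOn (logSum x n) S := by
  refine continuousOn_finsetSum _ fun i hi => ?_
  have hi' := Finset.mem_range.1 hi
  refine ContinuousOn.clog ?_ fun q hq => div_mem_slitPlane_of_norm_sub_lt (h i hi' q hq)
  refine ContinuousOn.div (by fun_prop) (by fun_prop) fun q hq h0 => ?_
  have := h i hi' q hq
  rw [h0, norm_zero] at this
  linarith [norm_nonneg (x (i + 1) - x i)]

theorem exp_logSum {x : ℕ → ℂ} {n : ℕ} {q : ℂ} (h : ∀ i ≤ n, x i ≠ q) :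
    Complex.exp (logSum x n q) = (x n - q) / (x 0 - q) := by
  induction n with
  | zero => simp [logSum, div_self (sub_ne_zero.2 (h 0 le_rfl))]
  | succ n ih =>
    have h1 := sub_ne_zero.2 (h n (by omega))
    have h2 := sub_ne_zero.2 (h (n + 1) le_rfl)
    have h0 := sub_ne_zero.2 (h 0 (by omega))
    rw [logSum, Finset.sum_range_succ, Complex.exp_add]
    change Complex.exp (logSum x n q) * _ = _
    rw [ih fun i hi => h i (by omega), Complex.exp_log (div_ne_zero h2 h1)]
    field_simp

theorem log_div_of_re_pos {x y : ℂ} (hx : 0 < x.re) (hy : 0 < y.re) :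
    Complex.log (x / y) = Complex.log x - Complex.log y := by
  have hx0 : x ≠ 0 := fun h => by simp [h] at hx
  have hy0 : y ≠ 0 := fun h => by simp [h] at hy
  have ax := abs_lt.1 (Complex.abs_arg_lt_pi_div_two_iff.2 (Or.inl hx))
  have ay := abs_lt.1 (Complex.abs_arg_lt_pi_div_two_iff.2 (Or.inl hy))
  have hny : y.arg ≠ Real.pi := by linarith [Real.pi_pos]
  rw [div_eq_mul_inv, (Complex.log_mul_eq_add_log_iff hx0 (inv_ne_zero hy0)).2,
    Complex.log_inv y hny, sub_eq_add_neg]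
  rw [Complex.arg_inv, if_neg hny]
  constructor <;> linarith

/-- If the polygon lies in an open half-plane bounded by a line through `q`, then a branch of the
logarithm exists on this half-plane, and the sum telescopes. -/
theorem logSum_eq_of_re_pos {x : ℕ → ℂ} {n : ℕ} {q κ : ℂ}
    (h : ∀ i ≤ n, 0 < (κ * (x i - q)).re) :
    logSum x n q = Complex.log (κ * (x n - q)) - Complex.log (κ * (x 0 - q)) := by
  have hκ : κ ≠ 0 := fun h0 => by have := h 0 (by omega); simp [h0] at this
  have : ∀ i ∈ Finset.range n, Complex.log ((x (i + 1) - q) / (x i - q)) =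
      Complex.log (κ * (x (i + 1) - q)) - Complex.log (κ * (x i - q)) := by
    intro i hi
    have hi' := Finset.mem_range.1 hi
    rw [← log_div_of_re_pos (h _ (by omega)) (h _ (by omega)), mul_div_mul_left _ _ hκ]
  rw [logSum, Finset.sum_congr rfl this]
  exact Finset.sum_range_sub (fun i => Complex.log (κ * (x i - q))) n

/-- A continuous function with values in `2πiℤ` is constant on a connected set. -/
theorem im_eq_of_exp_eq_one {S : Set ℂ} (hS : IsPreconnected S) {g : ℂ → ℂ}
    (hg : ContinuousOn g S) (h1 : ∀ q ∈ S, Complex.exp (g q) = 1) {x y : ℂ} (hx : x ∈ S)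
    (hy : y ∈ S) : (g x).im = (g y).im := by
  have key : ∀ x ∈ S, ∀ y ∈ S, ¬ (g x).im < (g y).im := by
    intro x hx y hy hlt
    obtain ⟨n, hn⟩ := Complex.exp_eq_one_iff.1 (h1 x hx)
    obtain ⟨m, hm⟩ := Complex.exp_eq_one_iff.1 (h1 y hy)
    have hpi := Real.pi_pos
    have en : (g x).im = n * (2 * Real.pi) := by rw [hn]; simp
    have em : (g y).im = m * (2 * Real.pi) := by rw [hm]; simp
    have hnm : n < m := by
      have : (n : ℝ) < m := by
        rw [en, em] at hlt
        exact lt_of_mul_lt_mul_right hlt (by positivity)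
      exact_mod_cast this
    have hnm' : (n : ℝ) + 1 ≤ m := by exact_mod_cast hnm
    obtain ⟨q, hq, hqv⟩ := hS.intermediate_value hx hy
      (Complex.continuous_im.comp_continuousOn hg)
      (show ((n : ℝ) + 1 / 2) * (2 * Real.pi) ∈ Icc _ _ by
        constructor
        · simp only [Function.comp, en]; nlinarith
        · simp only [Function.comp, em]; nlinarith)
    obtain ⟨k, hk⟩ := Complex.exp_eq_one_iff.1 (h1 q hq)
    have ek : (g q).im = k * (2 * Real.pi) := by rw [hk]; simp
    simp only [Function.comp] at hqv
    rw [ek] at hqv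
    have h3 : (k : ℝ) = n + 1 / 2 := mul_right_cancel₀ (by positivity) hqv
    have h4 : ((2 * k : ℤ) : ℝ) = ((2 * n + 1 : ℤ) : ℝ) := by push_cast; linarith
    have h5 : 2 * k = 2 * n + 1 := by exact_mod_cast h4
    omega
  exact le_antisymm (not_lt.1 (key y hy x hx)) (not_lt.1 (key x hx y hy))


theorem exists_pos_le_norm_sub {A B : Set ℂ} (hA : IsCompact A) (hB : IsCompact B)
    (hAB : Disjoint A B) : ∃ d > 0, ∀ x ∈ A, ∀ y ∈ B, d ≤ ‖x - y‖ := by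
  obtain ⟨r, hr, h⟩ := Metric.exists_pos_forall_lt_edist hA hB.isClosed hAB
  refine ⟨r, by exact_mod_cast hr, fun x hx y hy => ?_⟩
  have := h x hx y hy
  rw [edist_nndist] at this
  have h2 : r < nndist x y := by exact_mod_cast this
  rw [← dist_eq_norm]
  exact_mod_cast h2.le

/-- A closed curve which consists of an arc close to the real axis and of an arc avoiding the unit
disk separates two opposite points above and below the real axis. Indeed the winding numbers of the
curve around the two points, computed by sums of logarithms along a fine partition, differ
by `1`. -/
theorem not_mem_of_isPreconnected {c : ℝ → ℂ} (hcont : Continuous c) {a b θ : ℝ} (hab : a < b)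
    (hba : b < a + 1) (hper : c (a + 1) = c a) (him : ∀ u ∈ Icc a b, |(c u).im| ≤ θ)
    (ha : (c a).re < -1) (hb : 1 < (c b).re) (hlong : ∀ u ∈ Icc b (a + 1), 1 < ‖c u‖)
    {w : ℂ} (hw : ‖w‖ ≤ 1) (hwim : θ < w.im) {K : Set ℂ} (hKc : IsCompact K)
    (hKp : IsPreconnected K) (hK : ∀ u ∈ Icc a (a + 1), c u ∉ K) (hwK : w ∈ K) : -w ∉ K := by
  intro hwK'
  set S := segment ℝ w (-w) with hS
  have hSball : S ⊆ closedBall 0 1 := (convex_closedBall (0 : ℂ) 1).segment_subset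
    (by simpa using hw) (by simpa using hw)
  have hSp : IsPreconnected S := (convex_segment _ _).isPreconnected
  have hSc : IsCompact S := by
    rw [hS, segment_eq_image_lineMap]
    exact isCompact_Icc.image (by exact AffineMap.lineMap_continuous)
  obtain ⟨d1, hd1, h1⟩ := exists_pos_le_norm_sub
    ((isCompact_Icc (a := a) (b := a + 1)).image hcont) hKc (by
      rw [disjoint_left]; rintro _ ⟨u, hu, rfl⟩; exact hK u hu)
  obtain ⟨d2, hd2, h2⟩ := exists_pos_le_norm_sub
    ((isCompact_Icc (a := b) (b := a + 1)).image hcont) hSc (by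
      rw [disjoint_left]; rintro _ ⟨u, hu, rfl⟩ h
      have := hSball h
      rw [mem_closedBall_zero_iff] at this
      linarith [hlong u hu])
  obtain ⟨δ, hδ, hU⟩ := Metric.uniformContinuousOn_iff.1
    ((isCompact_Icc (a := a) (b := a + 1)).uniformContinuousOn_of_continuous hcont.continuousOn)
    (min d1 d2) (lt_min hd1 hd2)
  obtain ⟨M, hM⟩ := exists_nat_one_div_lt hδ
  set n := M + 1 with hn
  have hn0 : (0 : ℝ) < n := by positivity
  have hnδ : 1 / (n : ℝ) < δ := by rw [hn]; push_cast; exact hM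
  -- two partitions, of the arc close to the real axis and of the remaining arc
  set x : ℕ → ℂ := fun i => c (a + i * ((b - a) / n)) with hx
  set y : ℕ → ℂ := fun i => c (b + i * ((a + 1 - b) / n)) with hy
  have hpar : ∀ p l : ℝ, 0 < l → l ≤ 1 → ∀ i ≤ n, p ≤ p + i * (l / n) ∧ p + i * (l / n) ≤ p + l := by
    intro p l hl _ i hi
    have hi' : (i : ℝ) ≤ n := by exact_mod_cast hi
    refine ⟨by have : 0 ≤ (i : ℝ) * (l / n) := by positivity
               linarith, ?_⟩
    have : (i : ℝ) * (l / n) = l * (i / n) := by ring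
    rw [this]
    have : (i : ℝ) / n ≤ 1 := (div_le_one hn0).2 hi'
    nlinarith
  have hstep : ∀ p l : ℝ, 0 < l → l ≤ 1 → ∀ i : ℕ,
      dist (p + (i + 1 : ℕ) * (l / n)) (p + i * (l / n)) < δ := by
    intro p l hl hl1 i
    have : p + (i + 1 : ℕ) * (l / n) - (p + i * (l / n)) = l / n := by push_cast; ring
    rw [Real.dist_eq, this, abs_of_pos (by positivity)]
    exact lt_of_le_of_lt (div_le_div_of_nonneg_right hl1 hn0.le) hnδ
  have hxI : ∀ i ≤ n, a + i * ((b - a) / n) ∈ Icc a b := fun i hi => by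
    have := hpar a (b - a) (by linarith) (by linarith) i hi
    exact ⟨this.1, by linarith [this.2]⟩
  have hyI : ∀ i ≤ n, b + i * ((a + 1 - b) / n) ∈ Icc b (a + 1) := fun i hi => by
    have := hpar b (a + 1 - b) (by linarith) (by linarith) i hi
    exact ⟨this.1, by linarith [this.2]⟩
  have hIccx : Icc a b ⊆ Icc a (a + 1) := Icc_subset_Icc_right hba.le
  have hIccy : Icc b (a + 1) ⊆ Icc a (a + 1) := Icc_subset_Icc_left hab.le
  have hxs : ∀ i < n, ‖x (i + 1) - x i‖ < min d1 d2 := fun i hi => by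
    rw [← dist_eq_norm]
    exact hU _ (hIccx (hxI _ hi)) _ (hIccx (hxI _ hi.le))
      (hstep a (b - a) (by linarith) (by linarith) i)
  have hys : ∀ i < n, ‖y (i + 1) - y i‖ < min d1 d2 := fun i hi => by
    rw [← dist_eq_norm]
    exact hU _ (hIccy (hyI _ hi)) _ (hIccy (hyI _ hi.le))
      (hstep b (a + 1 - b) (by linarith) (by linarith) i)
  have hx0 : x 0 = c a := by simp [hx]
  have hxn : x n = c b := by simp only [hx]; congr 1; field_simp; ring
  have hy0 : y 0 = c b := by simp [hy]
  have hyn : y n = c a := by rw [← hper]; simp only [hy]; congr 1; field_simp; ring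
  have hxK : ∀ i ≤ n, ∀ q ∈ K, d1 ≤ ‖x i - q‖ := fun i hi q hq =>
    h1 _ (mem_image_of_mem _ (hIccx (hxI i hi))) q hq
  have hyK : ∀ i ≤ n, ∀ q ∈ K, d1 ≤ ‖y i - q‖ := fun i hi q hq =>
    h1 _ (mem_image_of_mem _ (hIccy (hyI i hi))) q hq
  have hyS : ∀ i ≤ n, ∀ q ∈ S, d2 ≤ ‖y i - q‖ := fun i hi q hq =>
    h2 _ (mem_image_of_mem _ (hyI i hi)) q hq
  have hneof : ∀ {d : ℝ} {p q : ℂ}, 0 < d → d ≤ ‖p - q‖ → p ≠ q := by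
    rintro d p q hd h rfl; simp at h; linarith
  -- the sum over both arcs is constant on `K`
  have hconst : (logSum x n w + logSum y n w).im = (logSum x n (-w) + logSum y n (-w)).im := by
    refine im_eq_of_exp_eq_one hKp (g := fun q => logSum x n q + logSum y n q) ?_ ?_ hwK hwK'
    · exact (continuousOn_logSum fun i hi q hq => ((hxs i hi).trans_le (min_le_left _ _)).trans_le
        (hxK i hi.le q hq)).add
        (continuousOn_logSum fun i hi q hq => ((hys i hi).trans_le (min_le_left _ _)).trans_le
        (hyK i hi.le q hq))
    · intro q hq
      have e1 := hneof hd1 (hxK 0 (by omega) q hq)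
      have e2 := hneof hd1 (hyK 0 (by omega) q hq)
      rw [hx0] at e1; rw [hy0] at e2
      rw [Complex.exp_add, exp_logSum fun i hi => hneof hd1 (hxK i hi q hq),
        exp_logSum fun i hi => hneof hd1 (hyK i hi q hq), hx0, hxn, hy0, hyn]
      have := sub_ne_zero.2 e1
      have := sub_ne_zero.2 e2
      field_simp
  -- real parts seen from points of the unit disk
  have hre : ∀ q ∈ closedBall (0 : ℂ) 1, 0 < (q - c a).re ∧ 0 < (c b - q).re := by
    intro q hq
    rw [mem_closedBall_zero_iff] at hq
    have := abs_le.1 ((Complex.abs_re_le_norm q).trans hq)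
    constructor <;> simp only [Complex.sub_re] <;> linarith
  -- the sum over the arc outside the disk is a branch of a logarithm on the segment
  have hlongsum : (logSum y n w - (Complex.log (w - c a) - Complex.log (c b - w)) - Real.pi * Complex.I).im
      = (logSum y n (-w) - (Complex.log (-w - c a) - Complex.log (c b - -w)) - Real.pi * Complex.I).im := by
    refine im_eq_of_exp_eq_one hSp (g := fun q => logSum y n q - (Complex.log (q - c a) -
      Complex.log (c b - q)) - Real.pi * Complex.I) ?_ ?_ (left_mem_segment _ _ _)
      (right_mem_segment _ _ _)
    · refine ((continuousOn_logSum fun i hi q hq => ((hys i hi).trans_le (min_le_right _ _)).trans_le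
        (hyS i hi.le q hq)).sub (ContinuousOn.sub ?_ ?_)).sub continuousOn_const
      · exact ContinuousOn.clog (by fun_prop) fun q hq => Or.inl (hre q (hSball hq)).1
      · exact ContinuousOn.clog (by fun_prop) fun q hq => Or.inl (hre q (hSball hq)).2
    · intro q hq
      obtain ⟨r1, r2⟩ := hre q (hSball hq)
      have n1 : q - c a ≠ 0 := fun h => by rw [h] at r1; simp at r1
      have n2 : c b - q ≠ 0 := fun h => by rw [h] at r2; simp at r2
      rw [Complex.exp_sub, Complex.exp_sub, Complex.exp_sub, Complex.exp_log n1, Complex.exp_log n2,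
        exp_logSum fun i hi => hneof hd2 (hyS i hi q hq), hy0, hyn, Complex.exp_pi_mul_I]
      have n3 : c a - q ≠ 0 := fun h => n1 (by rw [← neg_sub, h, neg_zero])
      have e : c a - q = -(q - c a) := by ring
      rw [e]
      field_simp
  -- the sum over the arc close to the axis, seen from the two points
  have hIw : ∀ i ≤ n, 0 < (Complex.I * (x i - w)).re := fun i hi => by
    have := abs_le.1 (him _ (hxI i hi))
    simp [hx]; linarith
  have hIw' : ∀ i ≤ n, 0 < (-Complex.I * (x i - -w)).re := fun i hi => by
    have := abs_le.1 (him _ (hxI i hi))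
    simp [hx]; linarith
  have s1 := logSum_eq_of_re_pos hIw
  have s2 := logSum_eq_of_re_pos hIw'
  have key : ∀ B : ℂ, 0 < B.re → 0 < (Complex.I * B).re →
      (Complex.log (Complex.I * B)).im = (Complex.log B).im + Real.pi / 2 := by
    intro B hB hIB
    have hB0 : B ≠ 0 := fun h => by simp [h] at hB
    have aB := abs_lt.1 (Complex.abs_arg_lt_pi_div_two_iff.2 (Or.inl hB))
    rw [(Complex.log_mul_eq_add_log_iff Complex.I_ne_zero hB0).2]
    · simp [Complex.log_im, add_comm]
    · rw [Complex.arg_I]; constructor <;> linarith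
  have key' : ∀ B : ℂ, 0 < B.re → 0 < (-Complex.I * B).re →
      (Complex.log (-Complex.I * B)).im = (Complex.log B).im - Real.pi / 2 := by
    intro B hB hIB
    have hB0 : B ≠ 0 := fun h => by simp [h] at hB
    have aB := abs_lt.1 (Complex.abs_arg_lt_pi_div_two_iff.2 (Or.inl hB))
    rw [(Complex.log_mul_eq_add_log_iff (neg_ne_zero.2 Complex.I_ne_zero) hB0).2]
    · rw [Complex.add_im, Complex.log_im (-Complex.I), Complex.arg_neg_I]; ring
    · rw [Complex.arg_neg_I]; constructor <;> linarith
  obtain ⟨p1, p2⟩ := hre w (hSball (left_mem_segment _ _ _))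
  obtain ⟨p3, p4⟩ := hre (-w) (hSball (right_mem_segment _ _ _))
  have q1 := key (c b - w) p2 (by have := hIw n le_rfl; rwa [hxn] at this)
  have q2 := key' (w - c a) p1 (by
    have := hIw 0 (by omega); rw [hx0] at this
    rwa [show -Complex.I * (w - c a) = Complex.I * (c a - w) by ring])
  have q3 := key' (c b - -w) p4 (by have := hIw' n le_rfl; rwa [hxn] at this)
  have q4 := key (-w - c a) p3 (by
    have := hIw' 0 (by omega); rw [hx0] at this
    rwa [show Complex.I * (-w - c a) = -Complex.I * (c a - -w) by ring])
  -- the two sums over the whole curve would differ by `2πi`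
  rw [show -Complex.I * (w - c a) = Complex.I * (c a - w) by ring] at q2
  rw [show Complex.I * (-w - c a) = -Complex.I * (c a - -w) by ring] at q4
  rw [hxn, hx0] at s1 s2
  simp only [s1, s2, Complex.add_im, Complex.sub_im] at hconst hlongsum
  have := Real.pi_pos
  linarith


/-- Near the curve and at the scale of the distance `d` to the curve, a flat curve is, after a
similarity `x ↦ m (x - c s)`, an almost horizontal arc through `0` and a rest that is far away; the
point at distance `d` from the curve is nearly `± I`. -/
theorem IsFlatCurve.exists_normal_form {c : ℝ → ℂ} (hc : IsFlatCurve c) {N θ : ℝ} (hN : 4 ≤ N)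
    (hθ : 0 < θ) (hθ1 : θ ≤ 1) : ∃ δ > 0, ∀ (z : ℂ) (d : ℝ), d = infDist z (range c) → 0 < d →
      d < δ → ∃ (m : ℂ) (s a b : ℝ), ‖m‖ * d = 1 ∧ ‖z - c s‖ = d ∧ a < b ∧ b < a + 1 ∧
        (m * (c a - c s)).re < -1 ∧ 1 < (m * (c b - c s)).re ∧
        (∀ u ∈ Icc a b, |(m * (c u - c s)).im| ≤ θ) ∧
        (∀ u ∈ Icc b (a + 1), N / 2 < ‖m * (c u - c s)‖) ∧ 1 - θ ≤ |(m * (z - c s)).im| := by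
  -- an ellipse with foci at distance `l` and sum of distances `(1 + ε) l` has a semi-minor axis of
  -- about `√(ε / 2) l`, which has to be less than `θ d / 2`, where `l ≤ 2 N d`
  obtain ⟨ε, hε⟩ : ∃ ε, ε = θ ^ 2 / (12 * N ^ 2) := ⟨_, rfl⟩
  have hε0 : 0 < ε := by rw [hε]; positivity
  have hεN : 12 * ε * N ^ 2 = θ ^ 2 := by rw [hε]; field_simp
  have hε1 : ε < 1 / 4 := by
    rw [hε, div_lt_iff₀ (by positivity)]
    have h1 : θ ^ 2 ≤ 1 := pow_le_one₀ hθ.le hθ1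
    have h2 : (4 : ℝ) ^ 2 ≤ N ^ 2 := by gcongr
    linarith
  obtain ⟨δ, hδ, harc⟩ := hc.exists_arc hε0
  have hcc := hc.continuous
  refine ⟨δ / N, by positivity, fun z d hd hd0 hdδ => ?_⟩
  obtain ⟨_, ⟨s, rfl⟩, hs⟩ := (hc.periodic.compact_of_continuous one_ne_zero
    hc.continuous).exists_infDist_eq_dist (range_nonempty c) z
  rw [← hd] at hs
  have hdmin : ∀ u, d ≤ ‖z - c u‖ := fun u => by
    rw [hd, ← dist_eq_norm]; exact infDist_le_dist_of_mem (mem_range_self u)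
  obtain ⟨a, b, has, hsb, hab, hba, ha, hb, harc, hlong⟩ := harc s (N * d) (by positivity)
    (by rwa [lt_div_iff₀ (by linarith), mul_comm] at hdδ)
  set l := dist (c a) (c b) with hl
  have hl1 : 2 * (N * d) ≤ (1 + ε) * l := by have := harc s ⟨has, hsb⟩; rw [ha, hb] at this; linarith
  have hl2 : l ≤ 2 * (N * d) := by have := dist_triangle (c a) (c s) (c b); linarith
  have hNd : 0 < N * d := by positivity
  have hl0 : 0 < l := by
    by_contra! h
    have := mul_nonpos_of_nonneg_of_nonpos (by positivity : 0 ≤ 1 + ε) h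
    linarith
  have hlc : ‖c b - c a‖ = l := by rw [hl, dist_comm, dist_eq_norm]
  set m : ℂ := (starRingEnd ℂ) (c b - c a) / ((l * d : ℝ) : ℂ) with hm
  have hmn : ‖m‖ = 1 / d := by
    rw [hm, norm_div, Complex.norm_conj, hlc, Complex.norm_real, Real.norm_of_nonneg (by positivity)]
    field_simp
  have hmab : m * (c b - c a) = ((l / d : ℝ) : ℂ) := by
    rw [hm, div_mul_eq_mul_div, ← Complex.normSq_eq_conj_mul_self, Complex.normSq_eq_norm_sq, hlc,
      ← Complex.ofReal_div]
    congr 1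
    field_simp
  set L := l / d with hL
  have hL1 : 2 * N ≤ (1 + ε) * L := by
    rw [hL, ← mul_div_assoc, le_div_iff₀ hd0]; linarith
  have hL2 : L ≤ 2 * N := by rw [hL, div_le_iff₀ hd0]; linarith
  have hL0 : 0 < L := by positivity
  have hdist : ∀ x y : ℂ, ‖m * (x - y)‖ = dist x y / d := fun x y => by
    rw [norm_mul, hmn, dist_eq_norm]; ring
  -- the ellipse is thin
  have hell : ∀ u ∈ Icc a b, |(m * (c u - c a)).im| ≤ θ / 2 := by
    intro u hu
    have h1 : ‖m * (c u - c a)‖ + ‖m * (c b - c u)‖ ≤ (1 + ε) * L := by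
      rw [hdist, hdist, ← add_div, hL, ← mul_div_assoc]
      have := harc u hu
      rw [dist_comm (c u), dist_comm (c b)]
      gcongr
    set Z := m * (c u - c a) + (starRingEnd ℂ) (m * (c b - c u)) with hZ
    have hZn : ‖Z‖ ≤ (1 + ε) * L := (norm_add_le _ _).trans (by rwa [Complex.norm_conj])
    have hsum : m * (c b - c u) = (L : ℂ) - m * (c u - c a) := by rw [← hmab]; ring
    have hre : Z.re = L := by rw [hZ, hsum]; simp; ring
    have him : Z.im = 2 * (m * (c u - c a)).im := by rw [hZ, hsum]; simp; ring
    have hsq : Z.re ^ 2 + Z.im ^ 2 ≤ ((1 + ε) * L) ^ 2 := by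
      have : ‖Z‖ ^ 2 = Z.re ^ 2 + Z.im ^ 2 := by
        rw [← Complex.normSq_eq_norm_sq, Complex.normSq_apply]; ring
      rw [← this]
      gcongr
    rw [hre, him] at hsq
    have h3 : L ^ 2 ≤ (2 * N) ^ 2 := by gcongr
    have h4 : (2 * (m * (c u - c a)).im) ^ 2 ≤ θ ^ 2 := by
      have h5 : ((1 + ε) * L) ^ 2 = L ^ 2 + 2 * ε * L ^ 2 + ε * (ε * L ^ 2) := by ring
      have h6 : ε * (ε * L ^ 2) ≤ 1 * (ε * L ^ 2) := by gcongr; linarith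
      have h7 : ε * L ^ 2 ≤ ε * (2 * N) ^ 2 := by gcongr
      have h8 : ε * (2 * N) ^ 2 = 4 * (ε * N ^ 2) := by ring
      linarith
    have := abs_le.1 (abs_le_of_sq_le_sq h4 hθ.le)
    rw [abs_le]
    constructor <;> linarith [this.1, this.2]
  have hCa : |(m * (c a - c s)).im| ≤ θ / 2 := by
    have := hell s ⟨has, hsb⟩
    rwa [← neg_sub, mul_neg, Complex.neg_im, abs_neg] at this
  have hNa : ‖m * (c a - c s)‖ = N := by rw [hdist, ha]; field_simp
  have hNb : ‖m * (c b - c s)‖ = N := by rw [hdist, dist_comm, hb]; field_simp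
  have hre : (m * (c b - c s)).re - (m * (c a - c s)).re = L := by
    rw [← Complex.sub_re, ← mul_sub, sub_sub_sub_cancel_right, hmab, Complex.ofReal_re]
  have hra := abs_le.1 (hNa ▸ Complex.abs_re_le_norm (m * (c a - c s)))
  have hrb := abs_le.1 (hNb ▸ Complex.abs_re_le_norm (m * (c b - c s)))
  have hLN : N + 1 < L := by
    have : (1 + ε) * L ≤ 5 / 4 * L := by gcongr; linarith
    linarith
  have hw : ‖m * (z - c s)‖ = 1 := by rw [hdist, ← hs]; field_simp
  have him : ∀ u ∈ Icc a b, |(m * (c u - c s)).im| ≤ θ := by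
    intro u hu
    have e : m * (c u - c s) = m * (c u - c a) + m * (c a - c s) := by ring
    rw [e, Complex.add_im]
    have := abs_add_le (m * (c u - c a)).im (m * (c a - c s)).im
    linarith [hell u hu]
  refine ⟨m, s, a, b, by rw [hmn]; field_simp, by rw [← dist_eq_norm, hs], hab, hba, by linarith,
    by linarith, him, ?_, ?_⟩
  · intro u hu
    have := hlong u hu
    have h0 : 0 ≤ dist (c s) (c u) := dist_nonneg
    rw [hdist, dist_comm, lt_div_iff₀ hd0]
    have h1 : (1 + ε) * dist (c s) (c u) ≤ 5 / 4 * dist (c s) (c u) := by gcongr; linarith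
    linarith
  · have hrw := abs_le.1 (hw ▸ Complex.abs_re_le_norm (m * (z - c s)))
    obtain ⟨u, hu, hue⟩ := intermediate_value_Icc hab.le
      (f := fun u => (m * (c u - c s)).re) (by fun_prop)
      (show (m * (z - c s)).re ∈ Icc _ _ from ⟨by linarith, by linarith⟩)
    have h1 : 1 ≤ ‖m * (z - c u)‖ := by
      rw [norm_mul, hmn, one_div, ← div_eq_inv_mul, le_div_iff₀ hd0, one_mul]
      exact hdmin u
    have e : m * (z - c u) = m * (z - c s) - m * (c u - c s) := by ring
    have h2 : (m * (z - c u)).re = 0 := by rw [e, Complex.sub_re]; simp only at hue; linarith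
    have h3 : (m * (z - c u)).im = (m * (z - c s)).im - (m * (c u - c s)).im := by
      rw [e, Complex.sub_im]
    have h4 := Complex.norm_le_abs_re_add_abs_im (m * (z - c u))
    rw [h2, abs_zero, zero_add, h3] at h4
    have h5 := abs_sub (m * (z - c s)).im (m * (c u - c s)).im
    linarith [him u hu]

/-- An open connected set `Ω`, disjoint from `γ`, which contains every connected set that is
disjoint from `γ` and meets `Ω`: a component of the complement of `γ`. -/
structure IsPlanarComponent (Ω γ : Set ℂ) : Prop where
  isOpen : IsOpen Ω
  isPreconnected : IsPreconnected Ω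
  disjoint : Disjoint Ω γ
  subset_of_isPreconnected : ∀ A : Set ℂ, IsPreconnected A → Disjoint A γ → (A ∩ Ω).Nonempty → A ⊆ Ω

/-- A component of the complement of a flat curve lies, near each of its points close to the curve
and at the scale of the distance to the curve, between two disks of large radius which nearly touch
each other. The second one is contained in another component. -/
theorem IsFlatCurve.exists_disks {c : ℝ → ℂ} (hc : IsFlatCurve c) {Ω : Set ℂ}
    (hΩ : IsPlanarComponent Ω (range c)) {R : ℝ} (hR : 2 ≤ R) :
    ∃ δ > 0, ∀ z ∈ Ω, infDist z (range c) < δ → ∃ (p u : ℂ) (d : ℝ),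
      d = infDist z (range c) ∧ 0 < d ∧ ‖u‖ = 1 ∧ p ∈ range c ∧ z = p + d * u ∧
      (∀ w ∈ ball ((R + 1 / R : ℝ) : ℂ) R, p + d * u * w ∈ Ω) ∧
      ∀ w ∈ ball (-((R + 1 / R : ℝ) : ℂ)) R, p + d * u * w ∉ Ω := by
  -- `N` is such that the disks, of diameter `2 R`, do not reach the far part of the curve, and `θ` is
  -- such that the near part stays within `1 / (2 R)` of the line between them
  obtain ⟨N, hN⟩ : ∃ N, N = 4 * R + 4 := ⟨_, rfl⟩
  obtain ⟨θ, hθ⟩ : ∃ θ, θ = 1 / (32 * N ^ 2 * R ^ 2) := ⟨_, rfl⟩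
  have hN0 : 0 < N := by rw [hN]; positivity
  have hR0 : 0 < R := by positivity
  have hθ0 : 0 < θ := by rw [hθ]; positivity
  have hθN : 2 * θ = (1 / (4 * N * R)) ^ 2 := by rw [hθ]; field_simp; norm_num
  have hθR : θ ≤ 1 / (4 * R) := by
    rw [hθ]
    apply one_div_le_one_div_of_le (by positivity)
    have h1 : 1 ≤ N ^ 2 := one_le_pow₀ (by linarith)
    have h2 : R ≤ R ^ 2 := le_self_pow₀ (by linarith) two_ne_zero
    have h3 : 1 * R ^ 2 ≤ N ^ 2 * R ^ 2 := by gcongr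
    linarith
  have hθ1 : θ ≤ 1 / 8 := hθR.trans (one_div_le_one_div_of_le (by norm_num) (by linarith))
  obtain ⟨δ, hδ, hnf⟩ := hc.exists_normal_form (N := N) (by linarith) hθ0 (by linarith)
  refine ⟨δ, hδ, fun z hz hzδ => ?_⟩
  have hcl : IsClosed (range c) := (hc.periodic.compact_of_continuous one_ne_zero
    hc.continuous).isClosed
  have hd0 : 0 < infDist z (range c) :=
    (hcl.notMem_iff_infDist_pos (range_nonempty c)).1 (disjoint_left.1 hΩ.disjoint hz)
  obtain ⟨m, s, a, b, hm, hs, hab, hba, ha, hb, him, hlong, hzim⟩ := hnf z _ rfl hd0 hzδ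
  set d := infDist z (range c) with hd
  have hm0 : m ≠ 0 := fun h => by simp [h] at hm
  set w := m * (z - c s) with hw
  have hw1 : ‖w‖ = 1 := by rw [hw, norm_mul, hs, hm]
  have hw0 : w ≠ 0 := fun h => by simp [h] at hw1
  have hdC : (d : ℂ) ≠ 0 := by exact_mod_cast hd0.ne'
  set u := (z - c s) / d with hu
  have hdu : d * u = z - c s := by rw [hu]; field_simp
  have hmu : m * (d * u) = w := by rw [hdu]
  have hwre : |w.re| ≤ 1 / (4 * N * R) := by
    apply abs_le_of_sq_le_sq _ (by positivity)
    have : ‖w‖ ^ 2 = w.re ^ 2 + w.im ^ 2 := by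
      rw [← Complex.normSq_eq_norm_sq, Complex.normSq_apply]; ring
    rw [hw1] at this
    have h2 : (1 - θ) ^ 2 ≤ w.im ^ 2 := by rw [← sq_abs w.im]; gcongr; linarith
    have h3 : (1 - θ) ^ 2 = 1 - 2 * θ + θ ^ 2 := by ring
    linarith [sq_nonneg θ]
  -- points of the curve avoid both disks
  have havoid : ∀ σ : ℂ, (σ = 1 ∨ σ = -1) → ∀ x ∈ ball (σ * ((R + 1 / R : ℝ) : ℂ)) R,
      c s + d * u * x ∉ range c := by
    rintro σ hσ x hx ⟨t, ht⟩
    obtain ⟨t', ht', hte⟩ := hc.periodic.exists_mem_Ico one_pos t a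
    rw [hte] at ht
    have hσn : ‖σ‖ = 1 := by rcases hσ with rfl | rfl <;> simp
    have hRR : 1 / R ≤ 1 := by rw [div_le_one hR0]; linarith
    have hxn : ‖x‖ < 2 * R + 1 := by
      have h1 := mem_ball_iff_norm.1 hx
      have h2 := norm_sub_norm_le x (σ * ((R + 1 / R : ℝ) : ℂ))
      rw [norm_mul, hσn, Complex.norm_real, Real.norm_of_nonneg (by positivity)] at h2
      linarith
    have hτ : m * (c t' - c s) = w * x := by rw [ht, ← hmu]; ring
    have hτn : ‖m * (c t' - c s)‖ < 2 * R + 1 := by rw [hτ, norm_mul, hw1, one_mul]; exact hxn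
    have ht2 : t' ∈ Icc a b := by
      refine ⟨ht'.1, ?_⟩
      by_contra! h
      have := hlong t' ⟨h.le, ht'.2.le⟩
      linarith
    have h3 := him t' ht2
    have hxre : x.re = w.re * (m * (c t' - c s)).re + w.im * (m * (c t' - c s)).im := by
      rw [hτ]
      simp only [Complex.mul_re, Complex.mul_im]
      have : ‖w‖ ^ 2 = w.re ^ 2 + w.im ^ 2 := by
        rw [← Complex.normSq_eq_norm_sq, Complex.normSq_apply]; ring
      rw [hw1] at this
      linear_combination x.re * this
    have hxabs : |x.re| ≤ 1 / (2 * R) := by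
      rw [hxre]
      refine (abs_add_le _ _).trans ?_
      rw [abs_mul, abs_mul]
      have h4 := (Complex.abs_re_le_norm (m * (c t' - c s))).trans hτn.le
      have h5 := (Complex.abs_im_le_norm w).trans hw1.le
      have h6 : |w.re| * |(m * (c t' - c s)).re| ≤ 1 / (4 * N * R) * N := by
        gcongr
        linarith
      have h7 : |w.im| * |(m * (c t' - c s)).im| ≤ 1 * (1 / (4 * R)) := by
        gcongr
        exact h3.trans hθR
      have h8 : 1 / (4 * N * R) * N + 1 * (1 / (4 * R)) = 1 / (2 * R) := by field_simp; norm_num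
      linarith
    have h9 : (σ * ((R + 1 / R : ℝ) : ℂ)).re ^ 2 = (R + 1 / R) ^ 2 ∧
        (σ * ((R + 1 / R : ℝ) : ℂ)).re * x.re ≤ (R + 1 / R) * (1 / (2 * R)) := by
      have := abs_le.1 hxabs
      have h0 : 0 ≤ R + 1 / R := by positivity
      rcases hσ with rfl | rfl
      · simp only [one_mul, Complex.ofReal_re, true_and]
        exact mul_le_mul_of_nonneg_left this.2 h0
      · simp only [neg_mul, one_mul, Complex.neg_re, Complex.ofReal_re, neg_sq, true_and]
        have h4 : (R + 1 / R) * -x.re ≤ (R + 1 / R) * (1 / (2 * R)) :=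
          mul_le_mul_of_nonneg_left (by linarith [this.1]) h0
        linarith
    have h10 : (x.re - (σ * ((R + 1 / R : ℝ) : ℂ)).re) ^ 2 < R ^ 2 := by
      have h1 := mem_ball_iff_norm.1 hx
      have h2 := Complex.abs_re_le_norm (x - σ * ((R + 1 / R : ℝ) : ℂ))
      rw [Complex.sub_re] at h2
      exact sq_lt_sq' (by linarith [(abs_lt.1 (h2.trans_lt h1)).1])
        (abs_lt.1 (h2.trans_lt h1)).2
    have e1 : (R + 1 / R) ^ 2 = R ^ 2 + 2 + (1 / R) ^ 2 := by field_simp; ring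
    have e2 : (R + 1 / R) * (1 / (2 * R)) = 1 / 2 + (1 / R) ^ 2 / 2 := by field_simp
    have e3 : ∀ A X : ℝ, (X - A) ^ 2 = X ^ 2 - 2 * (A * X) + A ^ 2 := fun A X => by ring
    rw [e3, h9.1, e1] at h10
    have h11 := h9.2
    rw [e2] at h11
    linarith [sq_nonneg x.re]
  have hpre : ∀ q : ℂ, IsPreconnected ((fun x => c s + d * u * x) '' ball q R) := fun q =>
    (convex_ball q R).isPreconnected.image _ (by fun_prop)
  have h1mem : ∀ σ : ℂ, (σ = 1 ∨ σ = -1) → σ ∈ ball (σ * ((R + 1 / R : ℝ) : ℂ)) R := by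
    intro σ hσ
    have hσn : ‖σ‖ = 1 := by rcases hσ with rfl | rfl <;> simp
    rw [mem_ball_iff_norm, show σ - σ * ((R + 1 / R : ℝ) : ℂ) = σ * ((1 - (R + 1 / R) : ℝ) : ℂ) by
      push_cast; ring, norm_mul, hσn, Complex.norm_real, one_mul, Real.norm_eq_abs, abs_lt]
    have : 1 / R ≤ 1 / 2 := one_div_le_one_div_of_le (by norm_num) hR
    have : 0 < 1 / R := by positivity
    constructor <;> linarith
  have hwK : z = c s + d * u * 1 := by rw [mul_one, hdu]; ring
  refine ⟨c s, u, d, rfl, hd0, ?_, mem_range_self s, by rw [hdu]; ring, fun x hx => ?_,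
    fun x hx hxΩ => ?_⟩
  · rw [hu, norm_div, hs, Complex.norm_real, Real.norm_of_nonneg hd0.le, div_self hd0.ne']
  · refine hΩ.subset_of_isPreconnected _ (hpre ((R + 1 / R : ℝ) : ℂ)) ?_ ?_ (mem_image_of_mem _ hx)
    · rw [disjoint_left]
      rintro _ ⟨y, hy, rfl⟩
      exact havoid 1 (Or.inl rfl) y (by rwa [one_mul])
    · refine ⟨z, ⟨1, ?_, hwK.symm⟩, hz⟩
      simpa using h1mem 1 (Or.inl rfl)
  · -- the opposite point cannot lie in `Ω`
    have hop : c s - d * u ∈ Ω := by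
      refine hΩ.subset_of_isPreconnected _ (hpre (-((R + 1 / R : ℝ) : ℂ))) ?_ ?_
        (⟨-1, ?_, by ring⟩)
      · rw [disjoint_left]
        rintro _ ⟨y, hy, rfl⟩
        exact havoid (-1) (Or.inr rfl) y (by rwa [neg_one_mul])
      · exact ⟨_, mem_image_of_mem _ hx, hxΩ⟩
      · have := h1mem (-1) (Or.inr rfl)
        rwa [neg_one_mul] at this
    have hpath : IsPathConnected Ω :=
      hΩ.isOpen.isConnected_iff_isPathConnected.1 ⟨⟨z, hz⟩, hΩ.isPreconnected⟩
    obtain ⟨γ, hγ⟩ := hpath.joinedIn z hz _ hop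
    set K : Set ℂ := (fun x => m * (x - c s)) '' range γ with hK
    have hKc : IsCompact K := (isCompact_range γ.continuous).image (by fun_prop)
    have hKp : IsPreconnected K := (isPreconnected_range γ.continuous).image _ (by fun_prop)
    have hcK : ∀ t, m * (c t - c s) ∉ K := by
      rintro t ⟨_, ⟨y, rfl⟩, hy⟩
      have h1 : γ y = c t := by
        have := mul_left_cancel₀ hm0 hy
        linear_combination this
      exact disjoint_left.1 hΩ.disjoint (hγ y) (h1 ▸ mem_range_self t)
    have hwmem : w ∈ K := ⟨z, ⟨0, γ.source⟩, rfl⟩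
    have hwmem' : -w ∈ K := ⟨_, ⟨1, γ.target⟩, by simp only; rw [← hmu]; ring⟩
    have hcont : Continuous fun t => m * (c t - c s) := by have := hc.continuous; fun_prop
    have hper : m * (c (a + 1) - c s) = m * (c a - c s) := by rw [hc.periodic a]
    have hlong' : ∀ t ∈ Icc b (a + 1), 1 < ‖m * (c t - c s)‖ := fun t ht => by
      have := hlong t ht
      linarith
    rcases le_abs.1 hzim with h | h
    · exact not_mem_of_isPreconnected hcont hab hba hper him ha hb hlong' hw1.le
        (by linarith) hKc hKp (fun t _ => hcK t) hwmem hwmem'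
    · exact not_mem_of_isPreconnected hcont hab hba hper him ha hb hlong' (w := -w)
        (by rw [norm_neg]; exact hw1.le) (by rw [Complex.neg_im]; linarith) hKc hKp
        (fun t _ => hcK t) hwmem' (by rwa [neg_neg])


/-! ### Conformal maps of a domain between two large disks -/

/-- A self-map of the unit disk fixing `0`, whose derivative at `0` is almost `1`, is almost the
identity on compact subsets. -/
theorem norm_sub_id_le_of_deriv_close {a : ℂ → ℂ} (hd : DifferentiableOn ℂ a (ball 0 1))
    (hm : MapsTo a (ball 0 1) (ball 0 1)) (h0 : a 0 = 0) {α η : ℝ} (hα : deriv a 0 = α)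
    (hη : 0 < η) (hαη : 1 - η ≤ α) {ζ : ℂ} (hζ : ζ ∈ ball (0 : ℂ) 1) :
    ‖a ζ - ζ‖ ≤ 3 * η / (1 - ‖ζ‖) := by
  have hmc : MapsTo a (ball 0 1) (closedBall (a 0) 1) := fun x hx => by
    rw [h0]; exact ball_subset_closedBall (hm hx)
  have hζ1 : ‖ζ‖ < 1 := mem_ball_zero_iff.1 hζ
  have hα1 : α ≤ 1 := by
    have := Complex.norm_deriv_le_one_of_mapsTo_ball hd hmc one_pos
    rw [hα, Complex.norm_real] at this
    exact (le_abs_self α).trans this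
  have hds : DifferentiableOn ℂ (dslope a 0) (ball 0 1) :=
    (Complex.differentiableOn_dslope (isOpen_ball.mem_nhds (mem_ball_self one_pos))).2 hd
  have hbc := Complex.borelCaratheodory_zero (f := fun z => dslope a 0 z - α) (R := 1) hη
    (hds.sub_const _) (fun x hx => by
      have h1 := Complex.norm_dslope_le_div_of_mapsTo_ball hd hmc hx
      have h2 := Complex.re_le_norm (dslope a 0 x)
      simp only [mem_ofPred_eq, Complex.sub_re, Complex.ofReal_re]
      linarith) one_pos hζ (by simp [hα])
  have hsl : a ζ = ζ * dslope a 0 ζ := by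
    have := sub_smul_dslope a 0 ζ
    simpa [h0] using this.symm
  have e : a ζ - ζ = ζ * (dslope a 0 ζ - α) + ζ * ((α - 1 : ℝ) : ℂ) := by
    rw [hsl]; push_cast; ring
  have hn : ‖((α - 1 : ℝ) : ℂ)‖ ≤ η := by
    rw [Complex.norm_real, Real.norm_eq_abs, abs_le]; constructor <;> linarith
  have hpos : 0 < 1 - ‖ζ‖ := by linarith
  have h1 : ‖ζ‖ * ‖dslope a 0 ζ - α‖ ≤ 1 * (2 * η / (1 - ‖ζ‖)) := by
    refine mul_le_mul hζ1.le (hbc.trans ?_) (norm_nonneg _) zero_le_one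
    have : 2 * η * ‖ζ‖ ≤ 2 * η * 1 := by gcongr
    rw [mul_one] at this
    gcongr
  have h2 : ‖ζ‖ * ‖((α - 1 : ℝ) : ℂ)‖ ≤ 1 * (η / (1 - ‖ζ‖)) := by
    refine mul_le_mul hζ1.le (hn.trans ?_) (norm_nonneg _) zero_le_one
    rw [le_div_iff₀ hpos]
    nlinarith [norm_nonneg ζ]
  rw [e]
  refine (norm_add_le _ _).trans ?_
  rw [norm_mul, norm_mul]
  refine (add_le_add h1 h2).trans (le_of_eq ?_)
  ring

/-- The inequality behind the fact that `y ↦ R (y - k) / (R² - k y)` maps the disk of radius `R` to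
the unit disk if `|k| < R`, and its exterior if `R < |k|`. -/
theorem sq_norm_sub_sq_norm (R k : ℝ) (y : ℂ) :
    ‖(R : ℂ) ^ 2 - k * y‖ ^ 2 - ‖(R : ℂ) * (y - k)‖ ^ 2 = (R ^ 2 - k ^ 2) * (R ^ 2 - ‖y‖ ^ 2) := by
  simp only [← Complex.normSq_eq_norm_sq, Complex.normSq_apply]
  simp [pow_two]
  ring

/-- The conformal map of the right half-plane onto the unit disk which sends `1` to `0`. -/
noncomputable def cayley (w : ℂ) : ℂ := (w - 1) / (w + 1)

/-- The conformal map of the disk `ball (R + 1 / R) R` onto the unit disk which sends `1` to `0`. -/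
noncomputable def innerMap (R : ℝ) (w : ℂ) : ℂ :=
  R * (w - 1) / (R ^ 2 - (1 - (R + 1 / R) : ℝ) * (w - (R + 1 / R : ℝ)))

theorem exists_innerMap_close {Q : Set ℂ} (hQ : IsCompact Q) (hre : ∀ w ∈ Q, 0 < w.re) {ε : ℝ}
    (hε : 0 < ε) : ∃ R₀ > 0, ∀ R ≥ R₀, ∀ w ∈ Q, ‖innerMap R w - cayley w‖ < ε := by
  set F : ℝ × ℂ → ℂ := fun x =>
    (x.2 - 1) / ((1 - x.1 + x.1 ^ 2) * x.2 + 1 - 2 * x.1 + x.1 ^ 2 - x.1 ^ 3) with hF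
  have hcont : ∀ x ∈ ({0} : Set ℝ) ×ˢ Q, ContinuousAt F x := by
    rintro ⟨t, w⟩ ⟨ht, hw⟩
    simp only [mem_singleton_iff] at ht
    subst ht
    refine ContinuousAt.div (by fun_prop) (by fun_prop) fun h => ?_
    have := congrArg Complex.re h
    simp at this
    linarith [hre w hw]
  have := (isCompact_singleton.prod hQ).uniformContinuousAt_of_continuousAt F hcont
    (Metric.dist_mem_uniformity hε)
  obtain ⟨δ, hδ, hsub⟩ := Metric.mem_uniformity_dist.1 this
  refine ⟨2 / δ, by positivity, fun R hR w hw => ?_⟩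
  have hR0 : 0 < R := lt_of_lt_of_le (by positivity) hR
  have h1 : dist ((0 : ℝ), w) (1 / R, w) < δ := by
    rw [Prod.dist_eq, dist_self, max_eq_left dist_nonneg, dist_comm, Real.dist_eq, sub_zero,
      abs_of_pos (by positivity), div_lt_iff₀ hR0]
    rw [ge_iff_le, div_le_iff₀ hδ] at hR
    linarith
  have h2 := hsub h1 ⟨rfl, hw⟩
  simp only [mem_ofPred_eq] at h2
  rw [dist_comm, dist_eq_norm] at h2
  have hRC : (R : ℂ) ≠ 0 := by exact_mod_cast hR0.ne'
  have e1 : F (0, w) = cayley w := by simp [hF, cayley]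
  have e2 : F (1 / R, w) = innerMap R w := by
    simp only [hF, innerMap]
    rw [← mul_div_mul_left _ _ hRC]
    congr 1
    push_cast
    field_simp
    ring
  rwa [e1, e2] at h2

/-- A lower bound for the derivative of the Riemann map of a domain in the exterior of a disk, by the
Schwarz lemma for the inverse map, with values in the exterior of the disk. -/
theorem le_deriv_of_disjoint_ball {R ρ l α : ℝ} (hR0 : 0 < R) (hl : l = 1 + ρ) (hlR : R ^ 2 < l ^ 2)
    {g : ℂ → ℂ} (hg : DifferentiableOn ℂ g (ball 0 1))
    (hy : ∀ ζ ∈ ball (0 : ℂ) 1, R ≤ ‖g ζ + ρ‖) (hg0 : g 0 = 1) (hα : 0 < α)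
    (hprod : deriv g 0 * α = 1) : R / (l ^ 2 - R ^ 2) ≤ α := by
  have hRC : (R : ℂ) ≠ 0 := by exact_mod_cast hR0.ne'
  have hgd : HasDerivAt g (deriv g 0) 0 :=
    (hg.differentiableAt (isOpen_ball.mem_nhds (mem_ball_self one_pos))).hasDerivAt
  set b : ℂ → ℂ := fun ζ => R * (g ζ - 1) / (R ^ 2 - l * (g ζ + ρ)) with hb
  have hle : ∀ ζ ∈ ball (0 : ℂ) 1,
      ‖(R : ℂ) * (g ζ - 1)‖ ≤ ‖(R : ℂ) ^ 2 - l * (g ζ + ρ)‖ := fun ζ hζ => by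
    have h1 := sq_norm_sub_sq_norm R l (g ζ + ρ)
    have h2 : g ζ + ρ - l = g ζ - 1 := by rw [hl]; push_cast; ring
    rw [h2] at h1
    have h3 : R ^ 2 ≤ ‖g ζ + ρ‖ ^ 2 := by gcongr; exact hy ζ hζ
    rw [← sq_le_sq₀ (norm_nonneg _) (norm_nonneg _)]
    nlinarith
  have hne : ∀ ζ ∈ ball (0 : ℂ) 1, (R : ℂ) ^ 2 - l * (g ζ + ρ) ≠ 0 := fun ζ hζ h0 => by
    have h1 := hle ζ hζ
    rw [h0, norm_zero, norm_le_zero_iff, mul_eq_zero, or_iff_right hRC, sub_eq_zero] at h1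
    rw [h1] at h0
    have h2 : R ^ 2 - l * l = 0 := by
      have h3 : ((R ^ 2 - l * l : ℝ) : ℂ) = 0 := by
        rw [← h0, hl]; push_cast; ring
      exact_mod_cast h3
    nlinarith
  have hbd : DifferentiableOn ℂ b (ball 0 1) :=
    DifferentiableOn.div ((hg.sub_const _).const_mul _)
      ((hg.add_const _).const_mul _ |>.const_sub _) hne
  have hb0 : b 0 = 0 := by simp [hb, hg0]
  have hbm : MapsTo b (ball 0 1) (closedBall (b 0) 1) := fun ζ hζ => by
    rw [hb0, mem_closedBall_zero_iff, hb]
    simp only [norm_div]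
    exact div_le_one_of_le₀ (hle ζ hζ) (norm_nonneg _)
  have hS := Complex.norm_deriv_le_one_of_mapsTo_ball hbd hbm one_pos
  have hden0 : (R : ℂ) ^ 2 - l * (g 0 + ρ) = ((R ^ 2 - l ^ 2 : ℝ) : ℂ) := by
    rw [hg0, hl]; push_cast; ring
  have hbder : deriv b 0 = R * deriv g 0 / ((R ^ 2 - l ^ 2 : ℝ) : ℂ) := by
    have h1 := ((hgd.sub_const 1).const_mul (R : ℂ)).fun_div
      (((hgd.add_const (ρ : ℂ)).const_mul (l : ℂ)).const_sub ((R : ℂ) ^ 2))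
      (hne 0 (mem_ball_self one_pos))
    rw [h1.deriv, hden0, hg0]
    have : ((R ^ 2 - l ^ 2 : ℝ) : ℂ) ≠ 0 := by
      have : R ^ 2 - l ^ 2 ≠ 0 := by linarith
      exact_mod_cast this
    field_simp
    ring
  have hgn : ‖deriv g 0‖ * α = 1 := by
    have := congrArg norm hprod
    rwa [norm_mul, Complex.norm_real, Real.norm_of_nonneg hα.le, norm_one] at this
  rw [hbder, norm_div, norm_mul, Complex.norm_real, Complex.norm_real,
    Real.norm_of_nonneg hR0.le, Real.norm_eq_abs, abs_of_neg (by linarith),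
    div_le_one (by linarith)] at hS
  rw [div_le_iff₀ (by linarith)]
  have h5 : R * ‖deriv g 0‖ * α = R := by rw [mul_assoc, hgn, mul_one]
  have h6 : R * ‖deriv g 0‖ * α ≤ -(R ^ 2 - l ^ 2) * α := by gcongr
  linarith

/-- The conformal map of the unit disk onto the disk of radius `R` with center `1 - k`, which
sends `0` to `1`. -/
noncomputable def diskMap (R k : ℝ) (ζ : ℂ) : ℂ := R * (R * ζ + k) / (R + k * ζ) + (1 - k : ℝ)

theorem add_mul_ne_zero {R k : ℝ} (hkn : |k| < R) {ζ : ℂ} (hζ : ζ ∈ ball (0 : ℂ) 1) :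
    (R : ℂ) + k * ζ ≠ 0 := fun h0 => by
  have hR0 : 0 < R := (abs_nonneg k).trans_lt hkn
  have h1 : ‖(k : ℂ) * ζ‖ = R := by
    rw [eq_neg_of_add_eq_zero_right h0, norm_neg, Complex.norm_real, Real.norm_of_nonneg hR0.le]
  rw [norm_mul, Complex.norm_real, Real.norm_eq_abs] at h1
  have h2 := mem_ball_zero_iff.1 hζ
  have h3 : |k| * ‖ζ‖ ≤ |k| * 1 := by gcongr
  linarith

theorem diskMap_mem_ball {R k : ℝ} (hkn : |k| < R) {ζ : ℂ} (hζ : ζ ∈ ball (0 : ℂ) 1) :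
    diskMap R k ζ ∈ ball ((1 - k : ℝ) : ℂ) R := by
  have hR0 : 0 < R := (abs_nonneg k).trans_lt hkn
  have hkR : k ^ 2 < R ^ 2 := by rw [← sq_abs k]; gcongr
  have h2 := mem_ball_zero_iff.1 hζ
  rw [mem_ball_iff_norm, diskMap]
  simp only [add_sub_cancel_right]
  rw [norm_div, norm_mul, Complex.norm_real, Real.norm_of_nonneg hR0.le,
    div_lt_iff₀ (norm_pos_iff.2 (add_mul_ne_zero hkn hζ))]
  refine mul_lt_mul_of_pos_left ?_ hR0
  rw [← sq_lt_sq₀ (norm_nonneg _) (norm_nonneg _)]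
  have h3 : ‖ζ‖ ^ 2 < 1 := by nlinarith [norm_nonneg ζ]
  have h4 : ‖(R : ℂ) + k * ζ‖ ^ 2 - ‖(R : ℂ) * ζ + k‖ ^ 2 = (R ^ 2 - k ^ 2) * (1 - ‖ζ‖ ^ 2) := by
    simp only [← Complex.normSq_eq_norm_sq, Complex.normSq_apply]
    simp
    ring
  have h5 : 0 < (R ^ 2 - k ^ 2) * (1 - ‖ζ‖ ^ 2) := mul_pos (by linarith) (by linarith)
  linarith

theorem hasDerivAt_diskMap {R k : ℝ} (hR0 : 0 < R) :
    HasDerivAt (diskMap R k) ((R ^ 2 - k ^ 2 : ℝ) / R : ℂ) 0 := by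
  have hRC : (R : ℂ) ≠ 0 := by exact_mod_cast hR0.ne'
  have h1 : HasDerivAt (diskMap R k) ((R * (R * 1) * (R + k * 0) - R * (R * 0 + k) * (k * 1)) /
      (R + k * 0) ^ 2) 0 :=
    ((((hasDerivAt_id (0 : ℂ)).const_mul (R : ℂ)).add_const (k : ℂ)).const_mul
      (R : ℂ)).fun_div (((hasDerivAt_id (0 : ℂ)).const_mul (k : ℂ)).const_add (R : ℂ))
      (by simpa using hRC) |>.add_const ((1 - k : ℝ) : ℂ)
  convert h1 using 1
  simp only [mul_zero, add_zero, zero_add, mul_one]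
  push_cast
  field_simp

theorem differentiableOn_diskMap {R k : ℝ} (hkn : |k| < R) :
    DifferentiableOn ℂ (diskMap R k) (ball 0 1) :=
  DifferentiableOn.add_const _
    (DifferentiableOn.div (by fun_prop) (by fun_prop) fun _ => add_mul_ne_zero hkn)

theorem diskMap_eq {R k : ℝ} (hR0 : 0 < R) (hkR : k ^ 2 < R ^ 2) {w : ℂ}
    (hw : w ∈ ball ((1 - k : ℝ) : ℂ) R) :
    diskMap R k (R * (w - 1) / (R ^ 2 - k * (w - (1 - k : ℝ)))) = w := by
  have hRC : (R : ℂ) ≠ 0 := by exact_mod_cast hR0.ne'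
  obtain ⟨y, hy⟩ : ∃ y, y = w - (1 - k : ℝ) := ⟨_, rfl⟩
  have hw1 : w - 1 = y - k := by rw [hy]; push_cast; ring
  have hyR : ‖y‖ < R := by rw [hy]; exact mem_ball_iff_norm.1 hw
  have hden : (R : ℂ) ^ 2 - k * y ≠ 0 := fun h0 => by
    have h1 := sq_norm_sub_sq_norm R k y
    rw [h0, norm_zero] at h1
    have h3 : ‖y‖ ^ 2 < R ^ 2 := by gcongr
    have h4 : 0 < (R ^ 2 - k ^ 2) * (R ^ 2 - ‖y‖ ^ 2) := mul_pos (by linarith) (by linarith)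
    linarith [sq_nonneg ‖(R : ℂ) * (y - k)‖]
  have h3 : (R : ℂ) ^ 2 - k ^ 2 ≠ 0 := by
    have : R ^ 2 - k ^ 2 ≠ 0 := by linarith
    exact_mod_cast this
  rw [← hy, hw1, diskMap]
  have h1 : (R : ℂ) + k * (R * (y - k) / (R ^ 2 - k * y)) = R * (R ^ 2 - k ^ 2) / (R ^ 2 - k * y) := by
    field_simp; ring
  have h2 : (R : ℂ) * (R * (y - k) / (R ^ 2 - k * y)) + k = (R ^ 2 - k ^ 2) * y / (R ^ 2 - k * y) := by
    rw [eq_div_iff hden, add_mul, mul_assoc (R : ℂ), div_mul_cancel₀ _ hden]; ring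
  have h4 : w = y + (1 - k : ℝ) := by rw [hy]; ring
  rw [h1, h2, h4]
  congr 1
  field_simp

/-- The interior and the exterior of the disks of radius `R` with centers `± (R + 1 / R)`
approximate the right half-plane. If a simply connected domain `Ω'` lies between them, then its
Riemann map (normalized at `1`) approximates the one of the half-plane. Both estimates needed are
Schwarz lemmas. -/
theorem exists_close_cayley {Q : Set ℂ} (hQ : IsCompact Q) (hre : ∀ w ∈ Q, 0 < w.re)
    {ε : ℝ} (hε : 0 < ε) : ∃ R₀ > 0, ∀ R ≥ R₀, Q ⊆ ball ((R + 1 / R : ℝ) : ℂ) R →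
      ∀ (Ω' : Set ℂ) (j g : ℂ → ℂ),
      ball ((R + 1 / R : ℝ) : ℂ) R ⊆ Ω' → Disjoint (ball (-((R + 1 / R : ℝ) : ℂ)) R) Ω' →
      IsOpen Ω' → DifferentiableOn ℂ j Ω' → MapsTo j Ω' (ball 0 1) →
      DifferentiableOn ℂ g (ball 0 1) → MapsTo g (ball 0 1) Ω' → LeftInvOn g j Ω' →
      j 1 = 0 → ∀ α : ℝ, 0 < α → deriv j 1 = α → ∀ w ∈ Q, ‖j w - cayley w‖ ≤ ε := by
  have hcay : ∀ w ∈ Q, ‖cayley w‖ < 1 := fun w hw => by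
    have h := hre w hw
    have hw0 : 0 < ‖w + 1‖ := norm_pos_iff.2 fun h0 => by
      have := congrArg Complex.re h0; simp at this; linarith
    rw [cayley, norm_div, div_lt_one hw0, ← sq_lt_sq₀ (norm_nonneg _) (norm_nonneg _)]
    simp only [← Complex.normSq_eq_norm_sq, Complex.normSq_apply]
    simp
    nlinarith
  have hcc : ContinuousOn (fun w => ‖cayley w‖) Q := by
    refine ContinuousOn.norm (ContinuousOn.div (by fun_prop) (by fun_prop) fun w hw h0 => ?_)
    have := congrArg Complex.re h0; simp at this; linarith [hre w hw]
  obtain ⟨r, hr1, hr⟩ : ∃ r < 1, ∀ w ∈ Q, ‖cayley w‖ ≤ r := by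
    rcases Q.eq_empty_or_nonempty with h | h
    · exact ⟨0, zero_lt_one, by simp [h]⟩
    · obtain ⟨x, hx, hmax⟩ := hQ.exists_isMaxOn h hcc
      exact ⟨_, hcay x hx, fun w hw => hmax hw⟩
  have hpos : 0 < (1 - r) / 2 := by linarith
  obtain ⟨R₁, hR₁, hclose⟩ := exists_innerMap_close hQ hre (lt_min (half_pos hε) hpos)
  set η := ε / 2 * ((1 - r) / 2) / 3 with hη
  have hη0 : 0 < η := by positivity
  refine ⟨max R₁ (max 2 (4 / η)), by positivity, fun R hR hQR Ω' j g hin hout hΩ hj hjm hg hgm hgj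
    hj1 α hα hjα w hw => ?_⟩
  have hRR₁ : R₁ ≤ R := (le_max_left _ _).trans hR
  have hR2 : 2 ≤ R := (le_max_left _ _).trans ((le_max_right _ _).trans hR)
  have hRη : 4 / η ≤ R := (le_max_right _ _).trans ((le_max_right _ _).trans hR)
  have hR0 : 0 < R := by linarith
  have hRC : (R : ℂ) ≠ 0 := by exact_mod_cast hR0.ne'
  obtain ⟨t, ht⟩ : ∃ t, t = 1 / R := ⟨_, rfl⟩
  have hRt : R * t = 1 := by rw [ht]; field_simp
  have ht0 : 0 < t := by rw [ht]; positivity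
  have ht1 : t ≤ 1 / 2 := by rw [ht]; exact one_div_le_one_div_of_le (by norm_num) hR2
  have htη : 4 * t ≤ η := by
    rw [ht, mul_one_div, div_le_iff₀ hR0]; rwa [div_le_iff₀ hη0, mul_comm] at hRη
  rw [← ht] at hin hout hQR
  have hcl := hclose R hRR₁ w hw
  -- `k` and `l` are the distances of `1` to the two centers
  obtain ⟨k, hk⟩ : ∃ k, k = 1 - (R + t) := ⟨_, rfl⟩
  obtain ⟨l, hl⟩ : ∃ l, l = 1 + (R + t) := ⟨_, rfl⟩
  have hkR : k ^ 2 < R ^ 2 := by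
    rw [hk]; apply sq_lt_sq'  <;> linarith
  have hlR : R ^ 2 < l ^ 2 := by
    rw [hl]; apply sq_lt_sq' <;> linarith
  have hg0 : g 0 = 1 := by
    rw [← hj1]
    refine hgj (hin ?_)
    rw [mem_ball_iff_norm, ← Complex.ofReal_one, ← Complex.ofReal_sub, Complex.norm_real,
      Real.norm_eq_abs, abs_lt]
    constructor <;> linarith
  have h1Ω : (1 : ℂ) ∈ Ω' := by rw [← hg0]; exact hgm (mem_ball_self one_pos)
  have hjd : HasDerivAt j α 1 := by
    rw [← hjα]; exact (hj.differentiableAt (hΩ.mem_nhds h1Ω)).hasDerivAt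
  have hgd : HasDerivAt g (deriv g 0) 0 :=
    (hg.differentiableAt (isOpen_ball.mem_nhds (mem_ball_self one_pos))).hasDerivAt
  -- the derivatives of mutually inverse maps
  have hprod : deriv g 0 * α = 1 := by
    have h1 : HasDerivAt (g ∘ j) (deriv g 0 * α) 1 := by
      refine HasDerivAt.comp 1 ?_ hjd
      rw [hj1]; exact hgd
    have h2 : HasDerivAt (g ∘ j) 1 1 :=
      (hasDerivAt_id (1 : ℂ)).congr_of_eventuallyEq
        (Filter.eventually_of_mem (hΩ.mem_nhds h1Ω) fun x hx => hgj hx)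
    exact h1.unique h2
  -- the Schwarz lemma for the outer disk
  have hαlow : R / (l ^ 2 - R ^ 2) ≤ α := by
    refine le_deriv_of_disjoint_ball hR0 hl hlR hg (fun ζ hζ => ?_) hg0 hα hprod
    by_contra! h
    refine disjoint_left.1 hout ?_ (hgm hζ)
    rwa [mem_ball_iff_norm, sub_neg_eq_add]
  -- the Schwarz lemma for the inner disk
  have hkn : |k| < R := abs_lt_of_sq_lt_sq hkR hR0.le
  have h1k : 1 - k = R + t := by rw [hk]; ring
  have hSm : ∀ ζ ∈ ball (0 : ℂ) 1, diskMap R k ζ ∈ ball ((R + t : ℝ) : ℂ) R := fun ζ hζ => by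
    rw [← h1k]; exact diskMap_mem_ball hkn hζ
  have hS0 : diskMap R k 0 = 1 := by
    simp only [diskMap, mul_zero, zero_add, add_zero]
    rw [mul_div_cancel_left₀ _ hRC]; push_cast; ring
  have hSd := hasDerivAt_diskMap (k := k) hR0
  have hSdiff := differentiableOn_diskMap hkn
  set a := j ∘ diskMap R k with ha
  have had : DifferentiableOn ℂ a (ball 0 1) := hj.comp hSdiff fun ζ hζ => hin (hSm ζ hζ)
  have ham : MapsTo a (ball 0 1) (ball 0 1) := fun ζ hζ => hjm (hin (hSm ζ hζ))
  have ha0 : a 0 = 0 := by simp [ha, hS0, hj1]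
  have hader : deriv a 0 = ((α * ((R ^ 2 - k ^ 2) / R) : ℝ) : ℂ) := by
    have : HasDerivAt a (α * ((R ^ 2 - k ^ 2 : ℝ) / R : ℂ)) 0 := by
      refine HasDerivAt.comp 0 ?_ hSd
      rw [hS0]; exact hjd
    rw [this.deriv]; push_cast; ring
  have hclose1 : 1 - η ≤ α * ((R ^ 2 - k ^ 2) / R) := by
    have h1 : R / (l ^ 2 - R ^ 2) * ((R ^ 2 - k ^ 2) / R) ≤ α * ((R ^ 2 - k ^ 2) / R) := by
      gcongr
    refine le_trans ?_ h1
    have h2 : R / (l ^ 2 - R ^ 2) * ((R ^ 2 - k ^ 2) / R) = (R ^ 2 - k ^ 2) / (l ^ 2 - R ^ 2) := by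
      field_simp
    rw [h2, le_div_iff₀ (by linarith)]
    have e1 : R ^ 2 - k ^ 2 = 2 * R - 3 + 2 * t - t ^ 2 := by
      rw [hk]; linear_combination (-2 : ℝ) * hRt
    have e2 : l ^ 2 - R ^ 2 = 2 * R + 3 + 2 * t + t ^ 2 := by
      rw [hl]; linear_combination (2 : ℝ) * hRt
    rw [e1, e2]
    have h3 : 4 * t * (2 * R + 3 + 2 * t + t ^ 2) ≤ η * (2 * R + 3 + 2 * t + t ^ 2) := by gcongr
    have h4 : 4 * t * (2 * R + 3 + 2 * t + t ^ 2) = 8 + 12 * t + 8 * t ^ 2 + 4 * t ^ 3 := by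
      linear_combination (8 : ℝ) * hRt
    have h5 : t ^ 2 ≤ 1 := by nlinarith
    have h6 : 0 ≤ t ^ 3 := by positivity
    have h7 : 0 ≤ t ^ 2 := by positivity
    linarith
  -- the estimate for `a` at the point `ζ` with `diskMap R k ζ = w` is one for `j` at `w`
  set ζ := innerMap R w with hζdef
  have hwR := hQR hw
  have hζe : ζ = R * (w - 1) / ((R : ℂ) ^ 2 - k * (w - (1 - k : ℝ))) := by
    rw [hζdef, innerMap, ← ht, ← hk, h1k]
  have hζn : ‖ζ‖ ≤ (1 + r) / 2 := by
    have h1 : ‖ζ‖ ≤ ‖ζ - cayley w‖ + ‖cayley w‖ := norm_le_norm_sub_add _ _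
    have h2 := hcl.trans_le (min_le_right _ _)
    linarith [hr w hw]
  have hζb : ζ ∈ ball (0 : ℂ) 1 := by rw [mem_ball_zero_iff]; linarith
  have hSζ : diskMap R k ζ = w := by
    rw [hζe]; exact diskMap_eq hR0 hkR (by rw [h1k]; exact hwR)
  have hmain := norm_sub_id_le_of_deriv_close had ham ha0 hader hη0 hclose1 hζb
  have haj : a ζ = j w := by simp only [ha, Function.comp, hSζ]
  rw [haj] at hmain
  have hfin : 3 * η / (1 - ‖ζ‖) ≤ ε / 2 := by
    rw [div_le_iff₀ (by linarith), hη]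
    have : ε / 2 * ((1 - r) / 2) ≤ ε / 2 * (1 - ‖ζ‖) := by gcongr; linarith
    linarith
  have h1 := hcl.trans_le (min_le_left _ _)
  calc ‖j w - cayley w‖ = ‖(j w - ζ) + (ζ - cayley w)‖ := by congr 1; ring
    _ ≤ ‖j w - ζ‖ + ‖ζ - cayley w‖ := norm_add_le _ _
    _ ≤ ε := by linarith


/-! ### Planar Epstein maps -/

/-- Half the gradient of `log σ`, as a complex number. -/
noncomputable def halfGradLog (σ : ℂ → ℝ) (z : ℂ) : ℂ :=
  ⟨fderiv ℝ σ z 1 / (2 * σ z), fderiv ℝ σ z Complex.I / (2 * σ z)⟩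

/-- The point `(Z, h)` of the upper half-space `ℂ × (0, ∞)` from which the visual metric has at `z`
the density `σ` and half the logarithmic gradient `s`. -/
noncomputable def epsteinPoint (z s : ℂ) (σ : ℝ) : ℂ × ℝ :=
  (z + ((‖s‖ ^ 2 + σ ^ 2 / 4)⁻¹ : ℝ) * s, σ / 2 * (‖s‖ ^ 2 + σ ^ 2 / 4)⁻¹)

/-- The Epstein map of the planar conformal metric `σ |dz|`, in the upper half-space model. -/
noncomputable def planarEpstein (σ : ℂ → ℝ) (z : ℂ) : ℂ × ℝ :=
  epsteinPoint z (halfGradLog σ z) (σ z)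

/-- The hyperbolic density of a planar domain with Riemann map `j` onto the unit disk. -/
noncomputable def hypDensity (j : ℂ → ℂ) (w : ℂ) : ℝ := 2 * ‖deriv j w‖ / (1 - ‖j w‖ ^ 2)

theorem fderiv_eq_halfGradLog {σ : ℂ → ℝ} {z : ℂ} (hσ : σ z ≠ 0) (v : ℂ) :
    fderiv ℝ σ z v = 2 * σ z * ((starRingEnd ℂ) (halfGradLog σ z) * v).re := by
  have hv : v = v.re • (1 : ℂ) + v.im • Complex.I := by
    simp [Complex.re_add_im]
  conv_lhs => rw [hv]
  rw [map_add, map_smul, map_smul]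
  simp [halfGradLog]
  field_simp

theorem halfGradLog_eq {σ : ℂ → ℝ} {z s : ℂ} (hσ : σ z ≠ 0)
    (h : ∀ v, fderiv ℝ σ z v = 2 * σ z * ((starRingEnd ℂ) s * v).re) : halfGradLog σ z = s := by
  apply Complex.ext
  · simp only [halfGradLog, h]; simp; field_simp
  · simp only [halfGradLog, h]; simp; field_simp

theorem halfGradLog_congr {σ τ : ℂ → ℝ} {z : ℂ} (h : σ =ᶠ[𝓝 z] τ) :
    halfGradLog σ z = halfGradLog τ z := by
  rw [halfGradLog, halfGradLog, h.fderiv_eq, h.eq_of_nhds]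

theorem planarEpstein_congr {σ τ : ℂ → ℝ} {z : ℂ} (h : σ =ᶠ[𝓝 z] τ) :
    planarEpstein σ z = planarEpstein τ z := by
  rw [planarEpstein, planarEpstein, halfGradLog_congr h, h.eq_of_nhds]

theorem hasFDerivAt_hypDensity {j : ℂ → ℂ} {w j1 j2 : ℂ} (h0 : HasDerivAt j j1 w)
    (h1 : HasDerivAt (deriv j) j2 w) (hj1 : j1 ≠ 0) (hn : ‖j w‖ < 1) :
    ∃ L : ℂ →L[ℝ] ℝ, HasFDerivAt (hypDensity j) L w ∧ ∀ v, L v = 2 * hypDensity j w *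
      ((starRingEnd ℂ) ((starRingEnd ℂ) (j2 / j1) / 2 + ((1 - ‖j w‖ ^ 2)⁻¹ : ℝ) *
        (j w * (starRingEnd ℂ) j1)) * v).re := by
  have e1 : deriv j w = j1 := h0.deriv
  have hpos : 0 < 1 - ‖j w‖ ^ 2 := by nlinarith [norm_nonneg (j w)]
  have hn1 : 0 < ‖j1‖ := norm_pos_iff.2 hj1
  have f0 := (h0.hasFDerivAt.restrictScalars ℝ).norm_sq
  have f1 := (h1.hasFDerivAt.restrictScalars ℝ).norm_sq
  have f2 := f1.sqrt (by rw [e1]; positivity)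
  have f3 := (f2.const_mul 2).mul ((hasDerivAt_inv hpos.ne').comp_hasFDerivAt w (f0.const_sub 1))
  have f4 : HasFDerivAt (hypDensity j) _ w := f3.congr_of_eventuallyEq
    (Filter.Eventually.of_forall fun x => by
      simp [hypDensity, Real.sqrt_sq (norm_nonneg _), div_eq_mul_inv])
  refine ⟨_, f4, fun v => ?_⟩
  have hR : ∀ m : ℝ, ((starRingEnd ℂ) ((starRingEnd ℂ) (j2 / j1) / 2 +
      (m : ℂ) * (j w * (starRingEnd ℂ) j1)) * v).re =
      ((starRingEnd ℂ) j1 * (j2 * v)).re / (2 * ‖j1‖ ^ 2) +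
        m * ((starRingEnd ℂ) (j w) * (j1 * v)).re := fun m => by
    have h2 : (j2 / j1) = (((‖j1‖ ^ 2)⁻¹ : ℝ) : ℂ) * ((starRingEnd ℂ) j1 * j2) := by
      have hn2 : ((‖j1‖ ^ 2 : ℝ) : ℂ) = (starRingEnd ℂ) j1 * j1 := by
        rw [← Complex.normSq_eq_norm_sq, Complex.normSq_eq_conj_mul_self]
      have hc : (starRingEnd ℂ) j1 ≠ 0 := (map_ne_zero _).2 hj1
      rw [Complex.ofReal_inv, hn2]
      field_simp
    have h3 : (starRingEnd ℂ) ((starRingEnd ℂ) (j2 / j1) / 2 +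
        (m : ℂ) * (j w * (starRingEnd ℂ) j1)) * v =
        (((2 * ‖j1‖ ^ 2)⁻¹ : ℝ) : ℂ) * ((starRingEnd ℂ) j1 * (j2 * v)) +
          (m : ℂ) * ((starRingEnd ℂ) (j w) * (j1 * v)) := by
      simp only [map_add, map_mul, map_div₀, Complex.conj_conj, Complex.conj_ofReal, map_ofNat]
      rw [h2]; push_cast; field_simp
    rw [h3, Complex.add_re, Complex.re_ofReal_mul, Complex.re_ofReal_mul]
    ring
  have hin : ∀ x y : ℂ, inner ℝ x y = ((starRingEnd ℂ) x * y).re := fun x y => by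
    rw [Complex.inner, mul_comm]
  rw [hR]
  simp only [e1, hypDensity, Real.sqrt_sq (norm_nonneg _), Function.comp, add_apply, smul_apply,
    neg_apply, ContinuousLinearMap.comp_apply, ContinuousLinearMap.coe_restrictScalars',
    ContinuousLinearMap.toSpanSingleton_apply, innerSL_apply_apply, hin, smul_eq_mul, nsmul_eq_mul]
  rw [mul_comm v j1, mul_comm v j2]
  push_cast
  field_simp
  ring

theorem halfGradLog_hypDensity {j : ℂ → ℂ} {w j1 j2 : ℂ} (h0 : HasDerivAt j j1 w)
    (h1 : HasDerivAt (deriv j) j2 w) (hj1 : j1 ≠ 0) (hn : ‖j w‖ < 1) :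
    halfGradLog (hypDensity j) w = (starRingEnd ℂ) (j2 / j1) / 2 +
      ((1 - ‖j w‖ ^ 2)⁻¹ : ℝ) * (j w * (starRingEnd ℂ) j1) := by
  obtain ⟨L, hL, hLv⟩ := hasFDerivAt_hypDensity h0 h1 hj1 hn
  refine halfGradLog_eq ?_ fun v => by rw [hL.fderiv, hLv]
  have hpos : 0 < 1 - ‖j w‖ ^ 2 := by nlinarith [norm_nonneg (j w)]
  rw [hypDensity, h0.deriv]
  have := norm_pos_iff.2 hj1
  positivity

/-- The Epstein map of the hyperbolic metric, as a function of the `2`-jet of the Riemann map. -/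
noncomputable def epsteinJet (x : ℂ × ℂ × ℂ × ℂ) : ℂ × ℝ :=
  epsteinPoint x.1 ((starRingEnd ℂ) (x.2.2.2 / x.2.2.1) / 2 +
    ((1 - ‖x.2.1‖ ^ 2)⁻¹ : ℝ) * (x.2.1 * (starRingEnd ℂ) x.2.2.1))
    (2 * ‖x.2.2.1‖ / (1 - ‖x.2.1‖ ^ 2))

theorem planarEpstein_hypDensity {j : ℂ → ℂ} {w j1 j2 : ℂ} (h0 : HasDerivAt j j1 w)
    (h1 : HasDerivAt (deriv j) j2 w) (hj1 : j1 ≠ 0) (hn : ‖j w‖ < 1) :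
    planarEpstein (hypDensity j) w = epsteinJet (w, j w, j1, j2) := by
  rw [planarEpstein, halfGradLog_hypDensity h0 h1 hj1 hn, epsteinJet, hypDensity, h0.deriv]

theorem contDiffAt_epsteinJet {n : WithTop ℕ∞} {x : ℂ × ℂ × ℂ × ℂ} (hx1 : x.2.2.1 ≠ 0)
    (hx : ‖x.2.1‖ < 1) : ContDiffAt ℝ n epsteinJet x := by
  have hpos : 1 - ‖x.2.1‖ ^ 2 ≠ 0 := by nlinarith [norm_nonneg x.2.1]
  have hn1 : 0 < ‖x.2.2.1‖ := norm_pos_iff.2 hx1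
  have c0 : ContDiffAt ℝ n (fun x : ℂ × ℂ × ℂ × ℂ => 1 - ‖x.2.1‖ ^ 2) x :=
    contDiffAt_const.sub (ContDiffAt.norm_sq ℝ (by fun_prop))
  have cc : ∀ f : ℂ × ℂ × ℂ × ℂ → ℂ, ContDiffAt ℝ n f x →
      ContDiffAt ℝ n (fun x => (starRingEnd ℂ) (f x)) x := fun f hf =>
    (Complex.conjCLE.contDiff.contDiffAt).comp x hf
  have co : ∀ f : ℂ × ℂ × ℂ × ℂ → ℝ, ContDiffAt ℝ n f x →
      ContDiffAt ℝ n (fun x => (f x : ℂ)) x := fun f hf =>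
    (Complex.ofRealCLM.contDiff.contDiffAt).comp x hf
  have c1 : ContDiffAt ℝ n (fun x : ℂ × ℂ × ℂ × ℂ => 2 * ‖x.2.2.1‖ / (1 - ‖x.2.1‖ ^ 2)) x :=
    ContDiffAt.div (contDiffAt_const.mul (ContDiffAt.norm ℝ (by fun_prop) hx1)) c0 hpos
  have cq : ContDiffAt ℝ n (fun x : ℂ × ℂ × ℂ × ℂ => x.2.2.2 / x.2.2.1) x :=
    ContDiffAt.mul (𝕜 := ℝ) (by fun_prop) (ContDiffAt.inv (by fun_prop) hx1)
  have c2 : ContDiffAt ℝ n (fun x : ℂ × ℂ × ℂ × ℂ => (starRingEnd ℂ) (x.2.2.2 / x.2.2.1) / 2 +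
    ((1 - ‖x.2.1‖ ^ 2)⁻¹ : ℝ) * (x.2.1 * (starRingEnd ℂ) x.2.2.1)) x := by
    refine ContDiffAt.add (ContDiffAt.div_const (cc _ cq) _)
      ((co _ (c0.inv hpos)).mul (ContDiffAt.mul (by fun_prop) (cc _ (by fun_prop))))
  have c3 := (c2.norm_sq ℝ).add ((c1.pow 2).div_const 4)
  have c4 := c3.inv (by
    have : 0 < ‖x.2.2.1‖ := norm_pos_iff.2 hx1
    have h2 : 0 < (2 * ‖x.2.2.1‖ / (1 - ‖x.2.1‖ ^ 2)) ^ 2 := by positivity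
    have h3 : ∀ a : ℂ, 0 ≤ ‖a‖ ^ 2 := fun a => by positivity
    exact ne_of_gt (add_pos_of_nonneg_of_pos (h3 _) (by positivity)))
  exact ContDiffAt.prodMk (ContDiffAt.add contDiffAt_fst ((co _ c4).mul c2))
    ((c1.div_const 2).mul c4)

/-- The Riemann map of the half-plane has the hyperbolic density `1 / Re w`. -/
theorem hypDensity_cayley {w : ℂ} (hw : 0 < w.re) : hypDensity cayley w = w.re⁻¹ := by
  have hne : w + 1 ≠ 0 := fun h => by
    have := congrArg Complex.re h; simp at this; linarith
  have hd : HasDerivAt cayley (2 / (w + 1) ^ 2) w := by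
    have := ((hasDerivAt_id w).sub_const 1).fun_div ((hasDerivAt_id w).add_const 1) hne
    refine this.congr_deriv ?_
    congr 1
    simp only [id]
    ring
  have h1 : ‖w + 1‖ ^ 2 - ‖w - 1‖ ^ 2 = 4 * w.re := by
    simp only [← Complex.normSq_eq_norm_sq, Complex.normSq_apply]
    simp; ring
  have hp : 0 < ‖w + 1‖ := norm_pos_iff.2 hne
  have h2 : 1 - ‖cayley w‖ ^ 2 = 4 * w.re / ‖w + 1‖ ^ 2 := by
    rw [cayley, norm_div, div_pow, ← h1]; field_simp
  rw [hypDensity, hd.deriv, h2, norm_div, norm_pow, Complex.norm_ofNat]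
  field_simp
  norm_num

/-- The Epstein map of the half-plane is the nearest point retraction to the totally geodesic plane
above its boundary line. -/
theorem planarEpstein_cayley {w : ℂ} (hw : 0 < w.re) :
    planarEpstein (hypDensity cayley) w = ((w.im : ℂ) * Complex.I, w.re) := by
  have hev : hypDensity cayley =ᶠ[𝓝 w] fun w => w.re⁻¹ := by
    filter_upwards [(isOpen_lt continuous_const Complex.continuous_re).mem_nhds hw] with x hx
    exact hypDensity_cayley hx
  rw [planarEpstein_congr hev]
  have hs : halfGradLog (fun w => w.re⁻¹) w = ((-(2 * w.re)⁻¹ : ℝ) : ℂ) := by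
    refine halfGradLog_eq (by positivity) fun v => ?_
    have hd : HasFDerivAt (fun w : ℂ => w.re⁻¹) _ w :=
      (hasDerivAt_inv hw.ne').comp_hasFDerivAt w Complex.reCLM.hasFDerivAt
    rw [hd.fderiv]
    simp
    field_simp
  rw [planarEpstein, hs, epsteinPoint, Complex.norm_real, Real.norm_eq_abs, sq_abs]
  have e : ((-(2 * w.re)⁻¹) ^ 2 + (w.re⁻¹) ^ 2 / 4)⁻¹ = 2 * w.re ^ 2 := by
    field_simp; norm_num
  rw [e, ← Complex.ofReal_mul]
  refine Prod.ext ?_ ?_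
  · have h3 : 2 * w.re ^ 2 * -(2 * w.re)⁻¹ = -w.re := by field_simp
    have h4 := Complex.re_add_im w
    simp only
    rw [h3, Complex.ofReal_neg]
    linear_combination -h4
  · simp only
    field_simp


/-! ### Stability of the Epstein map of the half-plane -/

/-- A `C¹` function and its derivative are uniformly continuous near a compact set. -/
theorem exists_uniform_fderiv {E F : Type*} [NormedAddCommGroup E] [NormedSpace ℝ E]
    [NormedAddCommGroup F] [NormedSpace ℝ F] {f : E → F} {K : Set E} (hK : IsCompact K)
    (hf : ∀ x ∈ K, ContDiffAt ℝ 1 f x) {ε : ℝ} (hε : 0 < ε) :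
    ∃ η > 0, ∀ x ∈ K, ∀ y, dist x y < η → ContDiffAt ℝ 1 f y ∧ dist (f x) (f y) < ε ∧
      dist (fderiv ℝ f x) (fderiv ℝ f y) < ε := by
  have hopen : IsOpen {x | ContDiffAt ℝ 1 f x} := isOpen_iff_mem_nhds.2 fun x hx =>
    ContDiffAt.eventually hx (by simp)
  obtain ⟨η₀, hη₀, h₀⟩ := hK.exists_thickening_subset_open hopen hf
  obtain ⟨η₁, hη₁, h₁⟩ := Metric.mem_uniformity_dist.1
    (hK.uniformContinuousAt_of_continuousAt f (fun x hx => (hf x hx).continuousAt)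
      (Metric.dist_mem_uniformity hε))
  obtain ⟨η₂, hη₂, h₂⟩ := Metric.mem_uniformity_dist.1
    (hK.uniformContinuousAt_of_continuousAt (fderiv ℝ f)
      (fun x hx => ((hf x hx).fderiv_right (m := 0) (by simp)).continuousAt)
      (Metric.dist_mem_uniformity hε))
  refine ⟨min η₀ (min η₁ η₂), by positivity, fun x hx y hxy => ⟨h₀ ?_, h₁ ?_ hx, h₂ ?_ hx⟩⟩
  · exact mem_thickening_iff.2 ⟨x, hx, by rw [dist_comm]; exact hxy.trans_le (min_le_left _ _)⟩
  · exact hxy.trans_le ((min_le_right _ _).trans (min_le_left _ _))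
  · exact hxy.trans_le ((min_le_right _ _).trans (min_le_right _ _))

/-- The Cauchy estimate for the difference of two holomorphic functions. -/
theorem norm_deriv_sub_deriv_le {U : Set ℂ} (hU : IsOpen U) {f g : ℂ → ℂ}
    (hf : DifferentiableOn ℂ f U) (hg : DifferentiableOn ℂ g U) {c : ℂ} {r s ε : ℝ}
    (hrs : s < r) (hcU : closedBall c r ⊆ U) (h : ∀ w ∈ closedBall c r, ‖f w - g w‖ ≤ ε) :
    ∀ w ∈ closedBall c s, ‖deriv f w - deriv g w‖ ≤ ε / (r - s) := by
  intro w hw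
  have hsub : closedBall w (r - s) ⊆ closedBall c r := closedBall_subset_closedBall' (by
    have := mem_closedBall.1 hw; linarith)
  have hwU : w ∈ U := hcU (hsub (mem_closedBall_self (by linarith)))
  have hd : DifferentiableOn ℂ (f - g) U := hf.sub hg
  have h1 := Complex.norm_deriv_le_of_forall_mem_sphere_norm_le (f := f - g) (c := w)
    (sub_pos.2 hrs) ((hd.mono (hsub.trans hcU)).diffContOnCl_ball subset_rfl)
    (fun z hz => h z (hsub (sphere_subset_closedBall hz)))
  rwa [deriv_sub (hf.differentiableAt (hU.mem_nhds hwU)) (hg.differentiableAt (hU.mem_nhds hwU))]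
    at h1

/-- The differential of a `2`-jet `w ↦ (w, j w, j' w, j'' w)`, in terms of `j', j'', j'''`. -/
noncomputable def jetDeriv (a b c : ℂ) : ℂ →L[ℝ] ℂ × ℂ × ℂ × ℂ :=
  (ContinuousLinearMap.id ℝ ℂ).prod
    (((ContinuousLinearMap.toSpanSingleton ℂ a).restrictScalars ℝ).prod
      (((ContinuousLinearMap.toSpanSingleton ℂ b).restrictScalars ℝ).prod
        ((ContinuousLinearMap.toSpanSingleton ℂ c).restrictScalars ℝ)))

theorem hasFDerivAt_jet {j j1 j2 : ℂ → ℂ} {j3 w : ℂ} (h0 : HasDerivAt j (j1 w) w)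
    (h1 : HasDerivAt j1 (j2 w) w) (h2 : HasDerivAt j2 j3 w) :
    HasFDerivAt (fun w => (w, j w, j1 w, j2 w)) (jetDeriv (j1 w) (j2 w) j3) w :=
  (hasFDerivAt_id w).prodMk ((h0.hasFDerivAt.restrictScalars ℝ).prodMk
    ((h1.hasFDerivAt.restrictScalars ℝ).prodMk (h2.hasFDerivAt.restrictScalars ℝ)))

theorem norm_jetDeriv_sub_le {a b c a' b' c' : ℂ} {ε : ℝ} (ha : ‖a - a'‖ ≤ ε) (hb : ‖b - b'‖ ≤ ε)
    (hc : ‖c - c'‖ ≤ ε) : ‖jetDeriv a b c - jetDeriv a' b' c'‖ ≤ ε := by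
  have hε : 0 ≤ ε := (norm_nonneg _).trans ha
  refine ContinuousLinearMap.opNorm_le_bound _ hε fun v => ?_
  have e : (jetDeriv a b c - jetDeriv a' b' c') v = (0, v * (a - a'), v * (b - b'), v * (c - c')) := by
    simp [jetDeriv, mul_sub]
  have h : ∀ x : ℂ, ‖x‖ ≤ ε → ‖v * x‖ ≤ ε * ‖v‖ := fun x hx => by
    rw [norm_mul, mul_comm]; gcongr
  rw [e]
  refine norm_prod_le_iff.2 ⟨by simpa using by positivity, norm_prod_le_iff.2 ⟨h _ ha,
    norm_prod_le_iff.2 ⟨h _ hb, h _ hc⟩⟩⟩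

theorem norm_jetDeriv_le {a b c : ℂ} {M : ℝ} (hM : 1 ≤ M) (ha : ‖a‖ ≤ M) (hb : ‖b‖ ≤ M)
    (hc : ‖c‖ ≤ M) : ‖jetDeriv a b c‖ ≤ M := by
  refine ContinuousLinearMap.opNorm_le_bound _ (by linarith) fun v => ?_
  have e : jetDeriv a b c v = (v, v * a, v * b, v * c) := by simp [jetDeriv]
  have h : ∀ x : ℂ, ‖x‖ ≤ M → ‖v * x‖ ≤ M * ‖v‖ := fun x hx => by
    rw [norm_mul, mul_comm]; gcongr
  rw [e]
  exact norm_prod_le_iff.2 ⟨by simp only; nlinarith [norm_nonneg v], norm_prod_le_iff.2 ⟨h _ ha,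
    norm_prod_le_iff.2 ⟨h _ hb, h _ hc⟩⟩⟩

/-- If the Riemann map `j` of a domain is close to the one of the half-plane on a disk, then on a
smaller disk the Epstein map is `C¹`-close to the one of the half-plane, which is an isometry for the
Euclidean norm. In particular it is injective there, with a Lipschitz inverse.

The disks are compact subsets of the right half-plane, the smaller one containing all the points
needed later (see `mem_closedBall_of_re`). The difference `1 / 200` of the radii allows for three
Cauchy estimates, each on a disk smaller by `1 / 600`. -/
theorem exists_planarEpstein_stable : ∃ ε > 0, ∀ (U : Set ℂ) (j : ℂ → ℂ), IsOpen U →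
    DifferentiableOn ℂ j U → closedBall 20 (20 - 1 / 200) ⊆ U →
    (∀ w ∈ closedBall (20 : ℂ) (20 - 1 / 200), ‖j w - cayley w‖ ≤ ε) →
    (∀ w ∈ closedBall (20 : ℂ) (20 - 1 / 100),
      ‖planarEpstein (hypDensity j) w - ((w.im : ℂ) * Complex.I, w.re)‖ ≤ 1 / 100) ∧
    (∀ w ∈ closedBall (20 : ℂ) (20 - 1 / 100), ∀ w' ∈ closedBall (20 : ℂ) (20 - 1 / 100),
      ‖w - w'‖ ≤ 4 * ‖planarEpstein (hypDensity j) w - planarEpstein (hypDensity j) w'‖) := by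
  set H : Set ℂ := {w | 0 < w.re} with hH
  have hHo : IsOpen H := isOpen_lt continuous_const Complex.continuous_re
  have hball : ∀ r : ℝ, r < 20 → closedBall (20 : ℂ) r ⊆ H := fun r hr w hw => by
    have h1 := mem_closedBall_iff_norm.1 hw
    have h2 := (Complex.abs_re_le_norm (w - 20)).trans h1
    have h3 := (abs_le.1 h2).1
    simp at h3
    simp only [hH, mem_ofPred_eq]
    linarith
  have hne : ∀ w ∈ H, w + 1 ≠ 0 := fun w hw h => by
    have := congrArg Complex.re h
    simp only [hH, mem_ofPred_eq] at hw
    simp at this; linarith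
  have hT : DifferentiableOn ℂ cayley H := DifferentiableOn.div (by fun_prop) (by fun_prop) hne
  have hT1 := hT.deriv hHo
  have hT2 := hT1.deriv hHo
  have hT3 := hT2.deriv hHo
  have hTH : ∀ w ∈ H, ‖cayley w‖ < 1 ∧ deriv cayley w ≠ 0 := fun w hw => by
    have h := hypDensity_cayley hw
    simp only [hH, mem_ofPred_eq] at hw
    have hp : 0 < hypDensity cayley w := by rw [h]; positivity
    constructor
    · by_contra! hcon
      have : hypDensity cayley w ≤ 0 := div_nonpos_of_nonneg_of_nonpos (by positivity)
        (by nlinarith)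
      linarith
    · intro h0
      rw [hypDensity, h0] at hp
      simp at hp
  -- compactness of the jets of the Riemann map of the half-plane
  set Q : Set ℂ := closedBall 20 (20 - 1 / 100) with hQ
  have hQH : Q ⊆ H := hball _ (by norm_num)
  have hQc : IsCompact Q := isCompact_closedBall _ _
  set J : ℂ → ℂ × ℂ × ℂ × ℂ := fun w => (w, cayley w, deriv cayley w, deriv (deriv cayley) w) with hJ
  have hJc : ContinuousOn J Q := continuousOn_id.prodMk ((hT.continuousOn.mono hQH).prodMk
    ((hT1.continuousOn.mono hQH).prodMk (hT2.continuousOn.mono hQH)))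
  set K := J '' Q with hK
  have hKc : IsCompact K := hQc.image_of_continuousOn hJc
  have hKs : ∀ x ∈ K, ContDiffAt ℝ 1 epsteinJet x := by
    rintro _ ⟨w, hw, rfl⟩
    exact contDiffAt_epsteinJet (hTH w (hQH hw)).2 (hTH w (hQH hw)).1
  have hKs2 : ∀ x ∈ K, ContDiffAt ℝ 2 epsteinJet x := by
    rintro _ ⟨w, hw, rfl⟩
    exact contDiffAt_epsteinJet (hTH w (hQH hw)).2 (hTH w (hQH hw)).1
  obtain ⟨B₁, hB₁⟩ := (hKc.image_of_continuousOn (f := fderiv ℝ epsteinJet) fun x hx =>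
    ((hKs x hx).fderiv_right (m := 0) (by simp)).continuousAt.continuousWithinAt).isBounded.exists_norm_le
  obtain ⟨B₂, hB₂⟩ := (hQc.image_of_continuousOn
    ((hT1.continuousOn.mono hQH).prodMk ((hT2.continuousOn.mono hQH).prodMk
      (hT3.continuousOn.mono hQH)))).isBounded.exists_norm_le
  obtain ⟨M, hM1, hMB₁, hMB₂⟩ : ∃ M : ℝ, 1 ≤ M ∧ B₁ ≤ M ∧ B₂ ≤ M :=
    ⟨max 1 (max B₁ B₂), le_max_left _ _, (le_max_left _ _).trans (le_max_right _ _),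
      (le_max_right _ _).trans (le_max_right _ _)⟩
  have hM0 : 0 < M := by linarith
  have hUopen : IsOpen {x : ℂ × ℂ × ℂ × ℂ | x.2.2.1 ≠ 0 ∧ ‖x.2.1‖ < 1} :=
    (isOpen_ne_fun (f := fun x : ℂ × ℂ × ℂ × ℂ => x.2.2.1) (by fun_prop) continuous_const).inter
      (isOpen_lt (f := fun x : ℂ × ℂ × ℂ × ℂ => ‖x.2.1‖) (by fun_prop) continuous_const)
  obtain ⟨η₀, hη₀, hthick⟩ := hKc.exists_thickening_subset_open hUopen (by
    rintro _ ⟨w, hw, rfl⟩; exact ⟨(hTH w (hQH hw)).2, (hTH w (hQH hw)).1⟩)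
  obtain ⟨η₁, hη₁, hunif⟩ := exists_uniform_fderiv hKc hKs (ε := 1 / (100 * M)) (by positivity)
  obtain ⟨η, hη0, hηη₀, hηη₁, hη2⟩ : ∃ η > 0, η < η₀ ∧ η < η₁ ∧ η ≤ 1 / (100 * M) :=
    ⟨min (min η₀ η₁) (1 / (100 * M)) / 2, by positivity,
      by
        have h1 : min (min η₀ η₁) (1 / (100 * M)) ≤ η₀ := (min_le_left _ _).trans (min_le_left _ _)
        linarith,
      by
        have h1 : min (min η₀ η₁) (1 / (100 * M)) ≤ η₁ := (min_le_left _ _).trans (min_le_right _ _)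
        linarith,
      by
        have h1 : min (min η₀ η₁) (1 / (100 * M)) ≤ 1 / (100 * M) := min_le_right _ _
        have h2 : 0 < 1 / (100 * M) := by positivity
        linarith⟩
  refine ⟨η / 600 ^ 3, by positivity, fun U j hUo hj hQU hclose => ?_⟩
  -- the Cauchy estimates for the first three derivatives
  set V := U ∩ H with hV
  have hVo : IsOpen V := hUo.inter hHo
  have hjV : DifferentiableOn ℂ j V := hj.mono inter_subset_left
  have hTV : DifferentiableOn ℂ cayley V := hT.mono inter_subset_right
  have hj1 := hjV.deriv hVo
  have hj2 := hj1.deriv hVo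
  have hj3 := hj2.deriv hVo
  have hbV : ∀ r : ℝ, r ≤ 20 - 1 / 200 → closedBall (20 : ℂ) r ⊆ V := fun r hr =>
    subset_inter ((closedBall_subset_closedBall hr).trans hQU) (hball r (by linarith))
  have d1 := norm_deriv_sub_deriv_le hVo hjV hTV (s := 20 - 1 / 200 - 1 / 600) (by norm_num)
    (hbV _ le_rfl) hclose
  have d2 := norm_deriv_sub_deriv_le hVo hj1 (hTV.deriv hVo) (s := 20 - 1 / 200 - 2 / 600)
    (by norm_num) (hbV _ (by norm_num)) d1
  have d3 := norm_deriv_sub_deriv_le hVo hj2 ((hTV.deriv hVo).deriv hVo) (s := 20 - 1 / 100)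
    (by norm_num) (hbV _ (by norm_num)) d2
  have hQV : Q ⊆ V := hbV _ (by norm_num)
  have b0 : ∀ w ∈ Q, ‖j w - cayley w‖ ≤ η := fun w hw => (hclose w
    (closedBall_subset_closedBall (by norm_num) hw)).trans (by rw [div_le_iff₀ (by positivity)]; nlinarith)
  have b1 : ∀ w ∈ Q, ‖deriv j w - deriv cayley w‖ ≤ η := fun w hw => (d1 w
    (closedBall_subset_closedBall (by norm_num) hw)).trans (by norm_num; nlinarith)
  have b2 : ∀ w ∈ Q, ‖deriv (deriv j) w - deriv (deriv cayley) w‖ ≤ η := fun w hw => (d2 w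
    (closedBall_subset_closedBall (by norm_num) hw)).trans (by norm_num; nlinarith)
  have b3 : ∀ w ∈ Q, ‖deriv (deriv (deriv j)) w - deriv (deriv (deriv cayley)) w‖ ≤ η :=
    fun w hw => (d3 w hw).trans (by norm_num; nlinarith)
  set G : ℂ → ℂ × ℂ × ℂ × ℂ := fun w => (w, j w, deriv j w, deriv (deriv j) w) with hG
  have hGJ : ∀ w ∈ Q, dist (J w) (G w) ≤ η := fun w hw => by
    rw [dist_comm, dist_eq_norm]
    exact norm_prod_le_iff.2 ⟨by simp [hG, hJ, hη0.le], norm_prod_le_iff.2 ⟨b0 w hw,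
      norm_prod_le_iff.2 ⟨b1 w hw, b2 w hw⟩⟩⟩
  have hder : ∀ {f : ℂ → ℂ} {S : Set ℂ}, IsOpen S → DifferentiableOn ℂ f S → ∀ w ∈ S,
      HasDerivAt f (deriv f w) w := fun hS hf w hw =>
    (hf.differentiableAt (hS.mem_nhds hw)).hasDerivAt
  have hEp : ∀ w ∈ Q, planarEpstein (hypDensity j) w = epsteinJet (G w) := fun w hw => by
    have h1 : G w ∈ {x : ℂ × ℂ × ℂ × ℂ | x.2.2.1 ≠ 0 ∧ ‖x.2.1‖ < 1} := hthick
      (mem_thickening_iff.2 ⟨J w, mem_image_of_mem _ hw, by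
        rw [dist_comm]; exact (hGJ w hw).trans_lt hηη₀⟩)
    exact planarEpstein_hypDensity (hder hVo hjV w (hQV hw)) (hder hVo hj1 w (hQV hw)) h1.1 h1.2
  have hEpT : ∀ w ∈ Q, ((w.im : ℂ) * Complex.I, w.re) = epsteinJet (J w) := fun w hw => by
    rw [← planarEpstein_cayley (hQH hw)]
    exact planarEpstein_hypDensity (hder hHo hT w (hQH hw)) (hder hHo hT1 w (hQH hw))
      (hTH w (hQH hw)).2 (hTH w (hQH hw)).1
  have hu : ∀ w ∈ Q, _ := fun w hw => hunif (J w) (mem_image_of_mem _ hw) (G w)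
    ((hGJ w hw).trans_lt hηη₁)
  have hM100 : 1 / (100 * M) ≤ 1 / 100 := one_div_le_one_div_of_le (by norm_num) (by linarith)
  -- the difference of the two Epstein maps has a small derivative
  have hD : ∀ w ∈ Q, HasFDerivWithinAt (fun w => epsteinJet (G w) - epsteinJet (J w))
      ((fderiv ℝ epsteinJet (G w)).comp
        (jetDeriv (deriv j w) (deriv (deriv j) w) (deriv (deriv (deriv j)) w)) -
      (fderiv ℝ epsteinJet (J w)).comp
        (jetDeriv (deriv cayley w) (deriv (deriv cayley) w) (deriv (deriv (deriv cayley)) w))) Q w :=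
    fun w hw => by
      have hGd := hasFDerivAt_jet (hder hVo hjV w (hQV hw)) (hder hVo hj1 w (hQV hw))
        (hder hVo hj2 w (hQV hw))
      have hJd := hasFDerivAt_jet (hder hHo hT w (hQH hw)) (hder hHo hT1 w (hQH hw))
        (hder hHo hT2 w (hQH hw))
      have e1 := ((hu w hw).1.differentiableAt one_ne_zero).hasFDerivAt.comp w hGd
      have e2 := ((hKs _ (mem_image_of_mem _ hw)).differentiableAt one_ne_zero).hasFDerivAt.comp w hJd
      exact (e1.sub e2).hasFDerivWithinAt
  have hDb : ∀ w ∈ Q, ‖(fderiv ℝ epsteinJet (G w)).comp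
        (jetDeriv (deriv j w) (deriv (deriv j) w) (deriv (deriv (deriv j)) w)) -
      (fderiv ℝ epsteinJet (J w)).comp
        (jetDeriv (deriv cayley w) (deriv (deriv cayley) w) (deriv (deriv (deriv cayley)) w))‖
      ≤ 1 / 4 := fun w hw => by
    set A := fderiv ℝ epsteinJet (G w)
    set A' := fderiv ℝ epsteinJet (J w)
    set L := jetDeriv (deriv j w) (deriv (deriv j) w) (deriv (deriv (deriv j)) w)
    set L' := jetDeriv (deriv cayley w) (deriv (deriv cayley) w) (deriv (deriv (deriv cayley)) w)
    have hA : ‖A - A'‖ ≤ 1 / (100 * M) := by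
      have := (hu w hw).2.2.le
      rwa [dist_comm, dist_eq_norm] at this
    have hA' : ‖A'‖ ≤ M := (hB₁ _ (mem_image_of_mem _ (mem_image_of_mem _ hw))).trans hMB₁
    have hL : ‖L - L'‖ ≤ η := norm_jetDeriv_sub_le (b1 w hw) (b2 w hw) (b3 w hw)
    have hB := norm_prod_le_iff.1 ((hB₂ _ (mem_image_of_mem _ hw)).trans hMB₂)
    have hB' := norm_prod_le_iff.1 hB.2
    have hL' : ‖L'‖ ≤ M := norm_jetDeriv_le hM1 hB.1 hB'.1 hB'.2
    have e : A.comp L - A'.comp L' = (A - A').comp L' + ((A - A').comp (L - L') + A'.comp (L - L')) := by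
      simp only [ContinuousLinearMap.comp_sub, ContinuousLinearMap.sub_comp]; abel
    rw [e]
    have n1 : ‖(A - A').comp L'‖ ≤ 1 / (100 * M) * M :=
      (ContinuousLinearMap.opNorm_comp_le _ _).trans (by gcongr)
    have n2 : ‖(A - A').comp (L - L')‖ ≤ 1 / (100 * M) * (1 / (100 * M)) :=
      (ContinuousLinearMap.opNorm_comp_le _ _).trans (by gcongr; exact hL.trans hη2)
    have n3 : ‖A'.comp (L - L')‖ ≤ M * (1 / (100 * M)) :=
      (ContinuousLinearMap.opNorm_comp_le _ _).trans (by gcongr; exact hL.trans hη2)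
    have e1 : 1 / (100 * M) * M = 1 / 100 := by field_simp
    have e2 : M * (1 / (100 * M)) = 1 / 100 := by field_simp
    have e3 : 1 / (100 * M) * (1 / (100 * M)) ≤ 1 / 100 * (1 / 100) := by gcongr
    have t1 := norm_add_le ((A - A').comp L') ((A - A').comp (L - L') + A'.comp (L - L'))
    have t2 := norm_add_le ((A - A').comp (L - L')) (A'.comp (L - L'))
    linarith
  refine ⟨fun w hw => ?_, fun w hw w' hw' => ?_⟩
  · rw [hEp w hw, hEpT w hw, ← dist_eq_norm, dist_comm]
    exact (hu w hw).2.1.le.trans hM100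
  · have hmv := (convex_closedBall (20 : ℂ) (20 - 1 / 100)).norm_image_sub_le_of_norm_hasFDerivWithin_le
      hD hDb hw' hw
    simp only [← hEp w hw, ← hEp w' hw', ← hEpT w hw, ← hEpT w' hw'] at hmv
    set P := planarEpstein (hypDensity j) w
    set P' := planarEpstein (hypDensity j) w'
    set X : ℂ × ℝ := ((w.im : ℂ) * Complex.I, w.re) with hX
    set X' : ℂ × ℝ := ((w'.im : ℂ) * Complex.I, w'.re) with hX'
    have h1 : ‖X - X'‖ ≤ ‖P - P'‖ + ‖P - X - (P' - X')‖ := by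
      have : X - X' = (P - P') - (P - X - (P' - X')) := by abel
      rw [this]; exact norm_sub_le _ _
    have h2 : |(w - w').im| ≤ ‖X - X'‖ := by
      refine le_trans (le_of_eq ?_) (norm_fst_le (X - X'))
      simp only [hX, hX', Prod.fst_sub]
      rw [← sub_mul, norm_mul, Complex.norm_I, mul_one, ← Complex.ofReal_sub, Complex.norm_real,
        Real.norm_eq_abs, Complex.sub_im]
    have h3 : |(w - w').re| ≤ ‖X - X'‖ := by
      refine le_trans (le_of_eq ?_) (norm_snd_le (X - X'))
      simp only [hX, hX', Prod.snd_sub, Real.norm_eq_abs, Complex.sub_re]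
    have h4 := Complex.norm_le_abs_re_add_abs_im (w - w')
    linarith


/-! ### Normalization of Riemann maps -/

/-- The automorphism of the unit disk sending `a` to `0`. -/
noncomputable def diskAut (a ζ : ℂ) : ℂ := (ζ - a) / (1 - (starRingEnd ℂ) a * ζ)

theorem one_sub_conj_mul_ne_zero {a ζ : ℂ} (ha : ‖a‖ < 1) (hζ : ‖ζ‖ < 1) :
    1 - (starRingEnd ℂ) a * ζ ≠ 0 := fun h => by
  have h1 : ‖(starRingEnd ℂ) a * ζ‖ = 1 := by rw [← sub_eq_zero.1 h, norm_one]
  rw [norm_mul, Complex.norm_conj] at h1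
  nlinarith [norm_nonneg a, norm_nonneg ζ]

theorem one_sub_sq_norm_diskAut {a ζ : ℂ} (ha : ‖a‖ < 1) (hζ : ‖ζ‖ < 1) :
    1 - ‖diskAut a ζ‖ ^ 2 = (1 - ‖a‖ ^ 2) * (1 - ‖ζ‖ ^ 2) / ‖1 - (starRingEnd ℂ) a * ζ‖ ^ 2 := by
  have h1 : ‖1 - (starRingEnd ℂ) a * ζ‖ ^ 2 - ‖ζ - a‖ ^ 2 = (1 - ‖a‖ ^ 2) * (1 - ‖ζ‖ ^ 2) := by
    simp only [← Complex.normSq_eq_norm_sq, Complex.normSq_apply]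
    simp; ring
  have h2 := norm_pos_iff.2 (one_sub_conj_mul_ne_zero ha hζ)
  rw [diskAut, norm_div, div_pow, ← h1, sub_div, div_self (by positivity)]

theorem norm_diskAut_lt {a ζ : ℂ} (ha : ‖a‖ < 1) (hζ : ‖ζ‖ < 1) : ‖diskAut a ζ‖ < 1 := by
  have h := one_sub_sq_norm_diskAut ha hζ
  have h2 := norm_pos_iff.2 (one_sub_conj_mul_ne_zero ha hζ)
  have h3 : 0 < 1 - ‖a‖ ^ 2 := by nlinarith [norm_nonneg a]
  have h4 : 0 < 1 - ‖ζ‖ ^ 2 := by nlinarith [norm_nonneg ζ]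
  have h5 : 0 < (1 - ‖a‖ ^ 2) * (1 - ‖ζ‖ ^ 2) / ‖1 - (starRingEnd ℂ) a * ζ‖ ^ 2 := by positivity
  nlinarith [norm_nonneg (diskAut a ζ)]

theorem hasDerivAt_diskAut {a ζ : ℂ} (ha : ‖a‖ < 1) (hζ : ‖ζ‖ < 1) :
    HasDerivAt (diskAut a) ((1 - ‖a‖ ^ 2 : ℝ) / (1 - (starRingEnd ℂ) a * ζ) ^ 2) ζ := by
  have := ((hasDerivAt_id ζ).sub_const a).fun_div
    (((hasDerivAt_id ζ).const_mul ((starRingEnd ℂ) a)).const_sub 1)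
    (one_sub_conj_mul_ne_zero ha hζ)
  refine this.congr_deriv ?_
  congr 1
  have h : ((‖a‖ ^ 2 : ℝ) : ℂ) = (starRingEnd ℂ) a * a := by
    rw [← Complex.normSq_eq_norm_sq, Complex.normSq_eq_conj_mul_self]
  rw [Complex.ofReal_sub, h]
  simp only [id]
  push_cast
  ring

theorem diskAut_neg_diskAut {a ζ : ℂ} (ha : ‖a‖ < 1) (hζ : ‖ζ‖ < 1) :
    diskAut (-a) (diskAut a ζ) = ζ := by
  have h0 := one_sub_conj_mul_ne_zero ha hζ
  have h1 := one_sub_conj_mul_ne_zero ha ha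
  have e1 : diskAut a ζ - -a = ζ * (1 - (starRingEnd ℂ) a * a) / (1 - (starRingEnd ℂ) a * ζ) := by
    rw [diskAut, eq_div_iff h0, sub_mul, div_mul_cancel₀ _ h0]; ring
  have e2 : 1 - (starRingEnd ℂ) (-a) * diskAut a ζ =
      (1 - (starRingEnd ℂ) a * a) / (1 - (starRingEnd ℂ) a * ζ) := by
    rw [diskAut, eq_div_iff h0, sub_mul, mul_assoc, div_mul_cancel₀ _ h0, map_neg]; ring
  rw [diskAut, e1, e2, div_div_div_cancel_right₀ h0, mul_div_assoc, div_self h1, mul_one]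

/-- A Riemann map `k` of a planar domain `Ω`, with inverse `f`. -/
structure IsRiemannMap (k f : ℂ → ℂ) (Ω : Set ℂ) : Prop where
  isOpen : IsOpen Ω
  differentiableOn : DifferentiableOn ℂ k Ω
  mapsTo : MapsTo k Ω (ball 0 1)
  differentiableOn_inv : DifferentiableOn ℂ f (ball 0 1)
  mapsTo_inv : MapsTo f (ball 0 1) Ω
  leftInvOn : LeftInvOn f k Ω

namespace IsRiemannMap

variable {k f : ℂ → ℂ} {Ω : Set ℂ}

theorem norm_lt (h : IsRiemannMap k f Ω) {z : ℂ} (hz : z ∈ Ω) : ‖k z‖ < 1 :=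
  mem_ball_zero_iff.1 (h.mapsTo hz)

theorem hasDerivAt (h : IsRiemannMap k f Ω) {z : ℂ} (hz : z ∈ Ω) : HasDerivAt k (deriv k z) z :=
  (h.differentiableOn.differentiableAt (h.isOpen.mem_nhds hz)).hasDerivAt

theorem hasDerivAt_deriv (h : IsRiemannMap k f Ω) {z : ℂ} (hz : z ∈ Ω) :
    HasDerivAt (deriv k) (deriv (deriv k) z) z :=
  ((h.differentiableOn.deriv h.isOpen).differentiableAt (h.isOpen.mem_nhds hz)).hasDerivAt

theorem deriv_inv_mul_deriv (h : IsRiemannMap k f Ω) {z : ℂ} (hz : z ∈ Ω) :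
    deriv f (k z) * deriv k z = 1 := by
  have h1 : HasDerivAt (f ∘ k) (deriv f (k z) * deriv k z) z :=
    (h.differentiableOn_inv.differentiableAt
      (isOpen_ball.mem_nhds (h.mapsTo hz))).hasDerivAt.comp z (h.hasDerivAt hz)
  have h2 : HasDerivAt (f ∘ k) 1 z := (hasDerivAt_id z).congr_of_eventuallyEq
    (Filter.eventually_of_mem (h.isOpen.mem_nhds hz) fun x hx => h.leftInvOn hx)
  exact h1.unique h2

theorem deriv_ne_zero (h : IsRiemannMap k f Ω) {z : ℂ} (hz : z ∈ Ω) : deriv k z ≠ 0 :=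
  right_ne_zero_of_mul_eq_one (h.deriv_inv_mul_deriv hz)

theorem hypDensity_pos (h : IsRiemannMap k f Ω) {z : ℂ} (hz : z ∈ Ω) : 0 < hypDensity k z := by
  have h1 := norm_pos_iff.2 (h.deriv_ne_zero hz)
  have h2 := h.norm_lt hz
  have h3 : 0 < 1 - ‖k z‖ ^ 2 := by nlinarith [norm_nonneg (k z)]
  rw [hypDensity]
  positivity

theorem differentiableAt_hypDensity (h : IsRiemannMap k f Ω) {z : ℂ} (hz : z ∈ Ω) :
    DifferentiableAt ℝ (hypDensity k) z := by
  obtain ⟨L, hL, -⟩ := hasFDerivAt_hypDensity (h.hasDerivAt hz) (h.hasDerivAt_deriv hz)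
    (h.deriv_ne_zero hz) (h.norm_lt hz)
  exact hL.differentiableAt

/-- The hyperbolic metric is invariant: composing the Riemann map with a similarity of the plane, an
automorphism of the disk and a rotation rescales the density. These can be chosen such that the new
Riemann map is `0` at `1` and has a positive derivative there. -/
theorem exists_normalized (h : IsRiemannMap k f Ω) {p u : ℂ} {d : ℝ} (hd : 0 < d) (hu : ‖u‖ = 1)
    (hz : p + d * u ∈ Ω) : ∃ j g : ℂ → ℂ, IsRiemannMap j g {w | p + d * u * w ∈ Ω} ∧ j 1 = 0 ∧
      (∃ α : ℝ, 0 < α ∧ deriv j 1 = α) ∧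
      ∀ w, p + d * u * w ∈ Ω → hypDensity j w = d * hypDensity k (p + d * u * w) := by
  have hm0 : (d : ℂ) * u ≠ 0 := mul_ne_zero (by exact_mod_cast hd.ne') fun h0 => by simp [h0] at hu
  obtain ⟨m, hm⟩ : ∃ m, m = (d : ℂ) * u := ⟨_, rfl⟩
  have hmn : ‖m‖ = d := by rw [hm, norm_mul, hu, Complex.norm_real, Real.norm_of_nonneg hd.le, mul_one]
  rw [← hm] at hz hm0 ⊢
  obtain ⟨a, ha⟩ : ∃ a, a = k (p + m) := ⟨_, rfl⟩
  have ha1 : ‖a‖ < 1 := by rw [ha]; exact h.norm_lt hz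
  have hna1 : ‖-a‖ < 1 := by rwa [norm_neg]
  set K : ℂ → ℂ := fun w => diskAut a (k (p + m * w)) with hK
  have hKd : ∀ w, p + m * w ∈ Ω → HasDerivAt K ((1 - ‖a‖ ^ 2 : ℝ) /
      (1 - (starRingEnd ℂ) a * k (p + m * w)) ^ 2 * (deriv k (p + m * w) * m)) w := fun w hw => by
    have h1 : HasDerivAt (fun w => p + m * w) m w := by
      simpa using ((hasDerivAt_id w).const_mul m).const_add p
    have h2 := HasDerivAt.comp w (h.hasDerivAt hw) h1
    exact HasDerivAt.comp (h₂ := diskAut a) w (hasDerivAt_diskAut ha1 (h.norm_lt hw)) h2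
  have hpos : 0 < 1 - ‖a‖ ^ 2 := by nlinarith [norm_nonneg a]
  have hz1 : p + m * 1 ∈ Ω := by rwa [mul_one]
  obtain ⟨D, hD⟩ : ∃ D, HasDerivAt K D 1 ∧ D ≠ 0 := ⟨_, hKd 1 hz1, by
    refine mul_ne_zero (div_ne_zero (by exact_mod_cast hpos.ne') (pow_ne_zero _
      (one_sub_conj_mul_ne_zero ha1 (h.norm_lt hz1)))) (mul_ne_zero (h.deriv_ne_zero hz1) hm0)⟩
  have hDn : 0 < ‖D‖ := norm_pos_iff.2 hD.2
  -- the rotation making the derivative at `1` positive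
  obtain ⟨β, hβ⟩ : ∃ β : ℂ, β = (starRingEnd ℂ) D / ‖D‖ := ⟨_, rfl⟩
  have hβn : ‖β‖ = 1 := by
    rw [hβ, norm_div, Complex.norm_conj, Complex.norm_real, norm_norm, div_self hDn.ne']
  have hβ0 : β ≠ 0 := fun h0 => by simp [h0] at hβn
  have hβD : β * D = (‖D‖ : ℂ) := by
    have h1 : ((‖D‖ ^ 2 : ℝ) : ℂ) = (starRingEnd ℂ) D * D := by
      rw [← Complex.normSq_eq_norm_sq, Complex.normSq_eq_conj_mul_self]
    have h2 : (‖D‖ : ℂ) ≠ 0 := by exact_mod_cast hDn.ne'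
    rw [hβ, div_mul_eq_mul_div, ← h1, div_eq_iff h2]
    push_cast; ring
  have hopen : IsOpen {w | p + m * w ∈ Ω} := h.isOpen.preimage (by fun_prop)
  have hb : ∀ ζ ∈ ball (0 : ℂ) 1, ‖ζ / β‖ < 1 := fun ζ hζ => by
    rw [norm_div, hβn, div_one]; exact mem_ball_zero_iff.1 hζ
  refine ⟨fun w => β * K w, fun ζ => (f (diskAut (-a) (ζ / β)) - p) / m,
    ⟨hopen, ?_, ?_, ?_, ?_, ?_⟩, ?_, ⟨‖D‖, hDn, ?_⟩, ?_⟩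
  · exact fun w hw => ((hKd w hw).const_mul β).differentiableAt.differentiableWithinAt
  · intro w hw
    rw [mem_ball_zero_iff, norm_mul, hβn, one_mul]
    exact norm_diskAut_lt ha1 (h.norm_lt hw)
  · refine DifferentiableOn.div_const (DifferentiableOn.sub_const
      (h.differentiableOn_inv.comp (t := ball 0 1) (f := fun ζ => diskAut (-a) (ζ / β)) ?_ ?_) _) _
    · exact fun ζ hζ => (HasDerivAt.comp ζ (hasDerivAt_diskAut hna1 (hb ζ hζ))
        ((hasDerivAt_id ζ).div_const β)).differentiableAt.differentiableWithinAt
    · exact fun ζ hζ => mem_ball_zero_iff.2 (norm_diskAut_lt hna1 (hb ζ hζ))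
  · intro ζ hζ
    have e : p + m * ((f (diskAut (-a) (ζ / β)) - p) / m) = f (diskAut (-a) (ζ / β)) := by
      field_simp; ring
    simp only [mem_ofPred_eq]
    rw [e]
    exact h.mapsTo_inv (mem_ball_zero_iff.2 (norm_diskAut_lt hna1 (hb ζ hζ)))
  · intro w hw
    simp only [mul_div_cancel_left₀ _ hβ0, hK]
    rw [diskAut_neg_diskAut ha1 (h.norm_lt hw), h.leftInvOn hw]
    field_simp
    ring
  · simp only [hK, mul_one, ← ha]; simp [diskAut]
  · rw [(hD.1.const_mul β).deriv, hβD]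
  · intro w hw
    rw [hypDensity, hypDensity, ((hKd w hw).const_mul β).deriv, norm_mul, norm_mul β, hβn, one_mul,
      one_mul, hK]
    simp only
    rw [one_sub_sq_norm_diskAut ha1 (h.norm_lt hw), norm_mul, norm_mul, norm_div, norm_pow, hmn,
      Complex.norm_real, Real.norm_of_nonneg hpos.le]
    have h2 := norm_pos_iff.2 (one_sub_conj_mul_ne_zero ha1 (h.norm_lt hw))
    have h4 : 0 < 1 - ‖k (p + m * w)‖ ^ 2 := by nlinarith [norm_nonneg (k (p + m * w)), h.norm_lt hw]
    field_simp

end IsRiemannMap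

/-- Epstein maps commute with similarities. -/
theorem planarEpstein_similarity {σ τ : ℂ → ℝ} {p m w : ℂ} {d : ℝ} (hd : 0 < d) (hm : ‖m‖ = d)
    (hσ : DifferentiableAt ℝ σ (p + m * w)) (hσ0 : 0 < σ (p + m * w))
    (h : τ =ᶠ[𝓝 w] fun w => d * σ (p + m * w)) :
    planarEpstein σ (p + m * w) = (p + m * (planarEpstein τ w).1, d * (planarEpstein τ w).2) := by
  have hτ : τ w = d * σ (p + m * w) := h.eq_of_nhds
  have hmC : (starRingEnd ℂ) m * m = ((d ^ 2 : ℝ) : ℂ) := by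
    rw [← hm, ← Complex.normSq_eq_norm_sq, Complex.normSq_eq_conj_mul_self]
  have hs : halfGradLog τ w = (starRingEnd ℂ) m * halfGradLog σ (p + m * w) := by
    refine halfGradLog_eq (by rw [hτ]; positivity) fun v => ?_
    have h1 : HasFDerivAt (fun w : ℂ => p + m * w)
        ((ContinuousLinearMap.toSpanSingleton ℂ m).restrictScalars ℝ) w := by
      have : HasDerivAt (fun w => p + m * w) m w := by
        simpa using ((hasDerivAt_id w).const_mul m).const_add p
      exact this.hasFDerivAt.restrictScalars ℝ
    have h2 := (hσ.hasFDerivAt.comp w h1).const_mul d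
    have h3 := h2.congr_of_eventuallyEq h
    rw [h3.fderiv, hτ]
    simp only [smul_apply, ContinuousLinearMap.comp_apply, smul_eq_mul,
      ContinuousLinearMap.coe_restrictScalars', ContinuousLinearMap.toSpanSingleton_apply]
    rw [fderiv_eq_halfGradLog hσ0.ne', map_mul, Complex.conj_conj]
    ring_nf
  have hn : ‖halfGradLog τ w‖ ^ 2 + τ w ^ 2 / 4 = d ^ 2 *
      (‖halfGradLog σ (p + m * w)‖ ^ 2 + σ (p + m * w) ^ 2 / 4) := by
    rw [hs, hτ, norm_mul, Complex.norm_conj, hm]; ring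
  rw [planarEpstein, planarEpstein, epsteinPoint, epsteinPoint, hn, hs, hτ]
  obtain ⟨N, hN⟩ : ∃ N, N = ‖halfGradLog σ (p + m * w)‖ ^ 2 + σ (p + m * w) ^ 2 / 4 := ⟨_, rfl⟩
  rw [← hN]
  have hdC : ((d ^ 2 : ℝ) : ℂ) ≠ 0 := by
    have : d ^ 2 ≠ 0 := by positivity
    exact_mod_cast this
  refine Prod.ext ?_ ?_
  · simp only
    rw [mul_inv, Complex.ofReal_mul, Complex.ofReal_inv (d ^ 2)]
    have : m * (w + ((d ^ 2 : ℝ) : ℂ)⁻¹ * (N⁻¹ : ℝ) * ((starRingEnd ℂ) m * halfGradLog σ (p + m * w)))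
        = m * w + ((d ^ 2 : ℝ) : ℂ)⁻¹ * ((starRingEnd ℂ) m * m) * ((N⁻¹ : ℝ) *
          halfGradLog σ (p + m * w)) := by ring
    rw [this, hmC, inv_mul_cancel₀ hdC]
    ring
  · simp only [mul_inv]
    field_simp


/-! ### The planar Epstein–Poincaré map near a flat curve -/

/-- The picture of a component `Ω` near its point `z` at the scale of the distance `d` to the curve:
in the coordinate `w`, where `p + d u w` is the point of the plane, `Ω` is almost a half-plane, its
Epstein map `E'` is almost the one of the half-plane, and `E'` has a Lipschitz inverse. -/
theorem exists_local_picture {c : ℝ → ℂ} (hc : IsFlatCurve c) {Ω : Set ℂ}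
    (hΩ : IsPlanarComponent Ω (range c)) {k f : ℂ → ℂ} (hk : IsRiemannMap k f Ω) :
    ∃ δ > 0, ∀ z ∈ Ω, infDist z (range c) < δ → ∃ (p u : ℂ) (d R : ℝ) (E' : ℂ → ℂ × ℝ),
      d = infDist z (range c) ∧ 0 < d ∧ ‖u‖ = 1 ∧ z = p + d * u ∧ 100 ≤ R ∧
      (∀ w ∈ ball (-((R + 1 / R : ℝ) : ℂ)) R, p + d * u * w ∉ Ω) ∧
      (∀ w ∈ closedBall (20 : ℂ) (20 - 1 / 100), planarEpstein (hypDensity k) (p + d * u * w) =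
        (p + d * u * (E' w).1, d * (E' w).2)) ∧
      (∀ w ∈ closedBall (20 : ℂ) (20 - 1 / 100),
        ‖E' w - ((w.im : ℂ) * Complex.I, w.re)‖ ≤ 1 / 100) ∧
      (∀ w ∈ closedBall (20 : ℂ) (20 - 1 / 100), ∀ w' ∈ closedBall (20 : ℂ) (20 - 1 / 100),
        ‖w - w'‖ ≤ 4 * ‖E' w - E' w'‖) := by
  obtain ⟨ε, hε, hstab⟩ := exists_planarEpstein_stable
  obtain ⟨R₀, hR₀, hcay⟩ := exists_close_cayley (isCompact_closedBall (20 : ℂ) (20 - 1 / 200))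
    (fun w hw => by
      have h1 := mem_closedBall_iff_norm.1 hw
      have h2 := (abs_le.1 ((Complex.abs_re_le_norm (w - 20)).trans h1)).1
      simp at h2
      linarith) hε
  obtain ⟨R, hRR₀, hR⟩ : ∃ R, R₀ ≤ R ∧ 400 ≤ R := ⟨max R₀ 400, le_max_left _ _, le_max_right _ _⟩
  have hR0 : 0 < R := by linarith
  obtain ⟨δ, hδ, hdisk⟩ := hc.exists_disks hΩ (R := R) (by linarith)
  refine ⟨δ, hδ, fun z hz hzδ => ?_⟩
  obtain ⟨p, u, d, hd, hd0, hu, -, hzp, hin, hout⟩ := hdisk z hz hzδ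
  obtain ⟨j, g, hj, hj1, ⟨α, hα, hjα⟩, hjσ⟩ := hk.exists_normalized hd0 hu (hzp ▸ hz)
  have hRi : 1 / R ≤ 1 / 400 := one_div_le_one_div_of_le (by norm_num) hR
  have hRi0 : 0 < 1 / R := by positivity
  have hQR : closedBall (20 : ℂ) (20 - 1 / 200) ⊆ ball ((R + 1 / R : ℝ) : ℂ) R := by
    refine closedBall_subset_ball' ?_
    have : dist (20 : ℂ) ((R + 1 / R : ℝ) : ℂ) = R + 1 / R - 20 := by
      rw [show (20 : ℂ) = ((20 : ℝ) : ℂ) by norm_num, Complex.dist_eq, ← Complex.ofReal_sub,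
        Complex.norm_real, Real.norm_eq_abs, abs_of_neg (by linarith)]
      ring
    rw [this]
    linarith
  have hclose := hcay R hRR₀ hQR _ j g hin (disjoint_left.2 fun w hw => hout w hw) hj.isOpen
    hj.differentiableOn hj.mapsTo hj.differentiableOn_inv hj.mapsTo_inv hj.leftInvOn hj1 α hα hjα
  have hQΩ : closedBall (20 : ℂ) (20 - 1 / 200) ⊆ {w | p + d * u * w ∈ Ω} :=
    fun w hw => hin w (hQR hw)
  obtain ⟨hE1, hE2⟩ := hstab _ j hj.isOpen hj.differentiableOn hQΩ hclose
  refine ⟨p, u, d, R, planarEpstein (hypDensity j), hd, hd0, hu, hzp, by linarith, hout,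
    fun w hw => ?_, hE1, hE2⟩
  have hw : p + d * u * w ∈ Ω := hQΩ (closedBall_subset_closedBall (by norm_num) hw)
  refine planarEpstein_similarity hd0 ?_ (hk.differentiableAt_hypDensity hw) (hk.hypDensity_pos hw) ?_
  · rw [norm_mul, hu, mul_one, Complex.norm_real, Real.norm_of_nonneg hd0.le]
  · exact Filter.eventually_of_mem (hj.isOpen.mem_nhds hw) fun x hx => hjσ x hx

theorem mem_closedBall_of_re {w : ℂ} (h1 : 1 / 8 ≤ w.re) (h2 : ‖w‖ ≤ 2) :
    w ∈ closedBall (20 : ℂ) (20 - 1 / 100) := by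
  rw [mem_closedBall_iff_norm, ← sq_le_sq₀ (norm_nonneg _) (by norm_num),
    ← Complex.normSq_eq_norm_sq, Complex.normSq_apply]
  have h3 : w.re * w.re + w.im * w.im ≤ 4 := by
    rw [← Complex.normSq_apply, Complex.normSq_eq_norm_sq]
    nlinarith [norm_nonneg w]
  simp
  nlinarith

/-- Near a flat curve, the Epstein–Poincaré map of a component of the complement is close to the
identity, injective, and an immersion. -/
theorem exists_planarEpstein_injOn {c : ℝ → ℂ} (hc : IsFlatCurve c) {Ω : Set ℂ}
    (hΩ : IsPlanarComponent Ω (range c)) {k f : ℂ → ℂ} (hk : IsRiemannMap k f Ω) :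
    ∃ δ > 0,
      (∀ z ∈ Ω, infDist z (range c) < δ →
        ‖planarEpstein (hypDensity k) z - (z, 0)‖ ≤ 2 * infDist z (range c)) ∧
      InjOn (planarEpstein (hypDensity k)) {z ∈ Ω | infDist z (range c) < δ} ∧
      ∀ z ∈ Ω, infDist z (range c) < δ → ∀ L : ℂ →L[ℝ] ℂ × ℝ,
        HasFDerivAt (planarEpstein (hypDensity k)) L z → Function.Injective L := by
  obtain ⟨δ, hδ, hloc⟩ := exists_local_picture hc hΩ hk
  have h1Q : (1 : ℂ) ∈ closedBall (20 : ℂ) (20 - 1 / 100) :=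
    mem_closedBall_of_re (by norm_num) (by norm_num)
  -- the value at the centre of the local picture
  have hval : ∀ {E' : ℂ → ℂ × ℝ}, (∀ w ∈ closedBall (20 : ℂ) (20 - 1 / 100),
      ‖E' w - ((w.im : ℂ) * Complex.I, w.re)‖ ≤ 1 / 100) →
      ‖(E' 1).1‖ ≤ 1 / 100 ∧ |(E' 1).2 - 1| ≤ 1 / 100 := fun h => by
    have := norm_prod_le_iff.1 (h 1 h1Q)
    simpa using this
  refine ⟨δ, hδ, fun z hz hzδ => ?_, ?_, fun z hz hzδ L hL => ?_⟩
  · obtain ⟨p, u, d, R, E', hd, hd0, hu, hzp, -, -, hE, hE1, -⟩ := hloc z hz hzδ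
    obtain ⟨v1, v2⟩ := hval hE1
    have v3 := abs_le.1 v2
    have e := hE 1 h1Q
    rw [mul_one, ← hzp] at e
    rw [e, ← hd]
    refine norm_prod_le_iff.2 ⟨?_, ?_⟩
    · have e2 : p + d * u * (E' 1).1 - z = d * (u * ((E' 1).1 - 1)) := by rw [hzp]; ring
      simp only [Prod.fst_sub]
      rw [e2, norm_mul, norm_mul, hu, one_mul, Complex.norm_real, Real.norm_of_nonneg hd0.le, mul_comm]
      have := norm_sub_le (E' 1).1 1
      rw [norm_one] at this
      gcongr
      linarith
    · simp only [Prod.snd_sub, sub_zero]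
      rw [norm_mul, Real.norm_of_nonneg hd0.le, mul_comm, Real.norm_eq_abs]
      gcongr
      rw [abs_le]; constructor <;> linarith
  · rintro z₁ ⟨hz₁, hzδ₁⟩ z₂ ⟨hz₂, hzδ₂⟩ heq
    obtain ⟨p, u, d, R, E', hd, hd0, hu, hzp, hR, hout, hE, hE1, hE2⟩ := hloc z₁ hz₁ hzδ₁
    obtain ⟨p', u', d', R', F', hd', hd0', hu', hzp', -, -, hF, hF1, -⟩ := hloc z₂ hz₂ hzδ₂
    obtain ⟨v1, v2⟩ := hval hE1
    obtain ⟨v1', v2'⟩ := hval hF1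
    have v3 := abs_le.1 v2
    have v3' := abs_le.1 v2'
    have e := hE 1 h1Q
    have e' := hF 1 h1Q
    rw [mul_one, ← hzp] at e
    rw [mul_one, ← hzp'] at e'
    rw [e, e'] at heq
    obtain ⟨heq1, heq2⟩ := Prod.mk.inj heq
    -- the heights of the Epstein points are almost the distances to the curve
    have hdd1 : d' ≤ 103 / 100 * d := by nlinarith
    have hdd2 : 1 / 5 * d < d' := by nlinarith
    have hm0 : (d : ℂ) * u ≠ 0 :=
      mul_ne_zero (by exact_mod_cast hd0.ne') fun h0 => by simp [h0] at hu
    have hmn : ‖(d : ℂ) * u‖ = d := by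
      rw [norm_mul, hu, mul_one, Complex.norm_real, Real.norm_of_nonneg hd0.le]
    obtain ⟨w, hw⟩ : ∃ w, w = (z₂ - p) / (d * u) := ⟨_, rfl⟩
    have hz₂w : z₂ = p + d * u * w := by rw [hw, mul_comm, div_mul_cancel₀ _ hm0]; ring
    have hwn : ‖w‖ ≤ 11 / 10 := by
      have h1 : z₂ - p = d * u * (E' 1).1 + d' * u' * (1 - (F' 1).1) := by
        linear_combination hzp' - heq1
      have h2 : ‖z₂ - p‖ ≤ d * (1 / 100) + d' * (1 + 1 / 100) := by
        rw [h1]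
        refine (norm_add_le _ _).trans ?_
        rw [norm_mul, hmn, norm_mul (d' * u' : ℂ), norm_mul (d' : ℂ), hu', mul_one, Complex.norm_real,
          Real.norm_of_nonneg hd0'.le]
        gcongr
        exact (norm_sub_le _ _).trans (by rw [norm_one]; gcongr)
      rw [hw, norm_div, hmn, div_le_iff₀ hd0]
      linarith
    -- `w` cannot be close to the boundary line of the half-plane
    have hwre : 1 / 8 ≤ w.re := by
      by_contra! hcon
      set S := segment ℝ z₂ (p + d * u * (w - 1 / 5)) with hS
      have hend : p + d * u * (w - 1 / 5) ∉ Ω := by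
        refine hout _ ?_
        have hR0 : 0 < R := by linarith
        have hRi0 : 0 < 1 / R := by positivity
        have hRR : R * (1 / R) = 1 := by field_simp
        have hRi : 1 / R ≤ 1 / 100 := one_div_le_one_div_of_le (by norm_num) hR
        have h3 : w.re * w.re + w.im * w.im ≤ (11 / 10) ^ 2 := by
          rw [← Complex.normSq_apply, Complex.normSq_eq_norm_sq]
          gcongr
        rw [mem_ball_iff_norm, sub_neg_eq_add, ← sq_lt_sq₀ (norm_nonneg _) hR0.le,
          ← Complex.normSq_eq_norm_sq, Complex.normSq_apply]
        have e1 : (w - 1 / 5 + ((R + 1 / R : ℝ) : ℂ)).re = w.re - 1 / 5 + (R + 1 / R) := by simp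
        have e2 : (w - 1 / 5 + ((R + 1 / R : ℝ) : ℂ)).im = w.im := by simp
        rw [e1, e2]
        have h4 := (abs_le.1 ((Complex.abs_re_le_norm w).trans hwn)).1
        have h5 : (w.re - 1 / 5) * (R + 1 / R) ≤ -(3 / 40) * (R + 1 / R) := by
          gcongr; linarith
        have h6 : (1 / R) * (1 / R) ≤ 1 / 100 * 1 := by gcongr; linarith
        nlinarith
      have hnd : ¬ Disjoint S (range c) := fun hdis =>
        hend (hΩ.subset_of_isPreconnected S (convex_segment _ _).isPreconnected hdis
          ⟨z₂, left_mem_segment _ _ _, hz₂⟩ (right_mem_segment _ _ _))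
      obtain ⟨q, hqS, hqc⟩ := not_disjoint_iff.1 hnd
      have h1 : d' ≤ dist z₂ q := by rw [hd']; exact infDist_le_dist_of_mem hqc
      have h2 : dist z₂ q ≤ dist z₂ (p + d * u * (w - 1 / 5)) := by
        have hb := (convex_closedBall z₂ (dist z₂ (p + d * u * (w - 1 / 5)))).segment_subset
          (mem_closedBall_self dist_nonneg) (mem_closedBall'.2 le_rfl) hqS
        exact mem_closedBall'.1 hb
      have h3 : dist z₂ (p + d * u * (w - 1 / 5)) = 1 / 5 * d := by
        have : z₂ - (p + d * u * (w - 1 / 5)) = d * u * (1 / 5) := by rw [hz₂w]; ring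
        rw [dist_eq_norm, this, norm_mul, hmn]
        norm_num
        ring
      linarith
    have hwQ := mem_closedBall_of_re hwre (hwn.trans (by norm_num))
    have ew := hE w hwQ
    rw [← hz₂w, e', ← heq1, ← heq2] at ew
    obtain ⟨f1, f2⟩ := Prod.mk.inj ew
    have g1 : (E' 1).1 = (E' w).1 := mul_left_cancel₀ hm0 (add_left_cancel f1)
    have g2 : (E' 1).2 = (E' w).2 := mul_left_cancel₀ hd0.ne' f2
    have h1 := hE2 1 h1Q w hwQ
    rw [Prod.ext g1 g2, sub_self, norm_zero, mul_zero, norm_le_zero_iff, sub_eq_zero] at h1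
    rw [hzp, hz₂w, ← h1, mul_one]
  · obtain ⟨p, u, d, R, E', hd, hd0, hu, hzp, -, -, hE, -, hE2⟩ := hloc z hz hzδ
    have hm0 : (d : ℂ) * u ≠ 0 :=
      mul_ne_zero (by exact_mod_cast hd0.ne') fun h0 => by simp [h0] at hu
    have hmn : ‖(d : ℂ) * u‖ = d := by
      rw [norm_mul, hu, mul_one, Complex.norm_real, Real.norm_of_nonneg hd0.le]
    have hlow : ∀ᶠ x in 𝓝 z, ‖x - z‖ ≤
        4 * ‖planarEpstein (hypDensity k) x - planarEpstein (hypDensity k) z‖ := by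
      have hcont : ContinuousAt (fun x => (x - p) / (d * u)) z := by fun_prop
      have hz1 : (z - p) / (d * u) = 1 := by rw [hzp, add_sub_cancel_left, div_self hm0]
      have hnb : closedBall (20 : ℂ) (20 - 1 / 100) ∈ 𝓝 ((z - p) / (d * u)) := by
        rw [hz1]
        refine Filter.mem_of_superset (isOpen_ball.mem_nhds ?_) ball_subset_closedBall
        rw [mem_ball_iff_norm]; norm_num
      filter_upwards [hcont hnb] with x hx
      set w := (x - p) / (d * u) with hw
      have hxw : x = p + d * u * w := by rw [hw, mul_comm, div_mul_cancel₀ _ hm0]; ring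
      have e1 := hE w hx
      have e2 := hE 1 h1Q
      rw [mul_one, ← hzp] at e2
      rw [← hxw] at e1
      rw [e1, e2]
      have h1 : x - z = d * u * (w - 1) := by rw [hxw, hzp]; ring
      have h2 : ‖((p + d * u * (E' w).1, d * (E' w).2) : ℂ × ℝ) - (p + d * u * (E' 1).1, d * (E' 1).2)‖
          = d * ‖E' w - E' 1‖ := by
        rw [Prod.norm_def, Prod.norm_def, mul_max_of_nonneg _ _ hd0.le]
        simp only [Prod.fst_sub, Prod.snd_sub, add_sub_add_left_eq_sub, ← mul_sub]
        rw [norm_mul, hmn, norm_mul, Real.norm_of_nonneg hd0.le]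
      rw [h1, h2, norm_mul, hmn]
      nlinarith [hE2 w hx 1 h1Q]
    rw [injective_iff_map_eq_zero]
    intro v hv
    by_contra hv0
    have hlit := hL.isLittleO.bound (c := 1 / 8) (by norm_num)
    have hcont : Filter.Tendsto (fun t : ℝ => z + t • v) (𝓝[≠] 0) (𝓝 z) := by
      have : Continuous fun t : ℝ => z + t • v := by fun_prop
      simpa using (this.tendsto 0).mono_left nhdsWithin_le_nhds
    obtain ⟨t, ⟨ht1, ht2⟩, ht0⟩ := ((hcont.eventually (hlow.and hlit)).and
      self_mem_nhdsWithin).exists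
    have ht0' : t ≠ 0 := ht0
    rw [add_sub_cancel_left, map_smul, hv, smul_zero, sub_zero] at ht2
    rw [add_sub_cancel_left] at ht1
    have : 0 < ‖t • v‖ := norm_pos_iff.2 (smul_ne_zero ht0' hv0)
    linarith


/-! ### From the upper half-space to the ball -/

/-- An isometric parametrization `e` of the plane orthogonal to the point `q` of the sphere by `ℂ`,
with its orthogonal projection `e'`. -/
structure IsFrame (q : S2) (e : ℂ →L[ℝ] E3) (e' : E3 →L[ℝ] ℂ) : Prop where
  inner_map : ∀ z w, inner ℝ (e z) (e w) = inner ℝ z w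
  inner_pole : ∀ z, inner ℝ (e z) (q : E3) = 0
  proj_map : ∀ z, e' (e z) = z
  proj_pole : e' q = 0
  decomp : ∀ x : E3, e (e' x) + inner ℝ x (q : E3) • (q : E3) = x

theorem exists_isFrame (q : S2) : ∃ e e', IsFrame q e e' := by
  have hq : (q : E3) ≠ 0 := ne_zero_of_mem_unit_sphere q
  have hqn : ‖(q : E3)‖ = 1 := norm_eq_of_mem_sphere q
  have : Fact (Module.finrank ℝ E3 = 2 + 1) := ⟨by simp⟩
  have hfr : Module.finrank ℝ (ℝ ∙ (q : E3))ᗮ = 2 :=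
    Submodule.finrank_orthogonal_span_singleton (n := 2) hq
  let b := (stdOrthonormalBasis ℝ (ℝ ∙ (q : E3))ᗮ).reindex (finCongr hfr)
  let φ : ℂ ≃ₗᵢ[ℝ] (ℝ ∙ (q : E3))ᗮ := Complex.orthonormalBasisOneI.repr.trans b.repr.symm
  let P := (ℝ ∙ (q : E3))ᗮ.orthogonalProjectionOnto
  refine ⟨(ℝ ∙ (q : E3))ᗮ.subtypeL.comp φ.toContinuousLinearEquiv.toContinuousLinearMap,
    φ.symm.toContinuousLinearEquiv.toContinuousLinearMap.comp P, ⟨?_, ?_, ?_, ?_, ?_⟩⟩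
  · intro z w
    exact φ.inner_map_map z w
  · intro z
    have := (φ z).2
    rw [Submodule.mem_orthogonal_singleton_iff_inner_left] at this
    simpa using this
  · intro z
    have : P ((φ z : (ℝ ∙ (q : E3))ᗮ) : E3) = φ z :=
      Submodule.orthogonalProjectionOnto_mem_subspace_eq_self _
    change φ.symm (P ((φ z : (ℝ ∙ (q : E3))ᗮ) : E3)) = z
    rw [this, φ.symm_apply_apply]
  · have : P (q : E3) = 0 := by
      apply Submodule.orthogonalProjectionOnto_apply_of_mem_orthogonal
      rw [Submodule.orthogonal_orthogonal]
      exact Submodule.mem_span_singleton_self _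
    change φ.symm (P (q : E3)) = 0
    rw [this, map_zero]
  · intro x
    change ((φ (φ.symm (P x)) : (ℝ ∙ (q : E3))ᗮ) : E3) + _ = x
    rw [φ.apply_symm_apply]
    have h1 := Submodule.starProjection_add_starProjection_orthogonal (K := (ℝ ∙ (q : E3))) x
    have h2 := Submodule.starProjection_unit_singleton ℝ hqn x
    rw [h2, real_inner_comm, add_comm] at h1
    exact h1

/-- The inversion in a sphere centered at `q`, which maps the upper half-space `ℂ × [0, ∞)`, placed
in `E3` by means of the frame `e`, onto the closed unit ball without `q`. -/
noncomputable def toBall (q : S2) (e : ℂ →L[ℝ] E3) (X : ℂ × ℝ) : E3 :=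
  (q : E3) + (2 / (‖X.1‖ ^ 2 + (1 + X.2) ^ 2)) • (e X.1 - (1 + X.2) • (q : E3))

/-- The inverse of `toBall`. -/
noncomputable def fromBall (q : S2) (e' : E3 →L[ℝ] ℂ) (x : E3) : ℂ × ℝ :=
  ((2 / ‖x - q‖ ^ 2) • e' x, -1 - 2 / ‖x - q‖ ^ 2 * inner ℝ (x - q) (q : E3))

theorem inner_q_q (q : S2) : inner ℝ (q : E3) (q : E3) = 1 := by
  rw [real_inner_self_eq_norm_sq, norm_eq_of_mem_sphere q, one_pow]

theorem toBall_den_pos (X : ℂ × ℝ) (h : 0 ≤ X.2) : 0 < ‖X.1‖ ^ 2 + (1 + X.2) ^ 2 := by positivity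

namespace IsFrame

variable {q : S2} {e : ℂ →L[ℝ] E3} {e' : E3 →L[ℝ] ℂ}

theorem norm_sq_combination (h : IsFrame q e e') (z : ℂ) (t : ℝ) :
    ‖e z - t • (q : E3)‖ ^ 2 = ‖z‖ ^ 2 + t ^ 2 := by
  rw [← real_inner_self_eq_norm_sq, inner_sub_left, inner_sub_right, inner_sub_right,
    inner_smul_left, inner_smul_right, inner_smul_right, inner_smul_left,
    real_inner_comm (e z) (q : E3), h.inner_pole, h.inner_map, inner_q_q,
    real_inner_self_eq_norm_sq]
  simp
  ring

theorem norm_sq_toBall_sub (h : IsFrame q e e') {X : ℂ × ℝ} (hX : 0 ≤ X.2) :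
    ‖toBall q e X - q‖ ^ 2 = 4 / (‖X.1‖ ^ 2 + (1 + X.2) ^ 2) := by
  have hD := toBall_den_pos X hX
  rw [toBall, add_sub_cancel_left, norm_smul, mul_pow, h.norm_sq_combination, Real.norm_eq_abs,
    sq_abs]
  field_simp
  norm_num

theorem toBall_ne (h : IsFrame q e e') {X : ℂ × ℝ} (hX : 0 ≤ X.2) : toBall q e X ≠ q := fun h0 => by
  have := h.norm_sq_toBall_sub hX
  rw [h0, sub_self, norm_zero] at this
  have hD := toBall_den_pos X hX
  have h2 : 0 < 4 / (‖X.1‖ ^ 2 + (1 + X.2) ^ 2) := by positivity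
  rw [← this] at h2
  simp at h2

theorem inner_toBall_sub (h : IsFrame q e e') (X : ℂ × ℝ) :
    inner ℝ (toBall q e X - q) (q : E3) = -(2 / (‖X.1‖ ^ 2 + (1 + X.2) ^ 2)) * (1 + X.2) := by
  rw [toBall, add_sub_cancel_left, inner_smul_left, inner_sub_left, inner_smul_left, h.inner_pole,
    inner_q_q]
  simp
  ring

theorem one_sub_norm_sq (q : S2) (x : E3) :
    1 - ‖x‖ ^ 2 = -(‖x - q‖ ^ 2 + 2 * inner ℝ (x - q) (q : E3)) := by
  have : x = (x - q) + q := by abel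
  conv_lhs => rw [this]
  rw [norm_add_sq_real, norm_eq_of_mem_sphere q]
  ring

theorem one_sub_norm_sq_toBall (h : IsFrame q e e') {X : ℂ × ℝ} (hX : 0 ≤ X.2) :
    1 - ‖toBall q e X‖ ^ 2 = 4 * X.2 / (‖X.1‖ ^ 2 + (1 + X.2) ^ 2) := by
  have hD := toBall_den_pos X hX
  rw [one_sub_norm_sq q, h.norm_sq_toBall_sub hX, h.inner_toBall_sub]
  field_simp
  ring

theorem norm_sq_toBall_sub_toBall (h : IsFrame q e e') {X Y : ℂ × ℝ} (hX : 0 ≤ X.2) (hY : 0 ≤ Y.2) :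
    ‖toBall q e X - toBall q e Y‖ ^ 2 = 4 * (‖X.1 - Y.1‖ ^ 2 + (X.2 - Y.2) ^ 2) /
      ((‖X.1‖ ^ 2 + (1 + X.2) ^ 2) * (‖Y.1‖ ^ 2 + (1 + Y.2) ^ 2)) := by
  have hD := toBall_den_pos X hX
  have hD' := toBall_den_pos Y hY
  have e1 : toBall q e X - toBall q e Y =
      e ((2 / (‖X.1‖ ^ 2 + (1 + X.2) ^ 2)) • X.1 - (2 / (‖Y.1‖ ^ 2 + (1 + Y.2) ^ 2)) • Y.1) -
      (2 / (‖X.1‖ ^ 2 + (1 + X.2) ^ 2) * (1 + X.2) - 2 / (‖Y.1‖ ^ 2 + (1 + Y.2) ^ 2) * (1 + Y.2)) •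
        (q : E3) := by
    rw [toBall, toBall, map_sub, map_smul, map_smul]
    module
  rw [e1, h.norm_sq_combination, norm_sub_sq_real, norm_sub_sq_real, norm_smul, norm_smul,
    inner_smul_left, inner_smul_right, mul_pow, mul_pow, Real.norm_eq_abs, Real.norm_eq_abs,
    sq_abs, sq_abs]
  simp only [conj_trivial]
  field_simp
  ring

theorem fromBall_toBall (h : IsFrame q e e') {X : ℂ × ℝ} (hX : 0 ≤ X.2) :
    fromBall q e' (toBall q e X) = X := by
  have hD := toBall_den_pos X hX
  have e1 : e' (toBall q e X) = (2 / (‖X.1‖ ^ 2 + (1 + X.2) ^ 2)) • X.1 := by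
    rw [toBall, map_add, map_smul, map_sub, map_smul, h.proj_pole, h.proj_map]
    simp
  rw [fromBall, h.norm_sq_toBall_sub hX, h.inner_toBall_sub, e1, smul_smul]
  refine Prod.ext ?_ ?_
  · simp only
    rw [show 2 / (4 / (‖X.1‖ ^ 2 + (1 + X.2) ^ 2)) * (2 / (‖X.1‖ ^ 2 + (1 + X.2) ^ 2)) = 1 by
      field_simp; norm_num, one_smul]
  · simp only
    field_simp
    ring

theorem toBall_fromBall (h : IsFrame q e e') {x : E3} (hx : x ≠ q) :
    toBall q e (fromBall q e' x) = x := by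
  have hr : 0 < ‖x - q‖ ^ 2 := by
    have := norm_pos_iff.2 (sub_ne_zero.2 hx); positivity
  have hdec := h.decomp (x - q)
  rw [map_sub, h.proj_pole, sub_zero] at hdec
  have hn := h.norm_sq_combination (e' x) (-inner ℝ (x - q) (q : E3))
  rw [neg_smul, sub_neg_eq_add, hdec] at hn
  set r := ‖x - q‖ ^ 2 with hrd
  set t := inner ℝ (x - q) (q : E3) with ht
  have hD : ‖(fromBall q e' x).1‖ ^ 2 + (1 + (fromBall q e' x).2) ^ 2 = 4 / r := by
    simp only [fromBall, norm_smul, mul_pow, Real.norm_eq_abs, sq_abs, ← hrd, ← ht]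
    have : ‖e' x‖ ^ 2 = r - t ^ 2 := by rw [hn]; ring
    rw [this]
    field_simp
    ring
  have e1 : e (fromBall q e' x).1 - (1 + (fromBall q e' x).2) • (q : E3) = (2 / r) • (x - q) := by
    conv_rhs => rw [← hdec]
    simp only [fromBall, map_smul, ← hrd, ← ht]
    module
  rw [toBall, hD, e1, smul_smul, show 2 / (4 / r) * (2 / r) = 1 by field_simp; norm_num, one_smul]
  abel

theorem fromBall_snd_eq (x : E3) (hx : x ≠ q) :
    (fromBall q e' x).2 = (1 - ‖x‖ ^ 2) / ‖x - q‖ ^ 2 := by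
  have hr : 0 < ‖x - q‖ ^ 2 := by
    have := norm_pos_iff.2 (sub_ne_zero.2 hx); positivity
  rw [one_sub_norm_sq q]
  simp only [fromBall]
  generalize ‖x - q‖ ^ 2 = r at hr ⊢
  field_simp
  ring

theorem contDiffAt_toBall (q : S2) (e : ℂ →L[ℝ] E3) {n : WithTop ℕ∞} {X : ℂ × ℝ} (hX : 0 ≤ X.2) :
    ContDiffAt ℝ n (toBall q e) X := by
  have hD := toBall_den_pos X hX
  have h1 : ContDiffAt ℝ n (fun X : ℂ × ℝ => 2 / (‖X.1‖ ^ 2 + (1 + X.2) ^ 2)) X :=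
    contDiffAt_const.div
      ((contDiffAt_fst.norm_sq ℝ).add ((contDiffAt_const.add contDiffAt_snd).pow 2)) hD.ne'
  have h2 : ContDiffAt ℝ n (fun X : ℂ × ℝ => e X.1 - (1 + X.2) • (q : E3)) X :=
    (e.contDiff.contDiffAt.comp X contDiffAt_fst).sub
      ((contDiffAt_const.add contDiffAt_snd).smul contDiffAt_const)
  exact contDiffAt_const.add (h1.smul h2)

theorem contDiffAt_fromBall (q : S2) (e' : E3 →L[ℝ] ℂ) {n : WithTop ℕ∞} {x : E3} (hx : x ≠ q) :
    ContDiffAt ℝ n (fromBall q e') x := by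
  have hr : ‖x - q‖ ^ 2 ≠ 0 := by
    have := norm_pos_iff.2 (sub_ne_zero.2 hx); positivity
  have h1 : ContDiffAt ℝ n (fun x : E3 => 2 / ‖x - q‖ ^ 2) x :=
    contDiffAt_const.div ((contDiffAt_id.sub contDiffAt_const).norm_sq ℝ) hr
  refine ContDiffAt.prodMk (h1.smul e'.contDiff.contDiffAt) (contDiffAt_const.sub (h1.mul ?_))
  exact ContDiffAt.inner ℝ (contDiffAt_id.sub contDiffAt_const) contDiffAt_const

end IsFrame


/-! ### Stereographic coordinates on the sphere -/

theorem contMDiff_coe_S2 : ContMDiff (𝓡 2) 𝓘(ℝ, E3) ∞ (fun p : S2 => (p : E3)) := by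
  have : Fact (Module.finrank ℝ E3 = 2 + 1) := ⟨by simp⟩
  exact contMDiff_coe_sphere

theorem ContMDiff.codRestrict_S2 {f : ℂ → E3} (hf : ContMDiff 𝓘(ℝ, ℂ) 𝓘(ℝ, E3) ∞ f)
    (hf' : ∀ x, f x ∈ sphere (0 : E3) 1) :
    ContMDiff 𝓘(ℝ, ℂ) (𝓡 2) ∞ (Set.codRestrict f _ hf' : ℂ → S2) := by
  have : Fact (Module.finrank ℝ E3 = 2 + 1) := ⟨by simp⟩
  exact hf.codRestrict_sphere hf'

/-- The stereographic projection from `q`. -/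
noncomputable def planarCoord (q : S2) (e' : E3 →L[ℝ] ℂ) (p : S2) : ℂ := (fromBall q e' p).1

namespace IsFrame

variable {q : S2} {e : ℂ →L[ℝ] E3} {e' : E3 →L[ℝ] ℂ}

theorem toBall_zero_mem (h : IsFrame q e e') (z : ℂ) : toBall q e (z, 0) ∈ sphere (0 : E3) 1 := by
  have := h.one_sub_norm_sq_toBall (X := (z, 0)) le_rfl
  simp only [mul_zero, zero_div] at this
  rw [mem_sphere_zero_iff_norm]
  nlinarith [norm_nonneg (toBall q e (z, 0))]

/-- The inverse of the stereographic projection from `q`. -/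
noncomputable def sphereMap (h : IsFrame q e e') (z : ℂ) : S2 :=
  ⟨toBall q e (z, 0), h.toBall_zero_mem z⟩

theorem sphereMap_ne (h : IsFrame q e e') (z : ℂ) : h.sphereMap z ≠ q := fun h0 =>
  h.toBall_ne (X := (z, 0)) le_rfl (congrArg Subtype.val h0)

theorem planarCoord_sphereMap (h : IsFrame q e e') (z : ℂ) :
    planarCoord q e' (h.sphereMap z) = z := by
  change (fromBall q e' (toBall q e (z, 0))).1 = z
  rw [h.fromBall_toBall le_rfl]

theorem fromBall_coe {p : S2} (hp : p ≠ q) :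
    fromBall q e' p = (planarCoord q e' p, 0) := by
  have hp' : (p : E3) ≠ q := fun h0 => hp (Subtype.ext h0)
  refine Prod.ext rfl ?_
  rw [fromBall_snd_eq _ hp', norm_eq_of_mem_sphere p]
  simp

theorem sphereMap_planarCoord (h : IsFrame q e e') {p : S2} (hp : p ≠ q) :
    h.sphereMap (planarCoord q e' p) = p := by
  have hp' : (p : E3) ≠ q := fun h0 => hp (Subtype.ext h0)
  apply Subtype.ext
  change toBall q e (planarCoord q e' p, 0) = p
  rw [← fromBall_coe hp, h.toBall_fromBall hp']

theorem contMDiff_sphereMap (h : IsFrame q e e') :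
    ContMDiff 𝓘(ℝ, ℂ) (𝓡 2) ∞ h.sphereMap := by
  refine ContMDiff.codRestrict_S2 (f := fun z => toBall q e (z, 0)) ?_ h.toBall_zero_mem
  refine ContDiff.contMDiff (contDiff_iff_contDiffAt.2 fun z => ?_)
  have h1 : ContDiffAt ℝ ∞ (fun z : ℂ => (z, (0 : ℝ))) z := contDiffAt_id.prodMk contDiffAt_const
  have h2 : ContDiffAt ℝ ∞ (toBall q e) (z, 0) := contDiffAt_toBall q e le_rfl
  exact h2.comp (f := fun z : ℂ => (z, (0 : ℝ))) z h1

theorem contMDiffAt_planarCoord {p : S2} (hp : p ≠ q) :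
    ContMDiffAt (𝓡 2) 𝓘(ℝ, ℂ) ∞ (planarCoord q e') p := by
  have hp' : (p : E3) ≠ q := fun h0 => hp (Subtype.ext h0)
  have h1 : ContDiffAt ℝ ∞ (fun x => (fromBall q e' x).1) (p : E3) :=
    contDiffAt_fst.comp (p : E3) (contDiffAt_fromBall q e' hp')
  exact h1.contMDiffAt.comp p contMDiff_coe_S2.contMDiffAt

theorem continuous_sphereMap (h : IsFrame q e e') : Continuous h.sphereMap :=
  h.contMDiff_sphereMap.continuous

/-- The inverse of the stereographic projection is a local diffeomorphism, so that its differential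
transports statements about tangent vectors of the sphere to the plane. -/
theorem mfderiv_sphereMap_surjective (h : IsFrame q e e') (z : ℂ) :
    Function.Surjective (mfderiv 𝓘(ℝ, ℂ) (𝓡 2) h.sphereMap z) := by
  have hp := h.sphereMap_ne z
  have h1 : MDifferentiableAt (𝓡 2) 𝓘(ℝ, ℂ) (planarCoord q e') (h.sphereMap z) :=
    (contMDiffAt_planarCoord hp).mdifferentiableAt (by simp)
  have h2 : MDifferentiableAt 𝓘(ℝ, ℂ) (𝓡 2) h.sphereMap z :=
    h.contMDiff_sphereMap.contMDiffAt.mdifferentiableAt (by simp)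
  have h3 : MDifferentiableAt 𝓘(ℝ, ℂ) (𝓡 2) h.sphereMap
      (planarCoord q e' (h.sphereMap z)) := by rwa [h.planarCoord_sphereMap]
  have hcomp := mfderiv_comp (h.sphereMap z) h3 h1
  have hid : h.sphereMap ∘ planarCoord q e' =ᶠ[𝓝 (h.sphereMap z)] id := by
    filter_upwards [isOpen_ne.mem_nhds hp] with p hp using h.sphereMap_planarCoord hp
  rw [hid.mfderiv_eq, mfderiv_id] at hcomp
  intro v
  refine ⟨mfderiv (𝓡 2) 𝓘(ℝ, ℂ) (planarCoord q e') (h.sphereMap z) v, ?_⟩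
  have := congrArg (fun L => L v) hcomp
  rw [h.planarCoord_sphereMap] at this
  exact this.symm

theorem fderiv_comp_sphereMap (h : IsFrame q e e') {E : S2 → E3} {z : ℂ}
    (hE : MDifferentiableAt (𝓡 2) 𝓘(ℝ, E3) E (h.sphereMap z)) (v : ℂ) :
    fderiv ℝ (E ∘ h.sphereMap) z v =
      mfderiv (𝓡 2) 𝓘(ℝ, E3) E (h.sphereMap z) (mfderiv 𝓘(ℝ, ℂ) (𝓡 2) h.sphereMap z v) := by
  have h2 : MDifferentiableAt 𝓘(ℝ, ℂ) (𝓡 2) h.sphereMap z :=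
    h.contMDiff_sphereMap.contMDiffAt.mdifferentiableAt (by simp)
  have := mfderiv_comp z hE h2
  rw [mfderiv_eq_fderiv] at this
  exact congrArg (fun L => L v) this

theorem forall_mfderiv_iff (h : IsFrame q e e') {E : S2 → E3} {z : ℂ}
    (hE : MDifferentiableAt (𝓡 2) 𝓘(ℝ, E3) E (h.sphereMap z)) (L : E3 →L[ℝ] ℝ) :
    (∀ v : TangentSpace (𝓡 2) (h.sphereMap z),
      L (mfderiv (𝓡 2) 𝓘(ℝ, E3) E (h.sphereMap z) v) = 0) ↔
    ∀ v, L (fderiv ℝ (E ∘ h.sphereMap) z v) = 0 := by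
  constructor
  · intro h0 v
    rw [h.fderiv_comp_sphereMap hE]
    exact h0 _
  · intro h0 v
    obtain ⟨w, rfl⟩ := h.mfderiv_sphereMap_surjective z v
    exact (congrArg L (h.fderiv_comp_sphereMap hE w)).symm.trans (h0 w)

theorem mfderiv_injective (h : IsFrame q e e') {E : S2 → E3} {z : ℂ}
    (hE : MDifferentiableAt (𝓡 2) 𝓘(ℝ, E3) E (h.sphereMap z))
    (hinj : Function.Injective (fderiv ℝ (E ∘ h.sphereMap) z)) :
    Function.Injective (mfderiv (𝓡 2) 𝓘(ℝ, E3) E (h.sphereMap z)) := by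
  intro v w hvw
  obtain ⟨a, rfl⟩ := h.mfderiv_sphereMap_surjective z v
  obtain ⟨b, rfl⟩ := h.mfderiv_sphereMap_surjective z w
  have hab : a = b := hinj
    ((h.fderiv_comp_sphereMap hE a).trans (hvw.trans (h.fderiv_comp_sphereMap hE b).symm))
  rw [hab]

theorem contMDiffAt_of_comp (h : IsFrame q e e') {E : S2 → E3} {z : ℂ}
    (hE : ContDiffAt ℝ ∞ (E ∘ h.sphereMap) z) :
    ContMDiffAt (𝓡 2) 𝓘(ℝ, E3) ∞ E (h.sphereMap z) := by
  have hp := h.sphereMap_ne z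
  have hE' : ContMDiffAt 𝓘(ℝ, ℂ) 𝓘(ℝ, E3) ∞ (E ∘ h.sphereMap)
      (planarCoord q e' (h.sphereMap z)) := by
    rw [h.planarCoord_sphereMap]; exact hE.contMDiffAt
  refine (hE'.comp (h.sphereMap z) (contMDiffAt_planarCoord hp)).congr_of_eventuallyEq ?_
  filter_upwards [isOpen_ne.mem_nhds hp] with p hp
  simp [h.sphereMap_planarCoord hp]

theorem contDiffAt_comp_sphereMap (h : IsFrame q e e') {E : S2 → E3} {z : ℂ}
    (hE : ContMDiffAt (𝓡 2) 𝓘(ℝ, E3) ∞ E (h.sphereMap z)) :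
    ContDiffAt ℝ ∞ (E ∘ h.sphereMap) z :=
  (hE.comp z h.contMDiff_sphereMap.contMDiffAt).contDiffAt

end IsFrame

/-! ### The envelope equation in the upper half-space -/

/-- The normalized Poisson kernel of the upper half-space: up to a factor which depends on `z`
only, the square root of the density at `z` of the visual metric from `X`. -/
noncomputable def halfSpacePoisson (X : ℂ × ℝ) (z : ℂ) : ℝ := X.2 / (‖X.1 - z‖ ^ 2 + X.2 ^ 2)

theorem fderiv_halfSpacePoisson (X : ℂ × ℝ) (hX : 0 < X.2) (z v : ℂ) :
    fderiv ℝ (halfSpacePoisson X) z v =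
      2 * X.2 * ((starRingEnd ℂ) (X.1 - z) * v).re / (‖X.1 - z‖ ^ 2 + X.2 ^ 2) ^ 2 := by
  have hN : 0 < ‖X.1 - z‖ ^ 2 + X.2 ^ 2 := by positivity
  have h1 : HasFDerivAt (fun w : ℂ => ‖X.1 - w‖ ^ 2 + X.2 ^ 2)
      (2 • (innerSL ℝ (X.1 - z)).comp (-ContinuousLinearMap.id ℝ ℂ)) z :=
    (((hasFDerivAt_id z).const_sub X.1).norm_sq).add_const _
  have h2 := ((hasDerivAt_inv hN.ne').comp_hasFDerivAt z h1).const_mul X.2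
  have h3 : fderiv ℝ (halfSpacePoisson X) z = _ := h2.fderiv
  rw [h3]
  simp [Complex.inner]
  field_simp
  ring

theorem halfSpacePoisson_pos {X : ℂ × ℝ} (hX : 0 < X.2) (z : ℂ) : 0 < halfSpacePoisson X z := by
  rw [halfSpacePoisson]; positivity

theorem contDiffAt_halfSpacePoisson {n : WithTop ℕ∞} (X : ℂ × ℝ) (hX : 0 < X.2) (z : ℂ) :
    ContDiffAt ℝ n (fun x : (ℂ × ℝ) × ℂ => halfSpacePoisson x.1 x.2) (X, z) := by
  have hN : 0 < ‖X.1 - z‖ ^ 2 + X.2 ^ 2 := by positivity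
  have h1 : ContDiffAt ℝ n (fun x : (ℂ × ℝ) × ℂ => x.1.2) (X, z) := contDiff_fst.snd.contDiffAt
  have h2 : ContDiffAt ℝ n (fun x : (ℂ × ℝ) × ℂ => x.1.1 - x.2) (X, z) :=
    contDiff_fst.fst.contDiffAt.sub contDiffAt_snd
  exact h1.div ((h2.norm_sq ℝ).add (h1.pow 2)) hN.ne'

theorem halfSpacePoisson_planarEpstein {σ : ℂ → ℝ} {z : ℂ} (hσ : 0 < σ z) :
    halfSpacePoisson (planarEpstein σ z) z = σ z / 2 := by
  have hM : 0 < ‖halfGradLog σ z‖ ^ 2 + σ z ^ 2 / 4 := by positivity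
  simp only [halfSpacePoisson, planarEpstein, epsteinPoint, add_sub_cancel_left, norm_mul, mul_pow,
    Complex.norm_real, Real.norm_eq_abs, sq_abs]
  set M := ‖halfGradLog σ z‖ ^ 2 + σ z ^ 2 / 4 with hMd
  have : M⁻¹ ^ 2 * ‖halfGradLog σ z‖ ^ 2 + (σ z / 2) ^ 2 * M⁻¹ ^ 2 = M⁻¹ := by
    have : ‖halfGradLog σ z‖ ^ 2 = M - σ z ^ 2 / 4 := by rw [hMd]; ring
    rw [this]; field_simp; ring
  rw [this]
  field_simp

/-- A point `Y z` of the horosphere at `z`, depending differentiably on `z`, solves the envelope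
equation if and only if it is given by the formula which defines `planarEpstein`. -/
theorem envelope_iff {σ : ℂ → ℝ} {Y : ℂ → ℂ × ℝ} {z : ℂ} (hσ : 0 < σ z)
    (hY : DifferentiableAt ℝ Y z) (hY0 : 0 < (Y z).2)
    (hE : ∀ᶠ w in 𝓝 z, halfSpacePoisson (Y w) w = σ w / 2) :
    (∀ v, fderiv ℝ (fun w => halfSpacePoisson (Y w) z) z v = 0) ↔ Y z = planarEpstein σ z := by
  have hN : 0 < ‖(Y z).1 - z‖ ^ 2 + (Y z).2 ^ 2 := by positivity
  have hz := hE.self_of_nhds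
  have hG : DifferentiableAt ℝ (fun x : (ℂ × ℝ) × ℂ => halfSpacePoisson x.1 x.2) (Y z, z) :=
    (contDiffAt_halfSpacePoisson (n := 1) (Y z) hY0 z).differentiableAt (by simp)
  have hdiag := (hG.hasFDerivAt.comp (f := fun w => (Y w, w)) z
    (hY.hasFDerivAt.prodMk (hasFDerivAt_id z)))
  have hleft := (hG.hasFDerivAt.comp (f := fun w => (Y w, z)) z
    (hY.hasFDerivAt.prodMk (hasFDerivAt_const z z)))
  have hright := (hG.hasFDerivAt.comp (f := fun w => (Y z, w)) z
    ((hasFDerivAt_const (Y z) z).prodMk (hasFDerivAt_id z)))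
  have hσd : HasFDerivAt σ _ z := (hdiag.const_mul 2).congr_of_eventuallyEq (by
    filter_upwards [hE] with w hw
    change σ w = 2 * halfSpacePoisson (Y w) w
    rw [hw]; ring)
  -- the derivative of `w ↦ halfSpacePoisson (Y w) w` is the sum of the two partial derivatives
  have key : ∀ v, 2 * σ z * ((starRingEnd ℂ) (halfGradLog σ z) * v).re =
      2 * fderiv ℝ (fun w => halfSpacePoisson (Y w) z) z v +
        2 * (2 * (Y z).2 * ((starRingEnd ℂ) ((Y z).1 - z) * v).re /
          (‖(Y z).1 - z‖ ^ 2 + (Y z).2 ^ 2) ^ 2) := by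
    intro v
    rw [← fderiv_halfSpacePoisson _ hY0, ← fderiv_eq_halfGradLog hσ.ne', hσd.fderiv]
    have e1 : fderiv ℝ (fun w => halfSpacePoisson (Y w) z) z = _ := hleft.fderiv
    have e2 : fderiv ℝ (halfSpacePoisson (Y z)) z = _ := hright.fderiv
    rw [e1, e2, ← mul_add]
    simp only [ContinuousLinearMap.coe_comp, Function.comp, _root_.smul_apply,
      ContinuousLinearMap.prod_apply, smul_eq_mul, _root_.zero_apply,
      ContinuousLinearMap.id_apply, ← map_add, Prod.mk_add_mk, zero_add, add_zero]
  set N := ‖(Y z).1 - z‖ ^ 2 + (Y z).2 ^ 2 with hNd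
  have hh : (Y z).2 = σ z / 2 * N := by
    rw [halfSpacePoisson, ← hNd, div_eq_iff hN.ne'] at hz
    exact hz
  set s := halfGradLog σ z with hs
  -- the partial derivative in the first argument is an inner product with a fixed vector
  have key2 : ∀ v, fderiv ℝ (fun w => halfSpacePoisson (Y w) z) z v =
      σ z * ((starRingEnd ℂ) (s - ((N⁻¹ : ℝ) : ℂ) * ((Y z).1 - z)) * v).re := by
    intro v
    have := key v
    rw [hh] at this
    have e1 : ((starRingEnd ℂ) (s - ((N⁻¹ : ℝ) : ℂ) * ((Y z).1 - z)) * v).re =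
        ((starRingEnd ℂ) s * v).re - N⁻¹ * ((starRingEnd ℂ) ((Y z).1 - z) * v).re := by
      rw [map_sub, map_mul, Complex.conj_ofReal, sub_mul, Complex.sub_re, mul_assoc,
        Complex.re_ofReal_mul]
    rw [e1]
    have e2 : 2 * (2 * (σ z / 2 * N) * ((starRingEnd ℂ) ((Y z).1 - z) * v).re / N ^ 2) =
        2 * σ z * (N⁻¹ * ((starRingEnd ℂ) ((Y z).1 - z) * v).re) := by field_simp
    rw [e2] at this
    linarith
  have iff1 : (∀ v, fderiv ℝ (fun w => halfSpacePoisson (Y w) z) z v = 0) ↔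
      s = ((N⁻¹ : ℝ) : ℂ) * ((Y z).1 - z) := by
    constructor
    · intro h0
      have := h0 (s - ((N⁻¹ : ℝ) : ℂ) * ((Y z).1 - z))
      rw [key2, ← Complex.normSq_eq_conj_mul_self, Complex.ofReal_re, mul_eq_zero,
        Complex.normSq_eq_zero] at this
      exact sub_eq_zero.1 (this.resolve_left hσ.ne')
    · intro h0 v
      rw [key2, ← h0]
      simp
  rw [iff1]
  constructor
  · intro h0
    have hM : ‖s‖ ^ 2 + σ z ^ 2 / 4 = N⁻¹ := by
      rw [h0, norm_mul, mul_pow, Complex.norm_real, Real.norm_eq_abs, sq_abs]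
      have e1 : ‖(Y z).1 - z‖ ^ 2 = N - (σ z / 2 * N) ^ 2 := by rw [← hh, hNd]; ring
      rw [e1]
      field_simp
      ring
    rw [planarEpstein, epsteinPoint, ← hs, hM, inv_inv]
    refine Prod.ext ?_ hh
    simp only
    rw [h0, ← mul_assoc, ← Complex.ofReal_mul, mul_inv_cancel₀ hN.ne']
    simp
  · intro h0
    have hM0 : 0 < ‖s‖ ^ 2 + σ z ^ 2 / 4 := by positivity
    have e1 : (Y z).1 - z = (((‖s‖ ^ 2 + σ z ^ 2 / 4)⁻¹ : ℝ) : ℂ) * s := by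
      rw [h0, planarEpstein, epsteinPoint, ← hs]; simp
    have e2 : (Y z).2 = σ z / 2 * (‖s‖ ^ 2 + σ z ^ 2 / 4)⁻¹ := by
      rw [h0, planarEpstein, epsteinPoint, ← hs]
    have hN' : N = (‖s‖ ^ 2 + σ z ^ 2 / 4)⁻¹ := by
      rw [hh] at e2
      exact mul_left_cancel₀ (by positivity) e2
    rw [e1, hN', ← mul_assoc, ← Complex.ofReal_mul, inv_inv, mul_inv_cancel₀ hM0.ne']
    simp


/-! ### Epstein maps in stereographic coordinates -/

theorem planarEpstein_snd_pos {σ : ℂ → ℝ} {z : ℂ} (hσ : 0 < σ z) : 0 < (planarEpstein σ z).2 := by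
  simp only [planarEpstein, epsteinPoint]
  positivity

theorem differentiableAt_visualDensity {x : E3} {p : S2} (hx : x ∈ ball (0 : E3) 1) :
    DifferentiableAt ℝ (fun x => visualDensity x p) x := by
  have hne : x - p ≠ 0 := by
    intro h0
    rw [sub_eq_zero] at h0
    rw [mem_ball_zero_iff, h0, norm_eq_of_mem_sphere p] at hx
    exact lt_irrefl _ hx
  have h0 : ‖x - p‖ ^ 2 ≠ 0 := by
    have := norm_pos_iff.2 hne; positivity
  have h1 : DifferentiableAt ℝ (fun x : E3 => 1 - ‖x‖ ^ 2) x :=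
    (differentiableAt_id.norm_sq ℝ).const_sub 1
  have h2 : DifferentiableAt ℝ (fun x : E3 => ‖x - p‖ ^ 2) x :=
    (differentiableAt_id.sub_const _).norm_sq ℝ
  have h3 : DifferentiableAt ℝ (fun x : E3 => (1 - ‖x‖ ^ 2) / ‖x - p‖ ^ 2) x := by
    simp only [div_eq_mul_inv]
    exact h1.mul (h2.inv h0)
  exact h3.pow 2

namespace IsFrame

variable {q : S2} {e : ℂ →L[ℝ] E3} {e' : E3 →L[ℝ] ℂ}

theorem toBall_mem_ball (h : IsFrame q e e') {X : ℂ × ℝ} (hX : 0 < X.2) :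
    toBall q e X ∈ ball (0 : E3) 1 := by
  have h1 := h.one_sub_norm_sq_toBall hX.le
  have hD := toBall_den_pos X hX.le
  have h2 : 0 < 4 * X.2 / (‖X.1‖ ^ 2 + (1 + X.2) ^ 2) := by positivity
  rw [mem_ball_zero_iff]
  nlinarith [norm_nonneg (toBall q e X)]

theorem visualDensity_toBall (h : IsFrame q e e') {X : ℂ × ℝ} (hX : 0 < X.2) (z : ℂ) :
    visualDensity (toBall q e X) (h.sphereMap z) =
      ((1 + ‖z‖ ^ 2) * halfSpacePoisson X z) ^ 2 := by
  have hD := toBall_den_pos X hX.le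
  have hN : 0 < ‖X.1 - z‖ ^ 2 + X.2 ^ 2 := by positivity
  change ((1 - ‖toBall q e X‖ ^ 2) / ‖toBall q e X - toBall q e (z, 0)‖ ^ 2) ^ 2 = _
  rw [h.one_sub_norm_sq_toBall hX.le, h.norm_sq_toBall_sub_toBall hX.le le_rfl, halfSpacePoisson]
  simp only [sub_zero, add_zero, one_pow]
  congr 1
  field_simp
  ring

/-- The tangency condition in stereographic coordinates: up to a positive factor, it is about the
derivative of `halfSpacePoisson`. -/
theorem fderiv_visualDensity_comp (h : IsFrame q e e') {Y : ℂ → ℂ × ℝ} {F : ℂ → E3} {z : ℂ}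
    (hY : DifferentiableAt ℝ Y z) (hY0 : 0 < (Y z).2) (hF : F =ᶠ[𝓝 z] fun w => toBall q e (Y w))
    (v : ℂ) :
    fderiv ℝ (fun x => visualDensity x (h.sphereMap z)) (F z) (fderiv ℝ F z v) =
      2 * (1 + ‖z‖ ^ 2) ^ 2 * halfSpacePoisson (Y z) z *
        fderiv ℝ (fun w => halfSpacePoisson (Y w) z) z v := by
  have hFz : F z = toBall q e (Y z) := hF.self_of_nhds
  have hFd : DifferentiableAt ℝ F z := by
    have h1 : DifferentiableAt ℝ (toBall q e) (Y z) :=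
      (contDiffAt_toBall q e (n := 1) hY0.le).differentiableAt (by simp)
    exact (h1.comp z hY).congr_of_eventuallyEq hF
  have hV : DifferentiableAt ℝ (fun x => visualDensity x (h.sphereMap z)) (F z) := by
    rw [hFz]; exact differentiableAt_visualDensity (h.toBall_mem_ball hY0)
  have hG : DifferentiableAt ℝ (fun w => halfSpacePoisson (Y w) z) z := by
    have h1 : DifferentiableAt ℝ (fun x : (ℂ × ℝ) × ℂ => halfSpacePoisson x.1 x.2) (Y z, z) :=
      (contDiffAt_halfSpacePoisson (n := 1) (Y z) hY0 z).differentiableAt (by simp)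
    exact h1.comp (f := fun w => (Y w, z)) z (hY.prodMk (differentiableAt_const z))
  have e1 : fderiv ℝ (fun w => visualDensity (F w) (h.sphereMap z)) z v =
      fderiv ℝ (fun x => visualDensity x (h.sphereMap z)) (F z) (fderiv ℝ F z v) :=
    congrArg (fun L => L v) (fderiv_comp (f := F) z hV hFd)
  have e2 : (fun w => visualDensity (F w) (h.sphereMap z)) =ᶠ[𝓝 z]
      fun w => ((1 + ‖z‖ ^ 2) * halfSpacePoisson (Y w) z) ^ 2 := by
    have hpos : ∀ᶠ w in 𝓝 z, 0 < (Y w).2 :=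
      hY.continuousAt.snd.eventually (lt_mem_nhds hY0)
    filter_upwards [hF, hpos] with w hw hw0
    rw [hw, h.visualDensity_toBall hw0]
  rw [← e1, e2.fderiv_eq, ((hG.hasFDerivAt.const_mul (1 + ‖z‖ ^ 2)).pow 2).fderiv]
  simp
  ring

/-- An Epstein map is given in stereographic coordinates by the planar formula. -/
theorem isEpsteinMap_eq (h : IsFrame q e e') {Ω : Set S2} (hΩ : IsOpen Ω)
    {ρ : S2 → ℝ} {σ : ℂ → ℝ} (hσ : ∀ z, h.sphereMap z ∈ Ω → 0 < σ z)
    (hρ : ∀ z, h.sphereMap z ∈ Ω → ρ (h.sphereMap z) = (σ z * (1 + ‖z‖ ^ 2) / 2) ^ 2)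
    {E : S2 → E3} (hE : IsEpsteinMap Ω ρ E) {z : ℂ} (hz : h.sphereMap z ∈ Ω) :
    E (h.sphereMap z) = toBall q e (planarEpstein σ z) := by
  set Y : ℂ → ℂ × ℝ := fun w => fromBall q e' (E (h.sphereMap w)) with hYd
  have hne : ∀ x ∈ ball (0 : E3) 1, x ≠ q := by
    rintro x hx rfl
    rw [mem_ball_zero_iff, norm_eq_of_mem_sphere q] at hx
    exact lt_irrefl _ hx
  have hball : ∀ w, h.sphereMap w ∈ Ω → E (h.sphereMap w) ∈ ball (0 : E3) 1 := fun w hw =>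
    (hE.mem_horosphere _ hw).1
  have hYpos : ∀ w, h.sphereMap w ∈ Ω → 0 < (Y w).2 := by
    intro w hw
    have hx := hball w hw
    have hxq := hne _ hx
    have := norm_pos_iff.2 (sub_ne_zero.2 hxq)
    simp only [hYd]
    rw [fromBall_snd_eq _ hxq]
    rw [mem_ball_zero_iff] at hx
    have : 0 < 1 - ‖E (h.sphereMap w)‖ ^ 2 := by nlinarith [norm_nonneg (E (h.sphereMap w))]
    positivity
  have hYE : ∀ w, h.sphereMap w ∈ Ω → E (h.sphereMap w) = toBall q e (Y w) := fun w hw =>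
    (h.toBall_fromBall (hne _ (hball w hw))).symm
  have hopen : ∀ᶠ w in 𝓝 z, h.sphereMap w ∈ Ω :=
    h.continuous_sphereMap.continuousAt.eventually (hΩ.mem_nhds hz)
  have hEs : ContMDiffAt (𝓡 2) 𝓘(ℝ, E3) ∞ E (h.sphereMap z) :=
    hE.smooth.contMDiffAt (hΩ.mem_nhds hz)
  have hEψ := h.contDiffAt_comp_sphereMap hEs
  have hYd' : DifferentiableAt ℝ Y z := by
    have h1 : DifferentiableAt ℝ (fromBall q e') ((E ∘ h.sphereMap) z) :=
      (contDiffAt_fromBall q e' (n := 1) (hne _ (hball z hz))).differentiableAt (by simp)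
    exact h1.comp z (hEψ.differentiableAt (by simp))
  rw [hYE z hz]
  congr 1
  refine (envelope_iff (hσ z hz) hYd' (hYpos z hz) ?_).1 fun v => ?_
  · filter_upwards [hopen] with w hw
    have h1 := (hE.mem_horosphere _ hw).2
    rw [hYE w hw, h.visualDensity_toBall (hYpos w hw), hρ w hw] at h1
    have h2 := halfSpacePoisson_pos (hYpos w hw) w
    have h3 := hσ w hw
    rw [sq_eq_sq₀ (by positivity) (by positivity)] at h1
    have h4 : (1 + ‖w‖ ^ 2) ≠ 0 := by positivity
    refine mul_left_cancel₀ h4 ?_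
    rw [h1]; ring
  · have hF : E ∘ h.sphereMap =ᶠ[𝓝 z] fun w => toBall q e (Y w) := by
      filter_upwards [hopen] with w hw using hYE w hw
    have h1 := h.fderiv_visualDensity_comp hYd' (hYpos z hz) hF v
    have h2 := (h.forall_mfderiv_iff (hEs.mdifferentiableAt (by simp))
      (fderiv ℝ (fun x => visualDensity x (h.sphereMap z)) (E (h.sphereMap z)))).1
      (hE.tangent _ hz) v
    have h3 := halfSpacePoisson_pos (hYpos z hz) z
    rw [Function.comp_apply, h2] at h1
    have h4 : 2 * (1 + ‖z‖ ^ 2) ^ 2 * halfSpacePoisson (Y z) z ≠ 0 := by positivity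
    exact (mul_eq_zero.1 h1.symm).resolve_left h4

theorem isEpsteinMap_planar (h : IsFrame q e e') {Ω : Set S2} (hΩ : IsOpen Ω) (hq : q ∉ Ω)
    {ρ : S2 → ℝ} {σ : ℂ → ℝ} (hσ : ∀ z, h.sphereMap z ∈ Ω → 0 < σ z)
    (hρ : ∀ z, h.sphereMap z ∈ Ω → ρ (h.sphereMap z) = (σ z * (1 + ‖z‖ ^ 2) / 2) ^ 2)
    (hs : ∀ z, h.sphereMap z ∈ Ω → ContDiffAt ℝ ∞ (planarEpstein σ) z) :
    IsEpsteinMap Ω ρ fun p => toBall q e (planarEpstein σ (planarCoord q e' p)) := by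
  set E : S2 → E3 := fun p => toBall q e (planarEpstein σ (planarCoord q e' p)) with hEd
  have hEψ : E ∘ h.sphereMap = fun z => toBall q e (planarEpstein σ z) := by
    funext z
    simp [hEd, h.planarCoord_sphereMap]
  have hlift : ∀ p ∈ Ω, ∃ z, h.sphereMap z = p := fun p hp =>
    ⟨_, h.sphereMap_planarCoord (fun h0 => hq (h0 ▸ hp))⟩
  have hsm : ∀ z, h.sphereMap z ∈ Ω → ContMDiffAt (𝓡 2) 𝓘(ℝ, E3) ∞ E (h.sphereMap z) := by
    intro z hz
    apply h.contMDiffAt_of_comp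
    rw [hEψ]
    have h1 : ContDiffAt ℝ ∞ (toBall q e) (planarEpstein σ z) :=
      contDiffAt_toBall q e (planarEpstein_snd_pos (hσ z hz)).le
    exact h1.comp z (hs z hz)
  refine ⟨?_, ?_, ?_⟩
  · intro p hp
    obtain ⟨z, rfl⟩ := hlift p hp
    exact (hsm z hp).contMDiffWithinAt
  · intro p hp
    obtain ⟨z, rfl⟩ := hlift p hp
    have hpos := planarEpstein_snd_pos (hσ z hp)
    have e1 : E (h.sphereMap z) = toBall q e (planarEpstein σ z) := congrFun hEψ z
    refine ⟨?_, ?_⟩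
    · rw [e1]; exact h.toBall_mem_ball hpos
    · rw [e1, h.visualDensity_toBall hpos, halfSpacePoisson_planarEpstein (hσ z hp), hρ z hp]
      ring
  · intro p hp
    obtain ⟨z, rfl⟩ := hlift p hp
    refine (h.forall_mfderiv_iff ((hsm z hp).mdifferentiableAt (by simp))
      (fderiv ℝ (fun x => visualDensity x (h.sphereMap z)) (E (h.sphereMap z)))).2 fun v => ?_
    have hpos := planarEpstein_snd_pos (hσ z hp)
    have hd : DifferentiableAt ℝ (planarEpstein σ) z := (hs z hp).differentiableAt (by simp)
    have h1 := h.fderiv_visualDensity_comp hd hpos (Filter.EventuallyEq.of_eq hEψ) v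
    have hopen : ∀ᶠ w in 𝓝 z, h.sphereMap w ∈ Ω :=
      h.continuous_sphereMap.continuousAt.eventually (hΩ.mem_nhds hp)
    have h2 := (envelope_iff (hσ z hp) hd hpos (by
      filter_upwards [hopen] with w hw
      exact halfSpacePoisson_planarEpstein (hσ w hw))).2 rfl v
    rw [h2, mul_zero] at h1
    exact h1

/-- Existence and uniqueness of the Epstein map of a conformal metric: `epsteinMap` is an Epstein
map, and it is given by the planar formula. -/
theorem epsteinMap_spec (h : IsFrame q e e') {Ω : Set S2} (hΩ : IsOpen Ω) (hq : q ∉ Ω)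
    {ρ : S2 → ℝ} {σ : ℂ → ℝ} (hσ : ∀ z, h.sphereMap z ∈ Ω → 0 < σ z)
    (hρ : ∀ z, h.sphereMap z ∈ Ω → ρ (h.sphereMap z) = (σ z * (1 + ‖z‖ ^ 2) / 2) ^ 2)
    (hs : ∀ z, h.sphereMap z ∈ Ω → ContDiffAt ℝ ∞ (planarEpstein σ) z) :
    IsEpsteinMap Ω ρ (epsteinMap Ω ρ) ∧ ∀ z, h.sphereMap z ∈ Ω →
      epsteinMap Ω ρ (h.sphereMap z) = toBall q e (planarEpstein σ z) := by
  have hex : ∃ E, IsEpsteinMap Ω ρ E := ⟨_, h.isEpsteinMap_planar hΩ hq hσ hρ hs⟩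
  have h1 : IsEpsteinMap Ω ρ (epsteinMap Ω ρ) := by
    rw [epsteinMap, dif_pos hex]
    exact hex.choose_spec
  exact ⟨h1, fun z hz => h.isEpsteinMap_eq hΩ hσ hρ h1 hz⟩

end IsFrame


/-! ### Conformal parametrizations in stereographic coordinates -/

namespace IsFrame

variable {q : S2} {e : ℂ →L[ℝ] E3} {e' : E3 →L[ℝ] ℂ}

theorem dist_sq_sphereMap (h : IsFrame q e e') (a b : ℂ) :
    dist (h.sphereMap a) (h.sphereMap b) ^ 2 =
      4 * dist a b ^ 2 / ((1 + ‖a‖ ^ 2) * (1 + ‖b‖ ^ 2)) := by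
  have := h.norm_sq_toBall_sub_toBall (X := (a, 0)) (Y := (b, 0)) le_rfl le_rfl
  simp only [sub_zero, add_zero, one_pow, ne_eq, OfNat.ofNat_ne_zero, not_false_eq_true,
    zero_pow] at this
  rw [Subtype.dist_eq, dist_eq_norm, dist_eq_norm]
  change ‖toBall q e (a, 0) - toBall q e (b, 0)‖ ^ 2 = _
  rw [this]
  ring

theorem differentiable_toBall_zero (q : S2) (e : ℂ →L[ℝ] E3) :
    Differentiable ℝ (fun z : ℂ => toBall q e (z, 0)) := by
  intro z
  have h1 : DifferentiableAt ℝ (toBall q e) (z, 0) :=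
    (contDiffAt_toBall q e (n := 1) le_rfl).differentiableAt (by simp)
  exact h1.comp (f := fun z : ℂ => (z, (0 : ℝ))) z
    (differentiableAt_id.prodMk (differentiableAt_const _))

/-- The inverse of the stereographic projection is conformal. -/
theorem norm_fderiv_toBall_zero (h : IsFrame q e e') (z v : ℂ) :
    ‖fderiv ℝ (fun z : ℂ => toBall q e (z, 0)) z v‖ = 2 * ‖v‖ / (1 + ‖z‖ ^ 2) := by
  have h1 : HasDerivAt (fun t : ℝ => z + t • v) v 0 := by
    simpa using ((hasDerivAt_id (0 : ℝ)).smul_const v).const_add z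
  have h0 : HasFDerivAt (fun z : ℂ => toBall q e (z, 0))
      (fderiv ℝ (fun z : ℂ => toBall q e (z, 0)) z) (z + (0 : ℝ) • v) := by
    simpa using (differentiable_toBall_zero q e z).hasFDerivAt
  have h2 := h0.comp_hasDerivAt (0 : ℝ) h1
  rw [hasDerivAt_iff_tendsto_slope] at h2
  have h3 := (h2.norm).pow 2
  have h4 : Filter.Tendsto (fun t : ℝ => 4 * ‖v‖ ^ 2 / ((1 + ‖z + t • v‖ ^ 2) * (1 + ‖z‖ ^ 2)))
      (𝓝[≠] 0) (𝓝 (4 * ‖v‖ ^ 2 / ((1 + ‖z + (0 : ℝ) • v‖ ^ 2) * (1 + ‖z‖ ^ 2)))) := by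
    refine (ContinuousAt.tendsto ?_).mono_left nhdsWithin_le_nhds
    refine ContinuousAt.div (by fun_prop) (by fun_prop) (by positivity)
  have h5 := tendsto_nhds_unique_of_eventuallyEq h3 h4 (by
    filter_upwards [self_mem_nhdsWithin] with t ht
    have ht' : t ≠ 0 := ht
    have h6 := h.norm_sq_toBall_sub_toBall (X := (z + t • v, 0)) (Y := (z, 0)) le_rfl le_rfl
    simp only [slope, Function.comp, vsub_eq_sub, sub_zero, zero_smul, add_zero]
    rw [norm_smul, mul_pow, h6, norm_inv, inv_pow, Real.norm_eq_abs, sq_abs]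
    simp only [add_sub_cancel_left, norm_smul, mul_pow, Real.norm_eq_abs, sq_abs, sub_self]
    field_simp
    ring)
  rw [zero_smul, add_zero] at h5
  rw [← sq_eq_sq₀ (norm_nonneg _) (by positivity), h5]
  field_simp
  ring

end IsFrame

/-- A smooth map of a disk to the plane whose differentials are similarities is holomorphic
or antiholomorphic: by connectedness, the two cases cannot both occur. -/
theorem exists_differentiableOn_comp {f : ℂ → ℂ} (hf : ContDiffOn ℝ ∞ f (ball 0 1)) {c : ℂ → ℝ}
    (hc : ∀ ζ ∈ ball (0 : ℂ) 1, c ζ ≠ 0) (hfc : ∀ ζ ∈ ball (0 : ℂ) 1, ∀ v,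
      ‖fderiv ℝ f ζ v‖ = c ζ * ‖v‖) :
    ∃ τ : ℂ → ℂ, (∀ z, τ (τ z) = z) ∧ (∀ z, ‖τ z‖ = ‖z‖) ∧
      DifferentiableOn ℂ (f ∘ τ) (ball 0 1) ∧
      ∀ ζ ∈ ball (0 : ℂ) 1, ‖deriv (f ∘ τ) ζ‖ = c (τ ζ) := by
  have hd : ∀ ζ ∈ ball (0 : ℂ) 1, HasFDerivAt f (fderiv ℝ f ζ) ζ := fun ζ hζ =>
    ((hf.contDiffAt (isOpen_ball.mem_nhds hζ)).differentiableAt (by simp)).hasFDerivAt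
  have hcont : ContinuousOn (fderiv ℝ f) (ball 0 1) :=
    hf.continuousOn_fderiv_of_isOpen isOpen_ball (by simp)
  have hconj : ∀ ζ ∈ ball (0 : ℂ) 1, (starRingEnd ℂ) ζ ∈ ball (0 : ℂ) 1 := by
    intro ζ hζ
    rw [mem_ball_zero_iff] at hζ ⊢
    rwa [Complex.norm_conj]
  set L := fderiv ℝ f with hL
  have hlin : ∀ ζ (v : ℂ), L ζ v = v.re * L ζ 1 + v.im * L ζ Complex.I := by
    intro ζ v
    conv_lhs => rw [show v = v.re • (1 : ℂ) + v.im • Complex.I by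
      apply Complex.ext <;> simp]
    rw [map_add, map_smul, map_smul]
    simp
  -- up to factors, `A` and `B` are the two Wirtinger derivatives
  set A : ℂ → ℂ := fun ζ => L ζ 1 - Complex.I * L ζ Complex.I with hA
  set B : ℂ → ℂ := fun ζ => L ζ 1 + Complex.I * L ζ Complex.I with hB
  have hAc : ContinuousOn A (ball 0 1) :=
    (hcont.clm_apply continuousOn_const).sub
      (continuousOn_const.mul (hcont.clm_apply continuousOn_const))
  have hBc : ContinuousOn B (ball 0 1) :=
    (hcont.clm_apply continuousOn_const).add
      (continuousOn_const.mul (hcont.clm_apply continuousOn_const))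
  have hor : ∀ ζ ∈ ball (0 : ℂ) 1, (A ζ = 0 ∧ B ζ ≠ 0) ∨ (A ζ ≠ 0 ∧ B ζ = 0) := by
    intro ζ hζ
    -- `1` and `I` are mapped to orthogonal vectors of the same length
    have n1 := hfc ζ hζ 1
    have n2 := hfc ζ hζ Complex.I
    have n3 := hfc ζ hζ (1 + Complex.I)
    rw [map_add] at n3
    have hI : ‖(1 : ℂ) + Complex.I‖ ^ 2 = 2 := by
      rw [← Complex.normSq_eq_norm_sq, Complex.normSq_apply]; norm_num
    simp only [norm_one, Complex.norm_I, mul_one] at n1 n2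
    have n1' : Complex.normSq (L ζ 1) = c ζ ^ 2 := by rw [Complex.normSq_eq_norm_sq, n1]
    have n2' : Complex.normSq (L ζ Complex.I) = c ζ ^ 2 := by
      rw [Complex.normSq_eq_norm_sq, n2]
    have n3' : Complex.normSq (L ζ 1 + L ζ Complex.I) = c ζ ^ 2 * 2 := by
      rw [Complex.normSq_eq_norm_sq, n3, mul_pow, hI]
    have hc2 : 0 < c ζ ^ 2 := by have := hc ζ hζ; positivity
    have hAB : A ζ * B ζ = 0 := by
      simp only [hA, hB]
      rw [Complex.normSq_apply] at n1' n2' n3'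
      simp only [Complex.add_re, Complex.add_im] at n3'
      generalize L ζ 1 = x at *
      generalize L ζ Complex.I = y at *
      have e1 : (x - Complex.I * y) * (x + Complex.I * y) = x ^ 2 + y ^ 2 := by
        have := Complex.I_sq
        linear_combination (-y ^ 2) * this
      rw [e1]
      have o : x.re * y.re + x.im * y.im = 0 := by linarith
      have p1 : (x.re ^ 2 - x.im ^ 2 + y.re ^ 2 - y.im ^ 2) ^ 2 +
          (2 * (x.re * x.im + y.re * y.im)) ^ 2 = 0 := by
        have h1 : x.re * x.re + x.im * x.im = y.re * y.re + y.im * y.im := by linarith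
        have : (x.re ^ 2 - x.im ^ 2 + y.re ^ 2 - y.im ^ 2) ^ 2 +
          (2 * (x.re * x.im + y.re * y.im)) ^ 2 =
          (x.re * x.re + x.im * x.im - (y.re * y.re + y.im * y.im)) ^ 2 +
            4 * (x.re * y.re + x.im * y.im) ^ 2 := by ring
        rw [this, h1, o]; ring
      have p2 : x.re ^ 2 - x.im ^ 2 + y.re ^ 2 - y.im ^ 2 = 0 := by nlinarith
      have p3 : 2 * (x.re * x.im + y.re * y.im) = 0 := by nlinarith
      apply Complex.ext
      · simp [pow_two]; linarith
      · simp [pow_two]; linarith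
    have hsum : ¬ (A ζ = 0 ∧ B ζ = 0) := by
      rintro ⟨a0, b0⟩
      have : L ζ 1 = 0 := by
        have : (2 : ℂ) * L ζ 1 = A ζ + B ζ := by simp only [hA, hB]; ring
        rw [a0, b0, add_zero] at this
        simpa using this
      rw [this, map_zero] at n1'
      exact hc2.ne n1'
    rcases mul_eq_zero.1 hAB with h0 | h0
    · exact Or.inl ⟨h0, fun h1 => hsum ⟨h0, h1⟩⟩
    · exact Or.inr ⟨fun h1 => hsum ⟨h1, h0⟩, h0⟩
  have hcase : (∀ ζ ∈ ball (0 : ℂ) 1, B ζ = 0) ∨ ∀ ζ ∈ ball (0 : ℂ) 1, A ζ = 0 := by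
    have hpre : IsPreconnected (ball (0 : ℂ) 1) := (convex_ball 0 1).isPreconnected
    have oA : IsOpen (ball (0 : ℂ) 1 ∩ A ⁻¹' {0}ᶜ) :=
      hAc.isOpen_inter_preimage isOpen_ball isOpen_compl_singleton
    have oB : IsOpen (ball (0 : ℂ) 1 ∩ B ⁻¹' {0}ᶜ) :=
      hBc.isOpen_inter_preimage isOpen_ball isOpen_compl_singleton
    rcases hpre.subset_or_subset oA oB (by
        rw [Set.disjoint_left]
        rintro ζ ⟨hζ, h1⟩ ⟨-, h2⟩
        rcases hor ζ hζ with h3 | h3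
        · exact h1 h3.1
        · exact h2 h3.2) (by
        intro ζ hζ
        rcases hor ζ hζ with h3 | h3
        · exact Or.inr ⟨hζ, h3.2⟩
        · exact Or.inl ⟨hζ, h3.1⟩) with h1 | h1
    · left
      intro ζ hζ
      rcases hor ζ hζ with h3 | h3
      · exact absurd h3.1 (h1 hζ).2
      · exact h3.2
    · right
      intro ζ hζ
      rcases hor ζ hζ with h3 | h3
      · exact h3.1
      · exact absurd h3.2 (h1 hζ).2
  rcases hcase with hB0 | hA0
  · have hder : ∀ ζ ∈ ball (0 : ℂ) 1, HasDerivAt (f ∘ id) (L ζ 1) ζ := by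
      intro ζ hζ
      have h1 := hd ζ hζ
      have h2 : L ζ = (ContinuousLinearMap.toSpanSingleton ℂ (L ζ 1)).restrictScalars ℝ := by
        ext1 v
        rw [hlin ζ v]
        have h3 : Complex.I * L ζ Complex.I = - L ζ 1 := by
          have := hB0 ζ hζ
          simp only [hB] at this
          linear_combination this
        have h4 : L ζ Complex.I = Complex.I * L ζ 1 := by
          linear_combination (-Complex.I) * h3 + L ζ Complex.I * Complex.I_sq
        simp only [ContinuousLinearMap.coe_restrictScalars',
          ContinuousLinearMap.toSpanSingleton_apply, smul_eq_mul]
        rw [h4]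
        conv_rhs => rw [← Complex.re_add_im v]
        ring
      rw [h2] at h1
      have h5 := (hasFDerivAt_of_restrictScalars ℝ h1 rfl).hasDerivAt
      rwa [ContinuousLinearMap.toSpanSingleton_apply, one_smul] at h5
    refine ⟨id, fun _ => rfl, fun _ => rfl, ?_, ?_⟩
    · exact fun ζ hζ => (hder ζ hζ).differentiableAt.differentiableWithinAt
    · intro ζ hζ
      rw [(hder ζ hζ).deriv, hfc ζ hζ]
      simp
  · have hder : ∀ ζ ∈ ball (0 : ℂ) 1,
        HasDerivAt (f ∘ starRingEnd ℂ) (L ((starRingEnd ℂ) ζ) 1) ζ := by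
      intro ζ hζ
      have h1 := (hd _ (hconj ζ hζ)).comp ζ (Complex.conjCLE.hasFDerivAt (x := ζ))
      have h2 : (L ((starRingEnd ℂ) ζ)).comp (Complex.conjCLE : ℂ →L[ℝ] ℂ) =
          (ContinuousLinearMap.toSpanSingleton ℂ
            (L ((starRingEnd ℂ) ζ) 1)).restrictScalars ℝ := by
        ext1 v
        rw [ContinuousLinearMap.comp_apply, hlin]
        have h3 : Complex.I * L ((starRingEnd ℂ) ζ) Complex.I = L ((starRingEnd ℂ) ζ) 1 := by
          have := hA0 _ (hconj ζ hζ)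
          simp only [hA] at this
          linear_combination -this
        have h4 : L ((starRingEnd ℂ) ζ) Complex.I = -Complex.I * L ((starRingEnd ℂ) ζ) 1 := by
          linear_combination (-Complex.I) * h3 + L ((starRingEnd ℂ) ζ) Complex.I * Complex.I_sq
        simp only [ContinuousLinearMap.coe_restrictScalars', ContinuousLinearEquiv.coe_coe,
          Complex.conjCLE_apply, Complex.conj_re, Complex.conj_im,
          ContinuousLinearMap.toSpanSingleton_apply, smul_eq_mul]
        rw [h4]
        conv_rhs => rw [← Complex.re_add_im v]
        push_cast
        ring
      have h1' : HasFDerivAt (f ∘ starRingEnd ℂ)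
          ((L ((starRingEnd ℂ) ζ)).comp (Complex.conjCLE : ℂ →L[ℝ] ℂ)) ζ := h1
      rw [h2] at h1'
      have h5 := (hasFDerivAt_of_restrictScalars ℝ h1' rfl).hasDerivAt
      rwa [ContinuousLinearMap.toSpanSingleton_apply, one_smul] at h5
    refine ⟨starRingEnd ℂ, Complex.conj_conj, Complex.norm_conj, ?_, ?_⟩
    · exact fun ζ hζ => (hder ζ hζ).differentiableAt.differentiableWithinAt
    · intro ζ hζ
      rw [(hder ζ hζ).deriv, hfc _ (hconj ζ hζ)]
      simp


namespace IsRiemannMap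

theorem contDiffAt_planarEpstein {k f : ℂ → ℂ} {Ω : Set ℂ} (h : IsRiemannMap k f Ω) {z : ℂ}
    (hz : z ∈ Ω) : ContDiffAt ℝ ∞ (planarEpstein (hypDensity k)) z := by
  have hs : ∀ j : ℂ → ℂ, DifferentiableOn ℂ j Ω → ContDiffAt ℝ ∞ j z := fun j hj =>
    ((hj.contDiffOn h.isOpen).contDiffAt (h.isOpen.mem_nhds hz)).restrict_scalars ℝ
  have h1 : ContDiffAt ℝ ∞ (fun w => (w, k w, deriv k w, deriv (deriv k) w)) z :=
    contDiffAt_id.prodMk ((hs k h.differentiableOn).prodMk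
      ((hs _ (h.differentiableOn.deriv h.isOpen)).prodMk
        (hs _ ((h.differentiableOn.deriv h.isOpen).deriv h.isOpen))))
  have h2 : ContDiffAt ℝ ∞ epsteinJet (z, k z, deriv k z, deriv (deriv k) z) :=
    contDiffAt_epsteinJet (h.deriv_ne_zero hz) (h.norm_lt hz)
  refine (h2.comp (f := fun w => (w, k w, deriv k w, deriv (deriv k) w)) z
    h1).congr_of_eventuallyEq ?_
  filter_upwards [h.isOpen.mem_nhds hz] with w hw
  exact planarEpstein_hypDensity (h.hasDerivAt hw) (h.hasDerivAt_deriv hw) (h.deriv_ne_zero hw)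
    (h.norm_lt hw)

end IsRiemannMap

namespace IsFrame

variable {q : S2} {e : ℂ →L[ℝ] E3} {e' : E3 →L[ℝ] ℂ}

/-- In stereographic coordinates, a conformal map of the disk onto a domain of the sphere is, up to
a complex conjugation of the disk, inverse to a Riemann map, and the hyperbolic metrics agree. -/
theorem exists_isRiemannMap (h : IsFrame q e e') {Ω : Set S2} (hΩ : IsOpen Ω) (hq : q ∉ Ω)
    {f : ℂ → S2} (hf : IsConformalOnto f Ω) :
    ∃ k g : ℂ → ℂ, IsRiemannMap k g (h.sphereMap ⁻¹' Ω) ∧ ∀ z, h.sphereMap z ∈ Ω →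
      poincareDensity f (h.sphereMap z) = (hypDensity k z * (1 + ‖z‖ ^ 2) / 2) ^ 2 := by
  set F : ℂ → E3 := fun ζ => (f ζ : E3) with hF
  set φ : ℂ → ℂ := fun ζ => planarCoord q e' (f ζ) with hφ
  have hfq : ∀ ζ ∈ ball (0 : ℂ) 1, f ζ ≠ q := fun ζ hζ h0 => hq (h0 ▸ hf.bijOn.mapsTo hζ)
  have hfφ : ∀ ζ ∈ ball (0 : ℂ) 1, h.sphereMap (φ ζ) = f ζ := fun ζ hζ =>
    h.sphereMap_planarCoord (hfq ζ hζ)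
  have hFs : ∀ ζ ∈ ball (0 : ℂ) 1, ContDiffAt ℝ ∞ F ζ := fun ζ hζ =>
    hf.smooth.contDiffAt (isOpen_ball.mem_nhds hζ)
  have hφs : ∀ ζ ∈ ball (0 : ℂ) 1, ContDiffAt ℝ ∞ φ ζ := by
    intro ζ hζ
    have h1 : ContDiffAt ℝ ∞ (fun x => (fromBall q e' x).1) (F ζ) :=
      contDiffAt_fst.comp (F ζ)
        (contDiffAt_fromBall q e' fun h0 => hfq ζ hζ (Subtype.ext h0))
    exact h1.comp ζ (hFs ζ hζ)
  -- the conformal factors of `F` and `φ`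
  have hnorm : ∀ ζ ∈ ball (0 : ℂ) 1, ‖fderiv ℝ F ζ‖ ≠ 0 ∧
      ∀ v, ‖fderiv ℝ F ζ v‖ = ‖fderiv ℝ F ζ‖ * ‖v‖ := by
    intro ζ hζ
    obtain ⟨c, hc, li, hli⟩ := conformalAt_iff_isConformalMap_fderiv.1 (hf.conformal ζ hζ)
    have h1 : ∀ v, ‖fderiv ℝ F ζ v‖ = ‖c‖ * ‖v‖ := by
      intro v
      have h2 : fderiv ℝ F ζ = c • li.toContinuousLinearMap := hli
      rw [h2]
      simp [norm_smul]
    have h2 : ‖fderiv ℝ F ζ‖ = ‖c‖ := by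
      apply le_antisymm
      · exact ContinuousLinearMap.opNorm_le_bound _ (norm_nonneg _) fun v => (h1 v).le
      · have := (fderiv ℝ F ζ).le_opNorm 1
        rwa [h1, norm_one, mul_one, mul_one] at this
    exact ⟨by rw [h2]; exact norm_ne_zero_iff.2 hc, fun v => by rw [h1, h2]⟩
  have hφn : ∀ ζ ∈ ball (0 : ℂ) 1, ∀ v,
      ‖fderiv ℝ φ ζ v‖ = ‖fderiv ℝ F ζ‖ * (1 + ‖φ ζ‖ ^ 2) / 2 * ‖v‖ := by
    intro ζ hζ v
    have e1 : F =ᶠ[𝓝 ζ] (fun z : ℂ => toBall q e (z, 0)) ∘ φ := by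
      filter_upwards [isOpen_ball.mem_nhds hζ] with η hη
      exact (congrArg Subtype.val (hfφ η hη)).symm
    have e2 := fderiv_comp ζ (differentiable_toBall_zero q e (φ ζ))
      ((hφs ζ hζ).differentiableAt (by simp))
    have e3 := (hnorm ζ hζ).2 v
    rw [e1.fderiv_eq, e2, ContinuousLinearMap.comp_apply, h.norm_fderiv_toBall_zero, ← e2,
      ← e1.fderiv_eq] at e3
    field_simp at e3 ⊢
    linarith
  obtain ⟨τ, hττ, hτn, hτd, hτc⟩ := exists_differentiableOn_comp
    (fun ζ hζ => (hφs ζ hζ).contDiffWithinAt)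
    (c := fun ζ => ‖fderiv ℝ F ζ‖ * (1 + ‖φ ζ‖ ^ 2) / 2)
    (fun ζ hζ => by
      have := (norm_nonneg (fderiv ℝ F ζ)).lt_of_ne' (hnorm ζ hζ).1
      positivity) hφn
  have hτb : ∀ ζ ∈ ball (0 : ℂ) 1, τ ζ ∈ ball (0 : ℂ) 1 := by
    intro ζ hζ
    rw [mem_ball_zero_iff] at hζ ⊢
    rwa [hτn]
  set k : ℂ → ℂ := fun z => τ (Function.invFunOn f (ball 0 1) (h.sphereMap z)) with hk
  have hinv : ∀ z, h.sphereMap z ∈ Ω → Function.invFunOn f (ball 0 1) (h.sphereMap z) ∈ ball 0 1 ∧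
      f (Function.invFunOn f (ball 0 1) (h.sphereMap z)) = h.sphereMap z := fun z hz =>
    ⟨Function.invFunOn_mem (hf.bijOn.surjOn hz), Function.invFunOn_eq (hf.bijOn.surjOn hz)⟩
  have hkm : MapsTo k (h.sphereMap ⁻¹' Ω) (ball 0 1) := fun z hz => hτb _ (hinv z hz).1
  have hleft : LeftInvOn (φ ∘ τ) k (h.sphereMap ⁻¹' Ω) := by
    intro z hz
    simp only [hk, hφ, Function.comp_apply]
    rw [hττ, (hinv z hz).2, h.planarCoord_sphereMap]
  have hmaps : MapsTo (φ ∘ τ) (ball 0 1) (h.sphereMap ⁻¹' Ω) := by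
    intro ζ hζ
    rw [mem_preimage, Function.comp_apply, hfφ _ (hτb ζ hζ)]
    exact hf.bijOn.mapsTo (hτb ζ hζ)
  have hright : ∀ ζ ∈ ball (0 : ℂ) 1, k ((φ ∘ τ) ζ) = ζ := by
    intro ζ hζ
    have h1 := hmaps hζ
    have h2 : f (Function.invFunOn f (ball 0 1) (h.sphereMap ((φ ∘ τ) ζ))) = f (τ ζ) := by
      rw [(hinv _ h1).2, Function.comp_apply, hfφ _ (hτb ζ hζ)]
    simp only [hk]
    rw [hf.bijOn.injOn (hinv _ h1).1 (hτb ζ hζ) h2, hττ]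
  have hopen : IsOpen (h.sphereMap ⁻¹' Ω) := hΩ.preimage h.continuous_sphereMap
  have hkd : ∀ z ∈ h.sphereMap ⁻¹' Ω, HasDerivAt k (deriv (φ ∘ τ) (k z))⁻¹ z := by
    intro z hz
    have hζ := hkm hz
    have h1 : HasStrictDerivAt (φ ∘ τ) (deriv (φ ∘ τ) (k z)) (k z) :=
      (hτd.analyticAt (isOpen_ball.mem_nhds hζ)).hasStrictDerivAt
    have h2 : deriv (φ ∘ τ) (k z) ≠ 0 := by
      rw [← norm_ne_zero_iff, hτc _ hζ]
      have := (norm_nonneg (fderiv ℝ F (τ (k z)))).lt_of_ne' (hnorm _ (hτb _ hζ)).1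
      positivity
    have h3 := h1.to_local_left_inverse h2
      (Filter.eventually_of_mem (isOpen_ball.mem_nhds hζ) hright)
    rw [hleft hz] at h3
    exact h3.hasDerivAt
  refine ⟨k, φ ∘ τ, ⟨hopen, fun z hz => (hkd z hz).differentiableAt.differentiableWithinAt, hkm,
    hτd, hmaps, hleft⟩, ?_⟩
  intro z hz
  have hζ := hkm hz
  have e1 : Function.invFunOn f (ball 0 1) (h.sphereMap z) = τ (k z) := by
    simp only [hk]; rw [hττ]
  have e2 : φ (τ (k z)) = z := hleft hz
  rw [hypDensity, (hkd z hz).deriv, norm_inv, hτc _ hζ, e2, poincareDensity, e1, hτn]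
  have h1 := (norm_nonneg (fderiv ℝ F (τ (k z)))).lt_of_ne' (hnorm _ (hτb _ hζ)).1
  have h2 : 0 < 1 - ‖k z‖ ^ 2 := by
    rw [mem_ball_zero_iff] at hζ
    nlinarith [norm_nonneg (k z)]
  change 4 / ((1 - ‖k z‖ ^ 2) ^ 2 * ‖fderiv ℝ F (τ (k z))‖ ^ 2) = _
  field_simp
  norm_num

end IsFrame

theorem isOpen_of_isComponentOf {Ω A : Set S2} (hA : IsOpen A) (h : IsComponentOf Ω A) :
    IsOpen Ω := by
  obtain ⟨p, -, rfl⟩ := h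
  have : LocallyConnectedSpace S2 :=
    ChartedSpace.locallyConnectedSpace (EuclideanSpace ℝ (Fin 2)) S2
  exact hA.connectedComponentIn


/-! ### Asymptotically conformal curves in stereographic coordinates -/

theorem Function.Periodic.uniformContinuous {X : Type*} [MetricSpace X] {c : ℝ → X}
    (hper : Function.Periodic c 1) (hc : Continuous c) : UniformContinuous c := by
  rw [Metric.uniformContinuous_iff]
  intro ε hε
  have h1 : UniformContinuousOn c (Icc (-1) 2) :=
    isCompact_Icc.uniformContinuousOn_of_continuous hc.continuousOn
  obtain ⟨δ, hδ, h2⟩ := Metric.uniformContinuousOn_iff.1 h1 ε hε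
  refine ⟨min δ 1, by positivity, fun {a b} hab => ?_⟩
  have hshift : ∀ t, c t = c (t - ⌊a⌋) := fun t => by
    simpa using (hper.sub_int_mul_eq (x := t) ⌊a⌋).symm
  rw [hshift a, hshift b]
  rw [Real.dist_eq, abs_lt] at hab
  have m1 := min_le_left δ 1
  have m2 := min_le_right δ 1
  have f1 := Int.floor_le a
  have f2 := Int.lt_floor_add_one a
  apply h2
  · constructor <;> linarith
  · constructor <;> linarith
  · rw [Real.dist_eq, abs_lt]
    constructor <;> linarith

/-- Short arcs of an asymptotically conformal curve are flat: a sufficiently short arc is the subarc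
of smaller diameter between its endpoints. -/
theorem IsAsymptoticallyConformal.exists_isFlatCurve {γ : Set S2}
    (h : IsAsymptoticallyConformal γ) : ∃ c : ℝ → S2, range c = γ ∧ IsFlatCurve c := by
  obtain ⟨c, hc, hγ, hAC⟩ := h
  refine ⟨c, hγ, hc.continuous, hc.periodic, hc.injOn, fun ε hε => ?_⟩
  obtain ⟨δ, hδ, hAC⟩ := hAC ε hε
  have hb : Bornology.IsBounded (range c) := (isCompact_univ.isBounded).subset (subset_univ _)
  have hD : 0 < diam (range c) := by
    have h01 : c 0 ≠ c (1 / 2) := fun h0 => by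
      have := hc.injOn (by norm_num) (by norm_num) h0
      norm_num at this
    exact (dist_pos.2 h01).trans_le (dist_le_diam_of_mem hb (mem_range_self _) (mem_range_self _))
  have huc : UniformContinuous c := hc.periodic.uniformContinuous hc.continuous
  obtain ⟨η, hη, hηc⟩ := Metric.uniformContinuous_iff.1 huc (min δ (diam (range c) / 2))
    (lt_min hδ (by positivity))
  refine ⟨min (η / 2) 1, by positivity, fun s u t hsu hut hts => ?_⟩
  have ht1 : t ≤ s + 1 := hts.trans (by gcongr; exact min_le_right _ _)
  have ht2 : t ≤ s + η / 2 := hts.trans (by gcongr; exact min_le_left _ _)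
  have hclose : ∀ a ∈ Icc s t, ∀ b ∈ Icc s t,
      dist (c a) (c b) < min δ (diam (range c) / 2) := by
    intro a ha b hb
    apply hηc
    rw [Real.dist_eq, abs_lt]
    constructor <;> linarith [ha.1, ha.2, hb.1, hb.2]
  have hst : s ≤ t := hsu.trans hut
  have hdA : diam (c '' Icc s t) ≤ diam (range c) / 2 := by
    refine diam_le_of_forall_dist_le (by positivity) ?_
    rintro _ ⟨a, ha, rfl⟩ _ ⟨b, hb, rfl⟩
    exact ((hclose a ha b hb).trans_le (min_le_right _ _)).le
  have hun : c '' Icc s t ∪ c '' Icc t (s + 1) = range c := by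
    rw [← image_union, Icc_union_Icc_eq_Icc hst ht1]
    exact hc.periodic.image_Icc one_pos s
  have hdu : diam (range c) ≤ diam (c '' Icc s t) + diam (c '' Icc t (s + 1)) := by
    rw [← hun]
    exact diam_union' ⟨c t, mem_image_of_mem c ⟨hst, le_rfl⟩, mem_image_of_mem c ⟨le_rfl, ht1⟩⟩
  exact hAC s t hst ht1 ((hclose s ⟨le_rfl, hst⟩ t ⟨hst, le_rfl⟩).trans_le (min_le_left _ _))
    (by linarith) (c u) (mem_image_of_mem c ⟨hsu, hut⟩)

namespace IsFrame

variable {q : S2} {e : ℂ →L[ℝ] E3} {e' : E3 →L[ℝ] ℂ}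

theorem continuousOn_planarCoord (q : S2) (e' : E3 →L[ℝ] ℂ) :
    ContinuousOn (planarCoord q e') {q}ᶜ := fun _ hp =>
  (contMDiffAt_planarCoord hp).continuousAt.continuousWithinAt

theorem injOn_planarCoord (h : IsFrame q e e') : InjOn (planarCoord q e') {q}ᶜ := by
  intro a ha b hb hab
  rw [← h.sphereMap_planarCoord ha, hab, h.sphereMap_planarCoord hb]

theorem dist_planarCoord (h : IsFrame q e e') {a b : S2} (ha : a ≠ q) (hb : b ≠ q) :
    dist (planarCoord q e' a) (planarCoord q e' b) =
      √(1 + ‖planarCoord q e' a‖ ^ 2) * √(1 + ‖planarCoord q e' b‖ ^ 2) / 2 * dist a b := by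
  have h1 := h.dist_sq_sphereMap (planarCoord q e' a) (planarCoord q e' b)
  rw [h.sphereMap_planarCoord ha, h.sphereMap_planarCoord hb] at h1
  have h2 : 0 < 1 + ‖planarCoord q e' a‖ ^ 2 := by positivity
  have h3 : 0 < 1 + ‖planarCoord q e' b‖ ^ 2 := by positivity
  rw [← sq_eq_sq₀ dist_nonneg (by positivity), mul_pow, h1, div_pow, mul_pow, Real.sq_sqrt h2.le,
    Real.sq_sqrt h3.le]
  field_simp
  norm_num

/-- Flatness of a curve is not affected by a conformal change of the metric. -/
theorem isFlatCurve_planarCoord (h : IsFrame q e e') {c : ℝ → S2} (hc : IsFlatCurve c)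
    (hq : q ∉ range c) : IsFlatCurve (planarCoord q e' ∘ c) := by
  have hcq : ∀ t, c t ≠ q := fun t h0 => hq ⟨t, h0⟩
  have hcont : Continuous (planarCoord q e' ∘ c) :=
    continuous_iff_continuousAt.2 fun t =>
      (contMDiffAt_planarCoord (hcq t)).continuousAt.comp hc.continuous.continuousAt
  have hper : Function.Periodic (planarCoord q e' ∘ c) 1 := fun t =>
    congrArg (planarCoord q e') (hc.periodic t)
  refine ⟨hcont, hper, fun a ha b hb hab => hc.injOn ha hb
    (h.injOn_planarCoord (hcq a) (hcq b) hab), fun ε hε => ?_⟩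
  set m : ℝ → ℝ := fun t => √(1 + ‖(planarCoord q e' ∘ c) t‖ ^ 2) with hm
  have hm1 : ∀ t, 1 ≤ m t := fun t => by
    rw [hm, Real.one_le_sqrt]; linarith [sq_nonneg ‖(planarCoord q e' ∘ c) t‖]
  have hmper : Function.Periodic m 1 := fun t => by simp only [hm]; rw [hper t]
  have hmc : Continuous m := by fun_prop
  have huc : UniformContinuous m := hmper.uniformContinuous hmc
  obtain ⟨ε', hε'⟩ : ∃ ε', ε' = min 1 (ε / 3) := ⟨_, rfl⟩
  have hε0 : 0 < ε' := by rw [hε']; positivity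
  have hε1 : ε' ≤ 1 := by rw [hε']; exact min_le_left _ _
  have hε3 : ε' ≤ ε / 3 := by rw [hε']; exact min_le_right _ _
  obtain ⟨η₁, hη₁, hη⟩ := Metric.uniformContinuous_iff.1 huc ε' hε0
  obtain ⟨η₂, hη₂, hflat⟩ := hc.flat ε' hε0
  refine ⟨min (η₁ / 2) η₂, by positivity, fun s u t hsu hut hts => ?_⟩
  have ht1 : t ≤ s + η₁ / 2 := hts.trans (by gcongr; exact min_le_left _ _)
  have ht2 : t ≤ s + η₂ := hts.trans (by gcongr; exact min_le_right _ _)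
  have hle : ∀ a ∈ Icc s t, m u ≤ (1 + ε') * m a := by
    intro a ha
    have h1 := hη (a := u) (b := a) (by
      rw [Real.dist_eq, abs_lt]; constructor <;> linarith [ha.1, ha.2])
    rw [Real.dist_eq, abs_lt] at h1
    nlinarith [hm1 a, h1.2]
  have hs := hle s ⟨le_rfl, hsu.trans hut⟩
  have ht := hle t ⟨hsu.trans hut, le_rfl⟩
  have h0 := hflat s u t hsu hut ht2
  simp only [Function.comp_apply]
  rw [h.dist_planarCoord (hcq s) (hcq u), h.dist_planarCoord (hcq u) (hcq t),
    h.dist_planarCoord (hcq s) (hcq t)]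
  change m s * m u / 2 * _ + m u * m t / 2 * _ ≤ (1 + ε) * (m s * m t / 2 * _)
  have p1 : 0 < m s := zero_lt_one.trans_le (hm1 s)
  have p2 : 0 < m t := zero_lt_one.trans_le (hm1 t)
  calc m s * m u / 2 * dist (c s) (c u) + m u * m t / 2 * dist (c u) (c t)
      ≤ m s * ((1 + ε') * m t) / 2 * dist (c s) (c u) +
        (1 + ε') * m s * m t / 2 * dist (c u) (c t) := by gcongr
    _ = (1 + ε') * (m s * m t / 2) * (dist (c s) (c u) + dist (c u) (c t)) := by ring
    _ ≤ (1 + ε') * (m s * m t / 2) * ((1 + ε') * dist (c s) (c t)) := by gcongr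
    _ = (1 + ε') * (1 + ε') * (m s * m t / 2 * dist (c s) (c t)) := by ring
    _ ≤ (1 + ε) * (m s * m t / 2 * dist (c s) (c t)) := by
        gcongr
        nlinarith

end IsFrame

theorem IsComponentOf.eq_connectedComponentIn {Ω A : Set S2} (h : IsComponentOf Ω A) {p : S2}
    (hp : p ∈ Ω) : Ω = connectedComponentIn A p := by
  obtain ⟨x, -, rfl⟩ := h
  exact connectedComponentIn_eq hp

theorem IsComponentOf.subset {Ω A : Set S2} (h : IsComponentOf Ω A) : Ω ⊆ A := by
  obtain ⟨x, -, rfl⟩ := h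
  exact connectedComponentIn_subset _ _

theorem IsComponentOf.disjoint {Ω Ω' A : Set S2} (h : IsComponentOf Ω A) (h' : IsComponentOf Ω' A)
    (hne : Ω ≠ Ω') : Disjoint Ω Ω' := by
  rw [Set.disjoint_left]
  exact fun p hp hp' =>
    hne ((h.eq_connectedComponentIn hp).trans (h'.eq_connectedComponentIn hp').symm)

theorem IsComponentOf.nonempty {Ω A : Set S2} (h : IsComponentOf Ω A) : Ω.Nonempty := by
  obtain ⟨x, hx, rfl⟩ := h
  exact ⟨x, mem_connectedComponentIn hx⟩

theorem IsComponentOf.isClosed_union {Ω γ : Set S2} (h : IsComponentOf Ω γᶜ) (hγ : IsClosed γ) :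
    IsClosed (Ω ∪ γ) := by
  rw [← isOpen_compl_iff, isOpen_iff_mem_nhds]
  intro p hp
  rw [mem_compl_iff, mem_union, not_or] at hp
  have hC : IsComponentOf (connectedComponentIn γᶜ p) γᶜ := ⟨p, hp.2, rfl⟩
  have hpC : p ∈ connectedComponentIn γᶜ p := mem_connectedComponentIn hp.2
  have hdis := hC.disjoint h fun h0 => hp.1 (h0 ▸ hpC)
  refine Filter.mem_of_superset ((isOpen_of_isComponentOf hγ.isOpen_compl hC).mem_nhds hpC) ?_
  intro x hx hx'
  rcases hx' with h1 | h1
  · exact Set.disjoint_left.1 hdis hx h1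
  · exact hC.subset hx h1

theorem IsFrame.isPlanarComponent {q : S2} {e : ℂ →L[ℝ] E3} {e' : E3 →L[ℝ] ℂ}
    (h : IsFrame q e e') {Ω : Set S2} {c : ℝ → S2} (hc : IsClosed (range c))
    (hΩ : IsComponentOf Ω (range c)ᶜ) (hqΩ : q ∉ Ω) (hqc : q ∉ range c) :
    IsPlanarComponent (h.sphereMap ⁻¹' Ω) (range (planarCoord q e' ∘ c)) := by
  have hopen : IsOpen Ω := isOpen_of_isComponentOf hc.isOpen_compl hΩ
  refine ⟨hopen.preimage h.continuous_sphereMap, ?_, ?_, ?_⟩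
  · have himg : h.sphereMap ⁻¹' Ω = planarCoord q e' '' Ω := by
      ext z
      constructor
      · exact fun hz => ⟨_, hz, h.planarCoord_sphereMap z⟩
      · rintro ⟨p, hp, rfl⟩
        rw [mem_preimage, h.sphereMap_planarCoord fun h0 => hqΩ (h0 ▸ hp)]
        exact hp
    rw [himg]
    have hpre : IsPreconnected Ω := by
      obtain ⟨x, -, hx⟩ := hΩ
      rw [hx]; exact isPreconnected_connectedComponentIn
    exact hpre.image _ ((IsFrame.continuousOn_planarCoord q e').mono
      fun p hp h0 => hqΩ (h0 ▸ hp))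
  · rw [Set.disjoint_left]
    rintro _ hz ⟨t, rfl⟩
    rw [mem_preimage, Function.comp_apply, h.sphereMap_planarCoord fun h0 => hqc ⟨t, h0⟩] at hz
    exact hΩ.subset hz (mem_range_self t)
  · rintro A hA hAc ⟨z, hzA, hzΩ⟩
    rw [← image_subset_iff, hΩ.eq_connectedComponentIn hzΩ]
    refine (hA.image _ h.continuous_sphereMap.continuousOn).subset_connectedComponentIn
      (mem_image_of_mem _ hzA) ?_
    rintro _ ⟨w, hw, rfl⟩ ⟨t, ht⟩
    refine Set.disjoint_left.1 hAc hw ⟨t, ?_⟩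
    rw [Function.comp_apply, ht, h.planarCoord_sphereMap]

/-! ### The two sides of the curve -/

theorem IsImmersionEmbeddingOn.mono {E : S2 → E3} {W W' : Set S2} (h : IsImmersionEmbeddingOn E W)
    (hW : W' ⊆ W) : IsImmersionEmbeddingOn E W' :=
  ⟨h.mapsTo.mono_left hW, h.smooth.mono hW, fun p hp => h.immersion p (hW hp),
    h.embedding.comp (.inclusion hW)⟩

theorem IsFrame.norm_toBall_sub_toBall_le {q : S2} {e : ℂ →L[ℝ] E3} {e' : E3 →L[ℝ] ℂ}
    (h : IsFrame q e e') {X Y : ℂ × ℝ} (hX : 0 ≤ X.2) (hY : 0 ≤ Y.2) :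
    ‖toBall q e X - toBall q e Y‖ ≤ 3 * ‖X - Y‖ := by
  have h1 := h.norm_sq_toBall_sub_toBall hX hY
  have hD : 1 ≤ ‖X.1‖ ^ 2 + (1 + X.2) ^ 2 := by nlinarith [sq_nonneg ‖X.1‖]
  have hD' : 1 ≤ ‖Y.1‖ ^ 2 + (1 + Y.2) ^ 2 := by nlinarith [sq_nonneg ‖Y.1‖]
  have n1 : ‖X.1 - Y.1‖ ≤ ‖X - Y‖ := norm_fst_le (X - Y)
  have n2 : |X.2 - Y.2| ≤ ‖X - Y‖ := norm_snd_le (X - Y)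
  have n3 : (X.2 - Y.2) ^ 2 ≤ ‖X - Y‖ ^ 2 := by
    rw [← sq_abs]; gcongr
  have n4 : ‖X.1 - Y.1‖ ^ 2 ≤ ‖X - Y‖ ^ 2 := by gcongr
  refine le_of_sq_le_sq ?_ (by positivity)
  rw [h1, div_le_iff₀ (by positivity)]
  have hDD : 1 ≤ (‖X.1‖ ^ 2 + (1 + X.2) ^ 2) * (‖Y.1‖ ^ 2 + (1 + Y.2) ^ 2) := by nlinarith
  nlinarith [sq_nonneg ‖X - Y‖, mul_nonneg (sq_nonneg ‖X - Y‖) (sub_nonneg.2 hDD)]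

/-- The behaviour of the Epstein–Poincaré map near the curve, on one side of it: stereographic
projection from a point of the other side reduces it to `exists_planarEpstein_injOn`. -/
theorem exists_isImmersionEmbeddingOn {γ Ω : Set S2} (hγ : IsAsymptoticallyConformal γ)
    (hΩ : IsComponentOf Ω γᶜ) {q : S2} (hqγ : q ∉ γ) (hqΩ : q ∉ Ω) {f : ℂ → S2}
    (hf : IsConformalOnto f Ω) :
    (∃ U : Set S2, IsOpen U ∧ γ ⊆ U ∧ IsImmersionEmbeddingOn (epsteinPoincareMap Ω f) (U ∩ Ω)) ∧
      ExtendsByIdentity (epsteinPoincareMap Ω f) Ω γ := by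
  obtain ⟨c, rfl, hc⟩ := hγ.exists_isFlatCurve
  have hclosed : IsClosed (range c) := by
    rw [← hc.periodic.image_Icc one_pos 0]
    exact (isCompact_Icc.image hc.continuous).isClosed
  obtain ⟨e, e', h⟩ := exists_isFrame q
  have hopen : IsOpen Ω := isOpen_of_isComponentOf hclosed.isOpen_compl hΩ
  obtain ⟨k, g, hk, hρ⟩ := h.exists_isRiemannMap hopen hqΩ hf
  obtain ⟨δ, hδ, hdist, hinj, himm⟩ := exists_planarEpstein_injOn
    (h.isFlatCurve_planarCoord hc hqγ) (h.isPlanarComponent hclosed hΩ hqΩ hqγ) hk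
  obtain ⟨hE, hEeq⟩ := h.epsteinMap_spec hopen hqΩ (fun z hz => hk.hypDensity_pos hz) hρ
    fun z hz => hk.contDiffAt_planarEpstein hz
  change IsEpsteinMap Ω _ (epsteinPoincareMap Ω f) at hE
  change ∀ z, h.sphereMap z ∈ Ω → epsteinPoincareMap Ω f (h.sphereMap z) = _ at hEeq
  set E := epsteinPoincareMap Ω f with hEd
  set d : S2 → ℝ := fun p => infDist (planarCoord q e' p) (range (planarCoord q e' ∘ c)) with hd
  have hdc : ContinuousOn d {q}ᶜ :=
    (continuous_infDist_pt _).comp_continuousOn (IsFrame.continuousOn_planarCoord q e')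
  have hdγ : ∀ p ∈ range c, d p = 0 := by
    rintro _ ⟨t, rfl⟩
    exact infDist_zero_of_mem (mem_range_self t)
  have hlift : ∀ p ∈ Ω, ∃ z, h.sphereMap z = p := fun p hp =>
    ⟨_, h.sphereMap_planarCoord (fun h0 => hqΩ (h0 ▸ hp))⟩
  have hball : ∀ p ∈ Ω, E p ∈ ball (0 : E3) 1 := fun p hp => (hE.mem_horosphere p hp).1
  have hpos : ∀ z, h.sphereMap z ∈ Ω → 0 < (planarEpstein (hypDensity k) z).2 := fun z hz =>
    planarEpstein_snd_pos (hk.hypDensity_pos hz)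
  -- the extension by the identity
  classical
  set F : S2 → E3 := fun p => if p ∈ Ω then E p else p with hF
  have hFΩ : EqOn F E Ω := fun p hp => if_pos hp
  have hFγ : ∀ p ∈ range c, F p = p := fun p hp => if_neg fun h0 => hΩ.subset h0 hp
  have hFd : ∀ p ∈ Ω ∪ range c, d p < δ → ‖F p - p‖ ≤ 6 * d p := by
    rintro p (hp | hp) hpd
    · obtain ⟨z, rfl⟩ := hlift p hp
      have hdz : d (h.sphereMap z) = infDist z (range (planarCoord q e' ∘ c)) := by
        simp only [hd]; rw [h.planarCoord_sphereMap]
      rw [hdz] at hpd ⊢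
      have h1 := hdist z hp hpd
      rw [hFΩ hp, hEeq z hp]
      have h2 := h.norm_toBall_sub_toBall_le (Y := (z, 0)) (hpos z hp).le le_rfl
      change ‖toBall q e _ - toBall q e (z, 0)‖ ≤ _
      linarith
    · rw [hFγ p hp, hdγ p hp]; simp
  have hFc : ContinuousOn F (Ω ∪ range c) := by
    rintro p (hp | hp)
    · have h1 : ContinuousAt E p := (hE.smooth.contMDiffAt (hopen.mem_nhds hp)).continuousAt
      refine (h1.congr ?_).continuousWithinAt
      filter_upwards [hopen.mem_nhds hp] with x hx using (hFΩ hx).symm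
    · have hpq : p ≠ q := fun h0 => hqγ (h0 ▸ hp)
      have h1 : Filter.Tendsto d (𝓝[Ω ∪ range c] p) (𝓝 0) := by
        have := (hdc.continuousAt (isOpen_compl_singleton.mem_nhds hpq)).tendsto
        rw [hdγ p hp] at this
        exact this.mono_left nhdsWithin_le_nhds
      have h2 : Filter.Tendsto (fun x => F x - x) (𝓝[Ω ∪ range c] p) (𝓝 0) := by
        refine squeeze_zero_norm' ?_ (by simpa using h1.const_mul 6)
        filter_upwards [self_mem_nhdsWithin, h1.eventually (gt_mem_nhds hδ)] with x hx hxd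
        exact hFd x hx hxd
      have h3 : Filter.Tendsto (fun x : S2 => (x : E3)) (𝓝[Ω ∪ range c] p) (𝓝 p) :=
        continuous_subtype_val.continuousAt.continuousWithinAt
      rw [ContinuousWithinAt, hFγ p hp]
      simpa using h2.add h3
  refine ⟨⟨{q}ᶜ ∩ d ⁻¹' Iio (δ / 2), hdc.isOpen_inter_preimage isOpen_compl_singleton isOpen_Iio,
    ?_, ?_, ?_, ?_, ?_⟩, F, hFc, hFΩ, hFγ⟩
  · intro p hp
    refine ⟨fun h0 => hqγ (h0 ▸ hp), ?_⟩
    rw [mem_preimage, hdγ p hp, mem_Iio]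
    positivity
  · exact fun p hp => hball p hp.2
  · exact hE.smooth.mono inter_subset_right
  · rintro p ⟨⟨-, hpd⟩, hp⟩
    obtain ⟨z, rfl⟩ := hlift p hp
    have hdz : infDist z (range (planarCoord q e' ∘ c)) < δ := by
      simp only [hd, mem_preimage, mem_Iio] at hpd
      rw [h.planarCoord_sphereMap] at hpd
      linarith
    have hEs : ContMDiffAt (𝓡 2) 𝓘(ℝ, E3) ∞ E (h.sphereMap z) :=
      hE.smooth.contMDiffAt (hopen.mem_nhds hp)
    refine h.mfderiv_injective (hEs.mdifferentiableAt (by simp)) ?_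
    have hEψ : DifferentiableAt ℝ (E ∘ h.sphereMap) z :=
      (h.contDiffAt_comp_sphereMap hEs).differentiableAt (by simp)
    have hEz : (E ∘ h.sphereMap) z ≠ q := by
      rw [Function.comp_apply, hEeq z hp]
      exact h.toBall_ne (hpos z hp).le
    have hfb : DifferentiableAt ℝ (fromBall q e') ((E ∘ h.sphereMap) z) :=
      (IsFrame.contDiffAt_fromBall q e' (n := 1) hEz).differentiableAt (by simp)
    have hcomp : HasFDerivAt (planarEpstein (hypDensity k)) _ z :=
      (hfb.hasFDerivAt.comp z hEψ.hasFDerivAt).congr_of_eventuallyEq (by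
        filter_upwards [(hopen.preimage h.continuous_sphereMap).mem_nhds hp] with w hw
        simp only [Function.comp_apply]
        rw [hEeq w hw, h.fromBall_toBall (hpos w hw).le])
    have := himm z hp hdz _ hcomp
    rw [ContinuousLinearMap.coe_comp] at this
    exact this.of_comp
  · -- a continuous injective map on a compact set is an embedding
    set K : Set S2 := (Ω ∪ range c) ∩ d ⁻¹' Iic (δ / 2) with hK
    have hKq : Ω ∪ range c ⊆ {q}ᶜ := by
      rintro p (hp | hp) h0
      · exact hqΩ (h0 ▸ hp)
      · exact hqγ (h0 ▸ hp)
    have hKc : IsCompact K :=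
      ((hdc.mono hKq).preimage_isClosed_of_isClosed (hΩ.isClosed_union hclosed)
        isClosed_Iic).isCompact
    have hnorm : ∀ p ∈ Ω, ∀ p' ∈ range c, F p ≠ F p' := by
      intro p hp p' hp' h0
      rw [hFΩ hp, hFγ p' hp'] at h0
      have := hball p hp
      rw [h0, mem_ball_zero_iff, norm_eq_of_mem_sphere p'] at this
      exact lt_irrefl _ this
    have hFinj : InjOn F K := by
      rintro p ⟨hp, hpd⟩ p' ⟨hp', hpd'⟩ hpp
      rcases hp with hp | hp <;> rcases hp' with hp' | hp'
      · rw [hFΩ hp, hFΩ hp'] at hpp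
        obtain ⟨z, rfl⟩ := hlift p hp
        obtain ⟨z', rfl⟩ := hlift p' hp'
        rw [hEeq z hp, hEeq z' hp'] at hpp
        have h1 := congrArg (fromBall q e') hpp
        rw [h.fromBall_toBall (hpos z hp).le, h.fromBall_toBall (hpos z' hp').le] at h1
        simp only [hd, mem_preimage, mem_Iic, h.planarCoord_sphereMap] at hpd hpd'
        rw [hinj ⟨hp, by linarith⟩ ⟨hp', by linarith⟩ h1]
      · exact absurd hpp (hnorm p hp p' hp')
      · exact absurd hpp.symm (hnorm p' hp' p hp)
      · rw [hFγ p hp, hFγ p' hp'] at hpp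
        exact Subtype.ext hpp
    have : CompactSpace K := isCompact_iff_compactSpace.1 hKc
    have hemb : IsEmbedding (K.domRestrict F) :=
      ((hFc.mono inter_subset_left).domRestrict.isClosedEmbedding
        (injOn_iff_injective.1 hFinj)).isEmbedding
    have hWK : {q}ᶜ ∩ d ⁻¹' Iio (δ / 2) ∩ Ω ⊆ K := fun p hp =>
      ⟨Or.inl hp.2, (le_of_lt hp.1.2 : d p ≤ δ / 2)⟩
    have heq : ({q}ᶜ ∩ d ⁻¹' Iio (δ / 2) ∩ Ω).domRestrict E =
        K.domRestrict F ∘ inclusion hWK := by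
      funext p
      exact (hFΩ p.2.2).symm
    rw [heq]
    exact hemb.comp (.inclusion hWK)

theorem mainTheorem5 (γ Ω Ωs : Set S2) (hγ : IsAsymptoticallyConformal γ)
    (hΩ : IsComponentOf Ω γᶜ) (hΩs : IsComponentOf Ωs γᶜ) (hne : Ω ≠ Ωs)
    (f g : ℂ → S2) (hf : IsConformalOnto f Ω) (hg : IsConformalOnto g Ωs) :
    (∃ U : Set S2, IsOpen U ∧ γ ⊆ U ∧
      IsImmersionEmbeddingOn (epsteinPoincareMap Ω f) (U ∩ Ω) ∧
      IsImmersionEmbeddingOn (epsteinPoincareMap Ωs g) (U ∩ Ωs)) ∧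
    ExtendsByIdentity (epsteinPoincareMap Ω f) Ω γ ∧
    ExtendsByIdentity (epsteinPoincareMap Ωs g) Ωs γ := by
  have hdis := hΩ.disjoint hΩs hne
  obtain ⟨q, hq⟩ := hΩs.nonempty
  obtain ⟨q', hq'⟩ := hΩ.nonempty
  obtain ⟨⟨U, hU, hγU, hEU⟩, hext⟩ := exists_isImmersionEmbeddingOn hγ hΩ
    (hΩs.subset hq) (Set.disjoint_right.1 hdis hq) hf
  obtain ⟨⟨V, hV, hγV, hEV⟩, hexts⟩ := exists_isImmersionEmbeddingOn hγ hΩs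
    (hΩ.subset hq') (Set.disjoint_left.1 hdis hq') hg
  exact ⟨⟨U ∩ V, hU.inter hV, subset_inter hγU hγV,
    hEU.mono (inter_subset_inter_left _ inter_subset_left),
    hEV.mono (inter_subset_inter_left _ inter_subset_right)⟩, hext, hexts⟩
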